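/- Work in one of the following settings: smooth real manifolds and Lie groups; real or complex analytic manifolds and Lie groups; non-singular affine varieties and affine algebraic groups over a field of characteristic zero. Let $\mathbb K$ be the ground field, $G$ a group with Lie algebra $\mathfrak g$ (bracket of left invariant vector fields), and $\mathcal H=\sum u_j\otimes v_j\in\mathfrak g\otimes\mathfrak g$ an $\mathrm{Ad}$-invariant symmetric $2$-tensor. For a left action on $M$, let $X_M(q)=\frac{d}{dt}\big|_{0}\exp(-tX)q$ denote the fundamental vector field of $X$, and write $\mathrm{fund}_M(X)=X_M$; let $L_q(X)=\frac{d}{dt}\big|_0 q\exp(tX)$ and $R_q(X)=\frac{d}{dt}\big|_0\exp(tX)q$ for $q\in G$. Write $u\wedge v=u\otimes v-v\otimes u$, and let $[\cdot,\cdot]$ be the Schouten bracket, with $[X_1\wedge X_2,Y_1\wedge Y_2]=[X_1,Y_1]\wedge X_2\wedge Y_2-[X_1,Y_2]\wedge X_2\wedge Y_1-[X_2,Y_1]\wedge X_1\wedge Y_2+[X_2,Y_2]\wedge X_1\wedge Y_1$. Let $$\phi_{\mathcal H}=-\tfrac12(\mathrm{Id}\otimes[\cdot,\cdot]\otimes\mathrm{Id})(\mathcal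 H\otimes\mathcal H)\in\mathfrak g\otimes\mathfrak g\otimes\mathfrak g .$$ A $G$-invariant bivector $P$ on a $G$-manifold $M$ is $G$-quasi Poisson relative to $\mathcal H$ if $[P,P]=\phi_{\mathcal H,M}$, the image of $\phi_{\mathcal H}$ under the infinitesimal action. A $G$-momentum mapping for $P$ relative to $\mathcal H$ is an admissible (smooth, analytic or algebraic) map $\Phi\colon M\to G$, equivariant with respect to conjugation, such that at every point $(d\Phi\otimes\mathrm{Id})(P)=\big(\tfrac12(L_\Phi+R_\Phi)\otimes\mathrm{fund}_M\big)(\mathcal H)$. Let $G^\times=G\times G$, with Lie algebra $\mathfrak g^\times=\mathfrak g^1\oplus\mathfrak g^2$, let $\mathcal H^\times=\mathcal H^1+\mathcal H^2\in\mathfrak g^\times\otimes\mathfrak g^\times$ be the sum of the two copies of $\mathcal H$, and let $\chi_{\mathcal H}=\tfrac12\sum u_j^1\wedge v_j^2$. Let $M$ be a $G^\times$-manifold, $P$ a $G^\times$-invariant bivector on $M$, and $P_{\rm fus}=P-\chi_{\mathcal H,M}$, where $\chi_{\mathcal H,M}$ is the image of $\chi_{\mathcal H}$ under the infinitesimal $\mathfrak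 g^\times$-action. (1) If $(\Phi^1,\Phi^2)\colon M\to G\times G$ is a $G^\times$-momentum mapping for $P$ relative to $\mathcal H^\times$, then, with respect to the diagonal $G$-action on $M$, the bivector $P_{\rm fus}$ is $G$-invariant and the pointwise product $\Phi^1\Phi^2\colon M\to G$ is a $G$-momentum mapping for $P_{\rm fus}$ relative to $\mathcal H$. (2) If $P$ is a $G^\times$-quasi Poisson structure relative to $\mathcal H^\times$, then, with respect to the diagonal $G$-action on $M$, $P_{\rm fus}$ is a $G$-quasi Poisson structure relative to $\mathcal H$. -/

import Mathlib

open scoped Manifold ContDiff TensorProduct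

noncomputable section

/-! ### Multilinear algebra -/

namespace QPoisson

section Tensors

variable {k : Type*} [Field k] {L V W : Type*} [AddCommMonoid L] [Module k L]
  [AddCommMonoid V] [Module k V] [AddCommMonoid W] [Module k W]
  {B : Type*} [CommRing B] [Algebra k B]

/-- `u ⊗ v ↦ a u * b v`. -/
def eval₂ (a b : V →ₗ[k] B) : V ⊗[k] V →ₗ[k] B :=
  LinearMap.mul' k B ∘ₗ TensorProduct.map a b

/-- `u ⊗ v ⊗ w ↦ a u * (b v * c w)`. -/
def eval₃ (a b c : V →ₗ[k] B) : V ⊗[k] (V ⊗[k] V) →ₗ[k] B :=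
  LinearMap.mul' k B ∘ₗ TensorProduct.map a (eval₂ b c)

/-- `u ⊗ v ⊗ w ↦ T u ⊗ T v ⊗ T w`. -/
def push₃ (T : V →ₗ[k] W) : V ⊗[k] (V ⊗[k] V) →ₗ[k] W ⊗[k] (W ⊗[k] W) :=
  TensorProduct.map T (TensorProduct.map T T)

/-- The map `Id ⊗ [·,·] ⊗ Id : L ⊗ L ⊗ L ⊗ L → L ⊗ L ⊗ L`. -/
def midBracket (br : L →ₗ[k] L →ₗ[k] L) :
    (L ⊗[k] L) ⊗[k] (L ⊗[k] L) →ₗ[k] L ⊗[k] (L ⊗[k] L) :=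
  (TensorProduct.map LinearMap.id
      ((TensorProduct.map (TensorProduct.lift br) LinearMap.id) ∘ₗ
        (TensorProduct.assoc k L L L).symm.toLinearMap)) ∘ₗ
    (TensorProduct.assoc k L L (L ⊗[k] L)).toLinearMap

/-- The Cartan element `φ_H = -½ (Id ⊗ [·,·] ⊗ Id)(H ⊗ H)`. For `H = ∑ e_a ⊗ e_a` this is
`(1/12) ∑ f_abc e_a ∧ e_b ∧ e_c` where `[e_a, e_b] = ∑ f_abc e_c`. -/
def cartanElement (br : L →ₗ[k] L →ₗ[k] L) (H : L ⊗[k] L) : L ⊗[k] (L ⊗[k] L) :=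
  (-(2 : k)⁻¹) • midBracket br (H ⊗ₜ[k] H)

/-- `H^× = H¹ + H²`, for the inclusions `i₁`, `i₂` of the two copies of `L`. -/
def doubled (i₁ i₂ : L →ₗ[k] V) (H : L ⊗[k] L) : V ⊗[k] V :=
  TensorProduct.map i₁ i₁ H + TensorProduct.map i₂ i₂ H

/-- `χ_H = ½ ∧(H)`, where `∧ (u ⊗ v) = u¹ ∧ v² = u¹ ⊗ v² - v² ⊗ u¹`. -/
def chi {V : Type*} [AddCommGroup V] [Module k V] (i₁ i₂ : L →ₗ[k] V) (H : L ⊗[k] L) : V ⊗[k] V :=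
  (2 : k)⁻¹ • (TensorProduct.map i₁ i₂ H -
    TensorProduct.comm k V V (TensorProduct.map i₁ i₂ H))

end Tensors

/-! ### Smooth and analytic manifolds -/

section Manifolds

variable {𝕜 : Type*} [RCLike 𝕜]
  {E : Type*} [NormedAddCommGroup E] [NormedSpace 𝕜 E]
  {HG : Type*} [TopologicalSpace HG] (I : ModelWithCorners 𝕜 E HG)
  {G : Type*} [TopologicalSpace G] [ChartedSpace HG G] [Group G]
  {F : Type*} [NormedAddCommGroup F] [NormedSpace 𝕜 F]
  {HM : Type*} [TopologicalSpace HM] (J : ModelWithCorners 𝕜 F HM)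
  {M : Type*} [TopologicalSpace M] [ChartedSpace HM M]

/-- Left translation `L_g : 𝔤 → T_g G`. -/
def leftTrans (g : G) : GroupLieAlgebra I G →ₗ[𝕜] TangentSpace I g :=
  (mfderiv I I (fun x : G => g * x) 1 :
    GroupLieAlgebra I G →L[𝕜] TangentSpace I (g * 1)).toLinearMap

/-- Right translation `R_g : 𝔤 → T_g G`. -/
def rightTrans (g : G) : GroupLieAlgebra I G →ₗ[𝕜] TangentSpace I g :=
  (mfderiv I I (fun x : G => x * g) 1 :
    GroupLieAlgebra I G →L[𝕜] TangentSpace I (1 * g)).toLinearMap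

/-- The adjoint action `Ad_g : 𝔤 → 𝔤`. -/
def Ad (g : G) : GroupLieAlgebra I G →ₗ[𝕜] GroupLieAlgebra I G :=
  (mfderiv I I (fun x : G => g * x * g⁻¹) 1 :
    GroupLieAlgebra I G →L[𝕜] TangentSpace I (g * 1 * g⁻¹)).toLinearMap

/-- An `Ad`-invariant symmetric `2`-tensor in `𝔤 ⊗ 𝔤`. -/
structure IsInvSymm (H : GroupLieAlgebra I G ⊗[𝕜] GroupLieAlgebra I G) : Prop where
  symm : TensorProduct.comm 𝕜 _ _ H = H
  inv : ∀ g : G, TensorProduct.map (Ad I g) (Ad I g) H = H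

variable (G) in
/-- The differential at the identity of `g ↦ (g, 1)`. -/
def incl₁ : GroupLieAlgebra I G →ₗ[𝕜] GroupLieAlgebra (I.prod I) (G × G) :=
  (mfderiv I (I.prod I) (fun x : G => (x, (1 : G))) 1 :
    GroupLieAlgebra I G →L[𝕜] TangentSpace (I.prod I) ((1 : G), (1 : G))).toLinearMap

variable (G) in
/-- The differential at the identity of `g ↦ (1, g)`. -/
def incl₂ : GroupLieAlgebra I G →ₗ[𝕜] GroupLieAlgebra (I.prod I) (G × G) :=
  (mfderiv I (I.prod I) (fun x : G => ((1 : G), x)) 1 :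
    GroupLieAlgebra I G →L[𝕜] TangentSpace (I.prod I) ((1 : G), (1 : G))).toLinearMap

variable (G) in
/-- The Lie bracket of `𝔤` (the bracket of left invariant vector fields) as a bilinear map. -/
def lieBr (n : WithTop ℕ∞) (hn : ∞ ≤ n) [LieGroup I n G] [CompleteSpace E] :
    GroupLieAlgebra I G →ₗ[𝕜] GroupLieAlgebra I G →ₗ[𝕜] GroupLieAlgebra I G :=
  haveI : LieGroup I (minSmoothness 𝕜 3) G := by
    rw [minSmoothness_of_isRCLikeNormedField]
    exact LieGroup.of_le (le_trans ENat.LEInfty.out hn)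
  LinearMap.mk₂ 𝕜 (fun x y => ⁅x, y⁆) (fun x y z => add_lie x y z) (fun c x y => smul_lie c x y)
    (fun x y z => lie_add x y z) (fun c x y => lie_smul c x y)

/-- The value at `q` of the fundamental vector field generated by `X`: the velocity at `t = 0` of
`exp(-tX) q`. -/
def fund [MulAction G M] (q : M) : GroupLieAlgebra I G →ₗ[𝕜] TangentSpace J q :=
  -(mfderiv I J (fun g : G => g • q) 1 :
    GroupLieAlgebra I G →L[𝕜] TangentSpace J ((1 : G) • q)).toLinearMap

/-- The differential of a function, as a covector. -/
def dif (f : M → 𝕜) (q : M) : TangentSpace J q →ₗ[𝕜] 𝕜 :=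
  (mfderiv J 𝓘(𝕜, 𝕜) f q : TangentSpace J q →L[𝕜] TangentSpace 𝓘(𝕜, 𝕜) (f q)).toLinearMap

variable (M) in
/-- A (not necessarily continuous) `2`-tensor field on `M`. -/
abbrev TensorField₂ := ∀ q : M, TangentSpace J q ⊗[𝕜] TangentSpace J q

/-- The operator `(f, h) ↦ P(df, dh)`. -/
def bidiff (P : TensorField₂ J M) (f h : M → 𝕜) (q : M) : 𝕜 :=
  eval₂ (dif J f q) (dif J h q) (P q)

/-- `P` is a skew-symmetric `2`-tensor field of class `C^n`. -/
structure IsBivector (n : WithTop ℕ∞) (P : TensorField₂ J M) : Prop where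
  skew : ∀ q, TensorProduct.comm 𝕜 _ _ (P q) = -P q
  contMDiffOn : ∀ (U : Set M) (f h : M → 𝕜), IsOpen U →
    ContMDiffOn J 𝓘(𝕜, 𝕜) n f U → ContMDiffOn J 𝓘(𝕜, 𝕜) n h U →
    ContMDiffOn J 𝓘(𝕜, 𝕜) n (bidiff J P f h) U

variable (G) in
/-- `P` is a `G`-invariant bivector of class `C^n`. -/
structure IsInvBivector [MulAction G M] (n : WithTop ℕ∞) (P : TensorField₂ J M) : Prop
    extends IsBivector J n P where
  inv : ∀ (g : G) (q : M),
    TensorProduct.map (mfderiv J J (fun x : M => g • x) q).toLinearMap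
      (mfderiv J J (fun x : M => g • x) q).toLinearMap (P q) = P (g • q)

/-- The Schouten bracket of two bivectors, as an operator on functions: `[P, Q](df, dg, dh)` is the
cyclic sum of `P(df, d(Q(dg, dh))) + Q(df, d(P(dg, dh)))`. This is the normalization and sign for
which `[X₁ ∧ X₂, Y₁ ∧ Y₂]` equals
`[X₁,Y₁] ∧ X₂ ∧ Y₂ - [X₁,Y₂] ∧ X₂ ∧ Y₁ - [X₂,Y₁] ∧ X₁ ∧ Y₂ + [X₂,Y₂] ∧ X₁ ∧ Y₁`. -/
def schouten (P Q : TensorField₂ J M) (f g h : M → 𝕜) : M → 𝕜 :=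
  bidiff J P f (bidiff J Q g h) + bidiff J Q f (bidiff J P g h) +
  bidiff J P g (bidiff J Q h f) + bidiff J Q g (bidiff J P h f) +
  bidiff J P h (bidiff J Q f g) + bidiff J Q h (bidiff J P f g)

/-- `P` is a `G`-quasi Poisson structure on `M` relative to `H`: a `G`-invariant bivector with
`[P, P] = φ_{H,M}`. The equality of `3`-tensors is tested on differentials of locally defined
functions. -/
structure IsQuasiPoisson [MulAction G M] (n : WithTop ℕ∞) (hn : ∞ ≤ n) [LieGroup I n G]
    [CompleteSpace E] (H : GroupLieAlgebra I G ⊗[𝕜] GroupLieAlgebra I G)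
    (P : TensorField₂ J M) : Prop extends IsInvBivector G J n P where
  schouten_eq : ∀ (U : Set M) (f g h : M → 𝕜), IsOpen U → ContMDiffOn J 𝓘(𝕜, 𝕜) n f U →
    ContMDiffOn J 𝓘(𝕜, 𝕜) n g U → ContMDiffOn J 𝓘(𝕜, 𝕜) n h U → ∀ q ∈ U,
    schouten J P P f g h q =
      eval₃ (dif J f q) (dif J g q) (dif J h q)
        (push₃ (fund I J q) (cartanElement (lieBr I G n hn) H))

/-- `Φ` is a `G`-momentum mapping for the `G`-invariant bivector `P` relative to `H`: it is
admissible, equivariant for conjugation, and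
`(dΦ ⊗ Id)(P) = (½ (L_Φ + R_Φ) ⊗ fund)(H)`. -/
structure IsMomentumMap [MulAction G M] (n : WithTop ℕ∞)
    (H : GroupLieAlgebra I G ⊗[𝕜] GroupLieAlgebra I G)
    (P : TensorField₂ J M) (Φ : M → G) : Prop where
  bivector : IsInvBivector G J n P
  contMDiff : ContMDiff J I n Φ
  equivariant : ∀ (g : G) (q : M), Φ (g • q) = g * Φ q * g⁻¹
  momentum : ∀ q : M,
    TensorProduct.map (mfderiv J I Φ q).toLinearMap LinearMap.id (P q) =
      TensorProduct.map ((2 : 𝕜)⁻¹ • (leftTrans I (Φ q) + rightTrans I (Φ q))) (fund I J q) H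

/-- `P_fus = P - χ_{H,M}`. -/
def fusion [MulAction (G × G) M] (H : GroupLieAlgebra I G ⊗[𝕜] GroupLieAlgebra I G)
    (P : TensorField₂ J M) : TensorField₂ J M := fun q =>
  P q - TensorProduct.map (fund (G := G × G) (I.prod I) J q) (fund (G := G × G) (I.prod I) J q)
    (chi (incl₁ I G) (incl₂ I G) H)

end Manifolds

/-- The diagonal action `g • q = (g, g) • q`. -/
abbrev diagAction (G M : Type*) [Group G] [MulAction (G × G) M] : MulAction G M :=
  MulAction.compHom M (MonoidHom.prod (MonoidHom.id G) (MonoidHom.id G))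

/-! ### Affine algebraic groups and varieties

An affine algebraic group is given by its coordinate Hopf algebra `A`, an affine variety by its
coordinate ring `B`. The first tensor factor corresponds to the first variable of a function. -/

section Algebraic

variable {K : Type*} [Field K] (A : Type*) [CommRing A] [HopfAlgebra K A]
  {B : Type*} [CommRing B] [Algebra K B]

/-- The tangent space at the identity: the point derivations of `A` at the counit. -/
def Lie : Submodule K (A →ₗ[K] K) where
  carrier := {X | ∀ a b, X (a * b) = Coalgebra.counit (R := K) a * X b +
    X a * Coalgebra.counit (R := K) b}
  add_mem' {X Y} hX hY a b := by
    simp only [Set.mem_ofPred_eq] at hX hY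
    simp only [LinearMap.add_apply, hX, hY]; ring
  zero_mem' a b := by simp
  smul_mem' c X hX a b := by
    simp only [Set.mem_ofPred_eq] at hX
    simp only [LinearMap.smul_apply, hX, smul_eq_mul]; ring

variable {A}

/-- The left invariant vector field `(X^L f)(q) = (d/dt) f(q exp(tX))`. -/
def leftField (X : A →ₗ[K] K) : A →ₗ[K] A :=
  (TensorProduct.rid K A).toLinearMap ∘ₗ TensorProduct.map LinearMap.id X ∘ₗ Coalgebra.comul

lemma leftField_mul (Y : Lie (K := K) A) (a b : A) :
    leftField Y.1 (a * b) = a * leftField Y.1 b + leftField Y.1 a * b := by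
  have key : ∀ s t : A ⊗[K] A,
      TensorProduct.rid K A (TensorProduct.map LinearMap.id Y.1 (s * t)) =
        TensorProduct.rid K A (TensorProduct.map LinearMap.id (Coalgebra.counit (R := K)) s) *
          TensorProduct.rid K A (TensorProduct.map LinearMap.id Y.1 t) +
        TensorProduct.rid K A (TensorProduct.map LinearMap.id Y.1 s) *
          TensorProduct.rid K A (TensorProduct.map LinearMap.id (Coalgebra.counit (R := K)) t) := by
    intro s t
    induction s with
    | zero => simp
    | add x y hx hy => simp only [add_mul, map_add, hx, hy]; ring
    | tmul a b =>
      induction t with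
      | zero => simp
      | add x y hx hy => simp only [mul_add, map_add, hx, hy]; ring
      | tmul c d =>
        have := Y.2 b d
        simp only [Algebra.TensorProduct.tmul_mul_tmul, TensorProduct.map_tmul,
          TensorProduct.rid_tmul, LinearMap.id_apply, this, add_smul, mul_smul,
          smul_mul_smul_comm]
  have hc : ∀ a : A, TensorProduct.rid K A (TensorProduct.map LinearMap.id
      (Coalgebra.counit (R := K)) (Coalgebra.comul (R := K) a)) = a := by
    intro a
    have := Coalgebra.lTensor_counit_comul (R := K) a
    rw [LinearMap.lTensor] at this
    rw [this]; simp
  simp only [leftField, LinearMap.comp_apply, LinearEquiv.coe_coe, Bialgebra.comul_mul, key, hc]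

lemma counit_leftField (Y : A →ₗ[K] K) (a : A) :
    Coalgebra.counit (R := K) (leftField Y a) = Y a := by
  have key : ∀ s : A ⊗[K] A, Coalgebra.counit (R := K)
      (TensorProduct.rid K A (TensorProduct.map LinearMap.id Y s)) =
        Y (TensorProduct.lid K A (TensorProduct.map (Coalgebra.counit (R := K)) LinearMap.id s)) := by
    intro s
    induction s with
    | zero => simp
    | add x y hx hy => simp only [map_add, hx, hy]
    | tmul a b => simp [mul_comm]
  have := Coalgebra.rTensor_counit_comul (R := K) a
  rw [LinearMap.rTensor] at this
  simp only [leftField, LinearMap.comp_apply, LinearEquiv.coe_coe, key, this]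
  simp

variable (K A) in
/-- The Lie bracket `[X, Y] = X ∘ Y^L - Y ∘ X^L`, the value at the identity of the commutator
`X^L Y^L - Y^L X^L` of left invariant vector fields. -/
def algBr : Lie (K := K) A →ₗ[K] Lie (K := K) A →ₗ[K] Lie (K := K) A :=
  LinearMap.mk₂ K
    (fun X Y => ⟨X.1 ∘ₗ leftField Y.1 - Y.1 ∘ₗ leftField X.1, fun a b => by
      simp only [LinearMap.sub_apply, LinearMap.comp_apply, leftField_mul, map_add]
      rw [X.2, X.2, Y.2, Y.2]
      simp only [counit_leftField]
      ring⟩)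
    (fun X X' Y => by
      ext a
      simp [leftField, TensorProduct.map_add_right]
      ring)
    (fun c X Y => by
      ext a
      simp [leftField, TensorProduct.map_smul_right, mul_sub])
    (fun X Y Y' => by
      ext a
      simp [leftField, TensorProduct.map_add_right]
      ring)
    (fun c X Y => by
      ext a
      simp [leftField, TensorProduct.map_smul_right, mul_sub])

/-- The map of Lie algebras induced by a homomorphism of groups with comorphism `p`. -/
def lieMap {A' : Type*} [CommRing A'] [HopfAlgebra K A'] (p : A' →ₐc[K] A) :
    Lie (K := K) A →ₗ[K] Lie (K := K) A' where
  toFun X := ⟨X.1 ∘ₗ (p : A' →ₐ[K] A).toLinearMap, fun a b => by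
    have h : ∀ x, Coalgebra.counit (R := K) (p x) = Coalgebra.counit (R := K) x :=
      fun x => CoalgHomClass.counit_comp_apply p x
    have := X.2 (p a) (p b)
    simpa [h] using this⟩
  map_add' X Y := by ext; simp
  map_smul' c X := by ext; simp

variable (K A) in
/-- The differential at the identity of `g ↦ (g, 1)`, whose comorphism is `Id ⊗ counit`. -/
def algIncl₁ : Lie (K := K) A →ₗ[K] Lie (K := K) (A ⊗[K] A) :=
  lieMap (((Bialgebra.TensorProduct.rid K K A : A ⊗[K] K →ₐc[K] A)).comp
    (Bialgebra.TensorProduct.map (BialgHom.id K A) (Bialgebra.counitBialgHom K A)))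

variable (K A) in
/-- The differential at the identity of `g ↦ (1, g)`, whose comorphism is `counit ⊗ Id`. -/
def algIncl₂ : Lie (K := K) A →ₗ[K] Lie (K := K) (A ⊗[K] A) :=
  lieMap (((Bialgebra.TensorProduct.lid K A : K ⊗[K] A →ₐc[K] A)).comp
    (Bialgebra.TensorProduct.map (Bialgebra.counitBialgHom K A) (BialgHom.id K A)))

/-- For `t = ∑ a ⊗ b`, the map `X ↦ ∑ X(a) b` on the Lie algebra. -/
def contrL (t : A ⊗[K] B) : Lie (K := K) A →ₗ[K] B where
  toFun X := TensorProduct.lid K B (TensorProduct.map X.1 LinearMap.id t)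
  map_add' X Y := by simp [TensorProduct.map_add_left]
  map_smul' c X := by simp [TensorProduct.map_smul_left]

/-- For `t = ∑ b ⊗ a`, the map `X ↦ ∑ X(a) b` on the Lie algebra. -/
def contrR (t : B ⊗[K] A) : Lie (K := K) A →ₗ[K] B where
  toFun X := TensorProduct.rid K B (TensorProduct.map LinearMap.id X.1 t)
  map_add' X Y := by simp [TensorProduct.map_add_right]
  map_smul' c X := by simp [TensorProduct.map_smul_right]

/-- The comorphism of an action of the group on the variety: `ρ f` is the function
`(g, q) ↦ f(g • q)`. -/
structure IsCoaction (ρ : B →ₐ[K] A ⊗[K] B) : Prop where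
  counit : ∀ f : B,
    TensorProduct.lid K B (TensorProduct.map Coalgebra.counit LinearMap.id (ρ f)) = f
  coassoc : ∀ f : B,
    TensorProduct.assoc K A A B (TensorProduct.map Coalgebra.comul LinearMap.id (ρ f)) =
      TensorProduct.map LinearMap.id ρ.toLinearMap (ρ f)

variable (K A) in
/-- `f` is sent to the function `(g, x) ↦ f(g x g⁻¹)`, that is,
`f ↦ ∑ f₁ S(f₃) ⊗ f₂` where `∑ f₁ ⊗ f₂ ⊗ f₃` is the iterated diagonal of `f`. -/
def conj : A →ₗ[K] A ⊗[K] A :=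
  TensorProduct.map (LinearMap.mul' K A) LinearMap.id ∘ₗ
    (TensorProduct.assoc K A A A).symm.toLinearMap ∘ₗ
    TensorProduct.map LinearMap.id
      (TensorProduct.map (HopfAlgebra.antipode K) LinearMap.id ∘ₗ
        (TensorProduct.comm K A A).toLinearMap ∘ₗ Coalgebra.comul) ∘ₗ
    Coalgebra.comul

/-- An `Ad`-invariant symmetric `2`-tensor: as a function of `g`, the value of `(Ad_g ⊗ Ad_g) H`
on any `f ⊗ h` is constant, where `(Ad_g X)(f)` is `X` applied to `x ↦ f(g x g⁻¹)`. -/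
structure IsAlgInvSymm (H : Lie (K := K) A ⊗[K] Lie (K := K) A) : Prop where
  symm : TensorProduct.comm K _ _ H = H
  inv : ∀ f h : A,
    eval₂ (contrR (conj K A f)) (contrR (conj K A h)) H =
      algebraMap K A (eval₂ ((LinearMap.applyₗ f) ∘ₗ (Lie (K := K) A).subtype)
        ((LinearMap.applyₗ h) ∘ₗ (Lie (K := K) A).subtype) H)

/-- For a function `f`, the map `X ↦ X_M f`, where `X_M` is the fundamental vector field with
`(X_M f)(q) = (d/dt) f(exp(-tX) q)`. -/
def algFund (ρ : B →ₐ[K] A ⊗[K] B) (f : B) : Lie (K := K) A →ₗ[K] B :=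
  -contrL (ρ f)

/-- A bivector on the variety, as a skew-symmetric biderivation `(f, h) ↦ P(df, dh)` of its
coordinate ring. -/
structure IsAlgBivector (P : B →ₗ[K] B →ₗ[K] B) : Prop where
  skew : ∀ f h, P f h = -P h f
  leibniz : ∀ f g h, P f (g * h) = g * P f h + P f g * h

/-- A bivector that is invariant under the action with comorphism `ρ`: the extension of `P` by
scalars to the functions of `(g, q)` is intertwined with `P` by `ρ`. -/
structure IsAlgInvBivector (ρ : B →ₐ[K] A ⊗[K] B) (P : B →ₗ[K] B →ₗ[K] B) : Prop
    extends IsAlgBivector P where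
  inv : ∀ f h, TensorProduct.map₂ (LinearMap.mul K A) P (ρ f) (ρ h) = ρ (P f h)

/-- The Schouten bracket `[P, Q](df, dg, dh)` of two bivectors. -/
def algSchouten (P Q : B →ₗ[K] B →ₗ[K] B) (f g h : B) : B :=
  P f (Q g h) + Q f (P g h) + P g (Q h f) + Q g (P h f) + P h (Q f g) + Q h (P f g)

/-- `P` is a quasi Poisson structure relative to `H`: an invariant bivector with
`[P, P] = φ_{H,M}`. -/
structure IsAlgQuasiPoisson (ρ : B →ₐ[K] A ⊗[K] B) (H : Lie (K := K) A ⊗[K] Lie (K := K) A)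
    (P : B →ₗ[K] B →ₗ[K] B) : Prop extends IsAlgInvBivector ρ P where
  schouten_eq : ∀ f g h : B, algSchouten P P f g h =
    eval₃ (algFund ρ f) (algFund ρ g) (algFund ρ h) (cartanElement (algBr K A) H)

/-- The homomorphism `Φ` is the comorphism of a momentum mapping for the invariant bivector `P`
relative to `H`: it is equivariant for conjugation, and
`(dΦ ⊗ Id)(P) = (½ (L_Φ + R_Φ) ⊗ fund)(H)`, evaluated on functions `f` on the group and `h` on the
variety. Here `contrR (comul f) X` is the derivative of `f` along the left invariant vector field
`(d/dt) q exp(tX)`, and `contrL (comul f) X` is its derivative along the right invariant vector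
field `(d/dt) exp(tX) q`. -/
structure IsAlgMomentumMap (ρ : B →ₐ[K] A ⊗[K] B) (H : Lie (K := K) A ⊗[K] Lie (K := K) A)
    (P : B →ₗ[K] B →ₗ[K] B) (Φ : A →ₐ[K] B) : Prop where
  bivector : IsAlgInvBivector ρ P
  equivariant : ∀ f : A, ρ (Φ f) = TensorProduct.map LinearMap.id Φ.toLinearMap (conj K A f)
  momentum : ∀ (f : A) (h : B), P (Φ f) h =
    eval₂ ((2 : K)⁻¹ • (Φ.toLinearMap ∘ₗ
      (contrR (Coalgebra.comul f) + contrL (Coalgebra.comul f)))) (algFund ρ h) H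

/-- `P_fus = P - χ_{H,M}`. -/
def algFusion (ρ : B →ₐ[K] (A ⊗[K] A) ⊗[K] B) (H : Lie (K := K) A ⊗[K] Lie (K := K) A)
    (P : B →ₗ[K] B →ₗ[K] B) : B →ₗ[K] B →ₗ[K] B :=
  P - LinearMap.mk₂ K
    (fun f h => eval₂ (algFund ρ f) (algFund ρ h) (chi (V := Lie (K := K) (A ⊗[K] A)) (algIncl₁ K A) (algIncl₂ K A) H))
    (fun f f' h => by
      have : algFund ρ (f + f') = algFund ρ f + algFund ρ f' := by
        ext X; simp [algFund, contrL]; abel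
      simp [eval₂, this, TensorProduct.map_add_left])
    (fun c f h => by
      have : algFund ρ (c • f) = c • algFund ρ f := by ext X; simp [algFund, contrL]
      simp [eval₂, this, TensorProduct.map_smul_left])
    (fun f h h' => by
      have : algFund ρ (h + h') = algFund ρ h + algFund ρ h' := by
        ext X; simp [algFund, contrL]; abel
      simp [eval₂, this, TensorProduct.map_add_right])
    (fun c f h => by
      have : algFund ρ (c • h) = c • algFund ρ h := by ext X; simp [algFund, contrL]
      simp [eval₂, this, TensorProduct.map_smul_right])

/-- The comorphism of the diagonal action `(g, q) ↦ (g, g) • q`. -/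
def diagCoaction (ρ : B →ₐ[K] (A ⊗[K] A) ⊗[K] B) : B →ₐ[K] A ⊗[K] B :=
  (Algebra.TensorProduct.map (Algebra.TensorProduct.lmul' K) (AlgHom.id K B)).comp ρ

/-- The comorphism of the pointwise product `Φ¹ Φ²`. -/
def mulComorphism (Φ₁ Φ₂ : A →ₐ[K] B) : A →ₐ[K] B :=
  (Algebra.TensorProduct.productMap Φ₁ Φ₂).comp (Bialgebra.comulAlgHom K A)

end Algebraic

end QPoisson

end

/-!
Both settings rest on one computation with derivations of a commutative algebra `B`,
`algSchouten_fusion`. Let `D` be an action of `V = 𝔤¹ ⊕ 𝔤²` on `B` by derivations, and let `P` be a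
skew biderivation of `B` preserved by `D`. Write `Q = P - χ`, where `χ` is the biderivation given by
`χ_H`. Then `[Q, Q] = [P, P] - 2 [P, χ] + [χ, χ]`. The bracket `[P, χ]` vanishes because `χ` is built
from derivations preserving `P`. The bracket `[χ, χ]` is expanded by the Leibniz rule: the two
copies of `𝔤` commute and each represents the bracket, so only the terms with one bracket inside a
single copy survive. By symmetry and `ad`-invariance of `H` they are the mixed part of the Cartan
element of `H` for the diagonal, that is, the difference between the image of `φ_H` under the
diagonal and the images under the two factors.

For affine varieties `B` is the coordinate ring. Point derivations of the Hopf algebra `A` are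
treated as elements of the convolution algebra of functionals on `A`, where the left and right
invariant fields, the adjoint action and the bracket become products; `ad`-invariance of `H` is the
differential of its `Ad`-invariance at the counit.

For manifolds `B` is the algebra of functions that are smooth on a given open set, and the operators
are the derivatives along fundamental vector fields. All identities between derivatives are reduced
to the symmetry of second derivatives, `dif_dif_comm`, applied to functions such as
`(g, h) ↦ f (g h q)`: this yields the formula `dif_bracket` for the Lie bracket of a group, the
commutation rules `IsSmoothAction.orbitDeriv_bracket` and `IsSmoothAction.orbitDeriv_comm`, the
infinitesimal invariance of `P` (`IsInvBivector.orbitDeriv_bidiff`) and of `H`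
(`IsInvSymm.bracket_inv`).

The momentum condition is linear in the bivector. If `C`, `L` and `R` are the derivatives of the
product `Φ₁ Φ₂` with a group element inserted in the middle, on the right and on the left, the given
condition says that `P` contributes `½ (C + R) ⊗ fund¹ + ½ (L + C) ⊗ fund²` evaluated on `H`.
Equivariance says that the two copies of `𝔤` act on the product by `C - R` and `L - C`, so
subtracting `χ` cancels the terms with `C` and leaves `½ (L + R) ⊗ (fund¹ + fund²)`.
-/

noncomputable section

namespace QPoisson

/-! ### The Schouten bracket of a fused bivector, for derivations of a commutative algebra -/

section TensorFormulas

variable {k : Type*} [Field k] {L V W : Type*} [AddCommMonoid L] [Module k L]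
  [AddCommMonoid V] [Module k V] [AddCommMonoid W] [Module k W]
  {B : Type*} [CommRing B] [Algebra k B]

@[simp] lemma eval₂_tmul (a b : V →ₗ[k] B) (u v : V) : eval₂ a b (u ⊗ₜ[k] v) = a u * b v := rfl

@[simp] lemma eval₃_tmul (a b c : V →ₗ[k] B) (u v w : V) :
    eval₃ a b c (u ⊗ₜ[k] (v ⊗ₜ[k] w)) = a u * (b v * c w) := rfl

@[simp] lemma push₃_tmul (T : V →ₗ[k] W) (u v w : V) :
    push₃ T (u ⊗ₜ[k] (v ⊗ₜ[k] w)) = T u ⊗ₜ[k] (T v ⊗ₜ[k] T w) := rfl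

@[simp] lemma midBracket_tmul (br : L →ₗ[k] L →ₗ[k] L) (a b c d : L) :
    midBracket br ((a ⊗ₜ[k] b) ⊗ₜ[k] (c ⊗ₜ[k] d)) = a ⊗ₜ[k] (br b c ⊗ₜ[k] d) := rfl

lemma eval₂_map {V' : Type*} [AddCommMonoid V'] [Module k V'] (a b : W →ₗ[k] B)
    (S T : V' →ₗ[k] W) (t : V' ⊗[k] V') :
    eval₂ a b (TensorProduct.map S T t) = eval₂ (a ∘ₗ S) (b ∘ₗ T) t := by
  induction t with
  | zero => simp
  | tmul x y => simp
  | add x y hx hy => simp only [map_add, hx, hy]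

lemma eval₂_comm (a b : V →ₗ[k] B) (t : V ⊗[k] V) :
    eval₂ a b (TensorProduct.comm k V V t) = eval₂ b a t := by
  induction t with
  | zero => simp
  | tmul x y => simp [mul_comm]
  | add x y hx hy => simp only [map_add, hx, hy]

lemma eval₃_push₃ (a b c : W →ₗ[k] B) (T : V →ₗ[k] W) (t : V ⊗[k] (V ⊗[k] V)) :
    eval₃ a b c (push₃ T t) = eval₃ (a ∘ₗ T) (b ∘ₗ T) (c ∘ₗ T) t := by
  have : eval₃ a b c ∘ₗ push₃ T = eval₃ (a ∘ₗ T) (b ∘ₗ T) (c ∘ₗ T) := by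
    ext; simp
  exact LinearMap.congr_fun this t

lemma map_eval₂ {B' : Type*} [CommRing B'] [Algebra k B'] (e : B →ₐ[k] B')
    (a b : V →ₗ[k] B) (t : V ⊗[k] V) :
    e (eval₂ a b t) = eval₂ (e.toLinearMap ∘ₗ a) (e.toLinearMap ∘ₗ b) t := by
  have : e.toLinearMap ∘ₗ eval₂ a b = eval₂ (e.toLinearMap ∘ₗ a) (e.toLinearMap ∘ₗ b) := by
    ext; simp
  exact LinearMap.congr_fun this t

lemma map_eval₃ {B' : Type*} [CommRing B'] [Algebra k B'] (e : B →ₐ[k] B')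
    (a b c : V →ₗ[k] B) (t : V ⊗[k] (V ⊗[k] V)) :
    e (eval₃ a b c t) =
      eval₃ (e.toLinearMap ∘ₗ a) (e.toLinearMap ∘ₗ b) (e.toLinearMap ∘ₗ c) t := by
  have : e.toLinearMap ∘ₗ eval₃ a b c =
      eval₃ (e.toLinearMap ∘ₗ a) (e.toLinearMap ∘ₗ b) (e.toLinearMap ∘ₗ c) := by
    ext; simp
  exact LinearMap.congr_fun this t

/-- Evaluation of the fusion term `χ_H`: the `u¹ ∧ v²` part only sees the composites with the two
inclusions. -/
lemma eval₂_chi {V : Type*} [AddCommGroup V] [Module k V] (i₁ i₂ : L →ₗ[k] V) (H : L ⊗[k] L)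
    (a b : V →ₗ[k] B) :
    eval₂ a b (chi i₁ i₂ H) =
      (2 : k)⁻¹ • (eval₂ (a ∘ₗ i₁) (b ∘ₗ i₂) H - eval₂ (b ∘ₗ i₁) (a ∘ₗ i₂) H) := by
  simp only [chi, map_smul, map_sub, eval₂_comm, eval₂_map]

end TensorFormulas

section CartanForm

variable {k : Type*} [Field k] {L : Type*} [AddCommGroup L] [Module k L]
  {B : Type*} [CommRing B] [Algebra k B]

/-- The trilinear form `∑ a([u_p, u_q]) b(v_p) c(v_q)` attached to `H = ∑ u_p ⊗ v_p`. -/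
def bracketForm (br : L →ₗ[k] L →ₗ[k] L) (S : Finset (L × L)) (a b c : L →ₗ[k] B) : B :=
  ∑ p ∈ S, ∑ q ∈ S, a (br p.1 q.1) * (b p.2 * c q.2)

/-- The trilinear form `∑ a(u_p) b([v_p, u_q]) c(v_q)` attached to `H = ∑ u_p ⊗ v_p`; up to the
factor `-½` it is the evaluation of the Cartan element. -/
def midForm (br : L →ₗ[k] L →ₗ[k] L) (S : Finset (L × L)) (a b c : L →ₗ[k] B) : B :=
  ∑ p ∈ S, ∑ q ∈ S, a p.1 * (b (br p.2 q.1) * c q.2)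

variable {br : L →ₗ[k] L →ₗ[k] L} {S : Finset (L × L)}

lemma bracketForm_swap (hbr : ∀ x y, br x y = -br y x) (a b c : L →ₗ[k] B) :
    bracketForm br S a c b = -bracketForm br S a b c := by
  simp only [bracketForm]
  rw [Finset.sum_comm, ← Finset.sum_neg_distrib]
  refine Finset.sum_congr rfl fun p _ => ?_
  rw [← Finset.sum_neg_distrib]
  refine Finset.sum_congr rfl fun q _ => ?_
  rw [hbr, map_neg]
  ring

lemma sum_symm (hsymm : TensorProduct.comm k L L (∑ p ∈ S, p.1 ⊗ₜ[k] p.2) = ∑ p ∈ S, p.1 ⊗ₜ[k] p.2)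
    (a b : L →ₗ[k] B) : ∑ p ∈ S, a p.1 * b p.2 = ∑ p ∈ S, a p.2 * b p.1 := by
  have := congrArg (eval₂ a b) hsymm
  simpa using this.symm

lemma sum_inv (hinv : ∀ x, TensorProduct.map (br x) LinearMap.id (∑ p ∈ S, p.1 ⊗ₜ[k] p.2) +
      TensorProduct.map LinearMap.id (br x) (∑ p ∈ S, p.1 ⊗ₜ[k] p.2) = 0)
    (x : L) (a b : L →ₗ[k] B) :
    ∑ p ∈ S, a p.1 * b (br x p.2) = -∑ p ∈ S, a (br x p.1) * b p.2 := by
  have := congrArg (eval₂ a b) (hinv x)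
  rw [eq_neg_iff_add_eq_zero, add_comm]
  simpa using this

lemma bracketForm_symm
    (hsymm : TensorProduct.comm k L L (∑ p ∈ S, p.1 ⊗ₜ[k] p.2) = ∑ p ∈ S, p.1 ⊗ₜ[k] p.2)
    (a b c : L →ₗ[k] B) :
    ∑ p ∈ S, ∑ q ∈ S, a (br p.2 q.2) * (b p.1 * c q.1) = bracketForm br S a b c := by
  have h1 : ∀ p ∈ S, ∑ q ∈ S, a (br p.2 q.2) * (b p.1 * c q.1) =
      ∑ q ∈ S, a (br p.2 q.1) * (b p.1 * c q.2) := fun p _ => by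
    have := congrArg (b p.1 * ·) (sum_symm hsymm (a ∘ₗ br p.2) c)
    simp only [Finset.mul_sum, LinearMap.comp_apply] at this
    rw [← sub_eq_zero, ← neg_eq_zero, neg_sub, ← sub_eq_zero.2 this, ← Finset.sum_sub_distrib,
      ← Finset.sum_sub_distrib]
    exact Finset.sum_congr rfl fun q _ => by ring
  rw [Finset.sum_congr rfl h1, bracketForm, Finset.sum_comm]
  conv_rhs => rw [Finset.sum_comm]
  refine Finset.sum_congr rfl fun q _ => ?_
  have := congrArg (· * c q.2) (sum_symm hsymm (a ∘ₗ br.flip q.1) b)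
  simp only [Finset.sum_mul, LinearMap.comp_apply, LinearMap.flip_apply] at this
  simpa [mul_assoc] using this.symm

/-- Invariance moves the bracket of the Cartan form to the first slot. -/
lemma midForm_eq_first (hbr : ∀ x y, br x y = -br y x)
    (hinv : ∀ x, TensorProduct.map (br x) LinearMap.id (∑ p ∈ S, p.1 ⊗ₜ[k] p.2) +
      TensorProduct.map LinearMap.id (br x) (∑ p ∈ S, p.1 ⊗ₜ[k] p.2) = 0)
    (a b c : L →ₗ[k] B) : midForm br S a b c = -bracketForm br S a b c := by
  rw [midForm, bracketForm, Finset.sum_comm]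
  conv_rhs => rw [Finset.sum_comm]
  rw [← Finset.sum_neg_distrib]
  refine Finset.sum_congr rfl fun q _ => ?_
  have := congrArg (· * c q.2) (sum_inv hinv q.1 a b)
  simp only [Finset.sum_mul, neg_mul] at this
  calc _ = -∑ p ∈ S, a p.1 * b (br q.1 p.2) * c q.2 := by
        rw [← Finset.sum_neg_distrib]
        exact Finset.sum_congr rfl fun p _ => by rw [hbr, map_neg]; ring
    _ = ∑ p ∈ S, a (br q.1 p.1) * b p.2 * c q.2 := by rw [this, neg_neg]
    _ = _ := by
        rw [← Finset.sum_neg_distrib]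
        exact Finset.sum_congr rfl fun p _ => by rw [hbr, map_neg]; ring

/-- Symmetry puts the Cartan form into a form with the bracket of two first components in the
second slot. -/
lemma midForm_eq_second
    (hsymm : TensorProduct.comm k L L (∑ p ∈ S, p.1 ⊗ₜ[k] p.2) = ∑ p ∈ S, p.1 ⊗ₜ[k] p.2)
    (a b c : L →ₗ[k] B) : midForm br S a b c = bracketForm br S b a c := by
  rw [midForm, bracketForm, Finset.sum_comm]
  conv_rhs => rw [Finset.sum_comm]
  refine Finset.sum_congr rfl fun q _ => ?_
  have := congrArg (· * c q.2) (sum_symm hsymm a (b ∘ₗ br.flip q.1))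
  simp only [Finset.sum_mul, LinearMap.comp_apply, LinearMap.flip_apply] at this
  simp only [← mul_assoc]
  rw [this]
  exact Finset.sum_congr rfl fun p _ => by ring

/-- Invariance moves the bracket of the Cartan form to the third slot. -/
lemma midForm_eq_third
    (hsymm : TensorProduct.comm k L L (∑ p ∈ S, p.1 ⊗ₜ[k] p.2) = ∑ p ∈ S, p.1 ⊗ₜ[k] p.2)
    (hinv : ∀ x, TensorProduct.map (br x) LinearMap.id (∑ p ∈ S, p.1 ⊗ₜ[k] p.2) +
      TensorProduct.map LinearMap.id (br x) (∑ p ∈ S, p.1 ⊗ₜ[k] p.2) = 0)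
    (a b c : L →ₗ[k] B) : midForm br S a b c = -bracketForm br S c a b := by
  rw [← bracketForm_symm hsymm, midForm, ← Finset.sum_neg_distrib]
  refine Finset.sum_congr rfl fun p _ => ?_
  have := congrArg (a p.1 * ·) (sum_inv hinv p.2 b c)
  simp only [Finset.mul_sum, mul_neg] at this
  rw [eq_neg_iff_add_eq_zero] at this ⊢
  rw [← this, add_comm]
  congr 1
  exact Finset.sum_congr rfl fun q _ => by ring

lemma eval₃_cartanElement (a b c : L →ₗ[k] B) :
    eval₃ a b c (cartanElement br (∑ p ∈ S, p.1 ⊗ₜ[k] p.2)) =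
      -((2 : k)⁻¹ • midForm br S a b c) := by
  simp only [cartanElement, TensorProduct.sum_tmul, TensorProduct.tmul_sum, map_sum, map_smul,
    midBracket_tmul, midForm, neg_smul, map_neg, eval₃_tmul]
  rw [Finset.sum_comm]

end CartanForm

section Derivations

variable {K : Type*} [Field K] {B : Type*} [CommRing B] [Algebra K B]

/-- The bivector `X ∧ Y` as an operator `(f, h) ↦ X f * Y h - Y f * X h`. -/
def wedgeOp (X Y : B →ₗ[K] B) : B →ₗ[K] B →ₗ[K] B :=
  (LinearMap.mul K B).compl₁₂ X Y - (LinearMap.mul K B).compl₁₂ Y X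

@[simp] lemma wedgeOp_apply (X Y : B →ₗ[K] B) (f h : B) :
    wedgeOp X Y f h = X f * Y h - Y f * X h := rfl

/-- The trivector `X ∧ Y ∧ Z` as an operator on functions. -/
def wedge₃ (X Y Z : B →ₗ[K] B) (f g h : B) : B :=
  X f * (Y g * Z h) - X f * (Z g * Y h) - X g * (Y f * Z h) + X g * (Z f * Y h)
    + X h * (Y f * Z g) - X h * (Z f * Y g)

/-- The Leibniz rule. -/
def IsLeibniz (X : B →ₗ[K] B) : Prop := ∀ a b, X (a * b) = a * X b + X a * b

lemma algSchouten_comm (P Q : B →ₗ[K] B →ₗ[K] B) (f g h : B) :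
    algSchouten P Q f g h = algSchouten Q P f g h := by
  simp only [algSchouten]; ring

lemma algSchouten_sub_left (P P' Q : B →ₗ[K] B →ₗ[K] B) (f g h : B) :
    algSchouten (P - P') Q f g h = algSchouten P Q f g h - algSchouten P' Q f g h := by
  simp only [algSchouten, LinearMap.sub_apply, map_sub]; ring

lemma algSchouten_smul_left (c : K) (P Q : B →ₗ[K] B →ₗ[K] B) (f g h : B) :
    algSchouten (c • P) Q f g h = c • algSchouten P Q f g h := by
  simp only [algSchouten, LinearMap.smul_apply, map_smul, smul_add]

lemma algSchouten_sum_left {ι : Type*} (s : Finset ι) (P : ι → B →ₗ[K] B →ₗ[K] B)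
    (Q : B →ₗ[K] B →ₗ[K] B) (f g h : B) :
    algSchouten (∑ i ∈ s, P i) Q f g h = ∑ i ∈ s, algSchouten (P i) Q f g h := by
  simp only [algSchouten, LinearMap.sum_apply, map_sum, Finset.sum_add_distrib]

/-- A bivector that is invariant under `X` and `Y` has zero Schouten bracket with `X ∧ Y`. -/
lemma algSchouten_wedgeOp_of_invariant {P : B →ₗ[K] B →ₗ[K] B} (hP : IsAlgBivector P)
    {X Y : B →ₗ[K] B}
    (hX : ∀ f g, X (P f g) = P (X f) g + P f (X g))
    (hY : ∀ f g, Y (P f g) = P (Y f) g + P f (Y g)) (f g h : B) :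
    algSchouten (wedgeOp X Y) P f g h = 0 := by
  have s1 := hP.skew (X f)
  have s2 := hP.skew (X g)
  have s3 := hP.skew (X h)
  have s4 := hP.skew (Y f)
  have s5 := hP.skew (Y g)
  have s6 := hP.skew (Y h)
  simp only [algSchouten, wedgeOp_apply, hX, hY, map_sub, hP.leibniz, s1, s2, s3, s4, s5, s6]
  ring

/-- The Schouten bracket of `X ∧ Y` and `X' ∧ Y'` when the mixed commutators vanish. -/
lemma algSchouten_wedgeOp_wedgeOp {X Y X' Y' Z W : B →ₗ[K] B} (hX : IsLeibniz X)
    (hY : IsLeibniz Y) (hX' : IsLeibniz X') (hY' : IsLeibniz Y')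
    (hZ : ∀ f, Z f = X (X' f) - X' (X f)) (hW : ∀ f, W f = Y (Y' f) - Y' (Y f))
    (hXY' : ∀ f, X (Y' f) = Y' (X f)) (hYX' : ∀ f, X' (Y f) = Y (X' f)) (f g h : B) :
    algSchouten (wedgeOp X Y) (wedgeOp X' Y') f g h =
      wedge₃ Z Y Y' f g h + wedge₃ W X X' f g h := by
  have hX (a b) : X (a * b) = _ := hX a b
  have hY (a b) : Y (a * b) = _ := hY a b
  have hX' (a b) : X' (a * b) = _ := hX' a b
  have hY' (a b) : Y' (a * b) = _ := hY' a b
  simp only [algSchouten, wedgeOp_apply, map_sub, hX, hY, hX', hY', wedge₃, hZ, hW, hXY', hYX']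
  ring

variable [CharZero K] {L V : Type*} [AddCommGroup L] [Module K L] [AddCommGroup V] [Module K V]

/-- The algebraic core of fusion. Let `V` act on `B` by derivations through `D`, let `i₁` and `i₂`
be two commuting copies of `L` in `V`, and let `H` be symmetric and invariant. If `P` is a
`V`-invariant bivector whose Schouten square is the Cartan element of `H¹ + H²`, then the Schouten
square of `P - χ_H` is the Cartan element of `H` for the diagonal action of `L`. -/
theorem algSchouten_fusion {br : L →ₗ[K] L →ₗ[K] L} {brV : V →ₗ[K] V →ₗ[K] V}
    {i₁ i₂ : L →ₗ[K] V} {D : V →ₗ[K] B →ₗ[K] B}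
    (hD : ∀ x, IsLeibniz (D x))
    (hbrV : ∀ x y f, D (brV x y) f = D x (D y f) - D y (D x f))
    (h₁ : ∀ x y f, D (i₁ (br x y)) f = D (i₁ x) (D (i₁ y) f) - D (i₁ y) (D (i₁ x) f))
    (h₂ : ∀ x y f, D (i₂ (br x y)) f = D (i₂ x) (D (i₂ y) f) - D (i₂ y) (D (i₂ x) f))
    (h₁₂ : ∀ x y f, D (i₁ x) (D (i₂ y) f) = D (i₂ y) (D (i₁ x) f))
    (hbr : ∀ x y, br x y = -br y x) {H : L ⊗[K] L}
    (hsymm : TensorProduct.comm K L L H = H)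
    (hinv : ∀ x, TensorProduct.map (br x) LinearMap.id H +
      TensorProduct.map LinearMap.id (br x) H = 0)
    {P Q : B →ₗ[K] B →ₗ[K] B} (hP : IsAlgBivector P)
    (hPinv : ∀ x f g, D x (P f g) = P (D x f) g + P f (D x g))
    (hQ : ∀ f h, Q f h = P f h - eval₂ (D.flip f) (D.flip h) (chi i₁ i₂ H))
    {f g h : B}
    (hPP : algSchouten P P f g h =
      eval₃ (D.flip f) (D.flip g) (D.flip h) (cartanElement brV (doubled i₁ i₂ H))) :
    algSchouten Q Q f g h =
      eval₃ (D.flip f ∘ₗ (i₁ + i₂)) (D.flip g ∘ₗ (i₁ + i₂)) (D.flip h ∘ₗ (i₁ + i₂))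
        (cartanElement br H) := by
  obtain ⟨S, rfl⟩ := TensorProduct.exists_finset H
  set χ : B →ₗ[K] B →ₗ[K] B := (2 : K)⁻¹ • ∑ p ∈ S, wedgeOp (D (i₁ p.1)) (D (i₂ p.2)) with hχ
  have hQχ : Q = P - χ := by
    ext a b
    rw [hQ, LinearMap.sub_apply, LinearMap.sub_apply, hχ, eval₂_chi]
    congr 1
    simp only [map_sum, eval₂_tmul, LinearMap.smul_apply, LinearMap.sum_apply, wedgeOp_apply,
      LinearMap.comp_apply, LinearMap.flip_apply, ← Finset.sum_sub_distrib]
    congr 1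
    exact Finset.sum_congr rfl fun p _ => by ring
  have hχP : algSchouten χ P f g h = 0 := by
    rw [hχ, algSchouten_smul_left, algSchouten_sum_left]
    simp only [algSchouten_wedgeOp_of_invariant hP (hPinv _) (hPinv _), Finset.sum_const_zero,
      smul_zero]
  -- `F₁`, `F₂` and their analogues are the functionals `X ↦ X f` on the two copies of `L`.
  set F₁ := D.flip f ∘ₗ i₁ with hF₁
  set F₂ := D.flip f ∘ₗ i₂ with hF₂
  set G₁ := D.flip g ∘ₗ i₁ with hG₁
  set G₂ := D.flip g ∘ₗ i₂ with hG₂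
  set H₁ := D.flip h ∘ₗ i₁ with hH₁
  set H₂ := D.flip h ∘ₗ i₂ with hH₂
  have hχχ : algSchouten χ χ f g h = ((2 : K)⁻¹ * (2 : K)⁻¹) •
      (∑ p ∈ S, ∑ q ∈ S, (wedge₃ (D (i₁ (br p.1 q.1))) (D (i₂ p.2)) (D (i₂ q.2)) f g h +
        wedge₃ (D (i₂ (br p.2 q.2))) (D (i₁ p.1)) (D (i₁ q.1)) f g h)) := by
    have hr : ∀ R : B →ₗ[K] B →ₗ[K] B, algSchouten R χ f g h =
        (2 : K)⁻¹ • ∑ q ∈ S, algSchouten R (wedgeOp (D (i₁ q.1)) (D (i₂ q.2))) f g h := by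
      intro R
      rw [algSchouten_comm, hχ, algSchouten_smul_left, algSchouten_sum_left]
      simp only [algSchouten_comm R]
    rw [hr, mul_smul]
    congr 1
    simp only [algSchouten_comm _ (wedgeOp _ _)]
    rw [Finset.sum_congr rfl fun q _ => algSchouten_comm _ _ f g h]
    simp only [hχ, algSchouten_smul_left, algSchouten_sum_left]
    rw [← Finset.smul_sum, Finset.sum_comm]
    congr 1
    refine Finset.sum_congr rfl fun p _ => Finset.sum_congr rfl fun q _ => ?_
    exact algSchouten_wedgeOp_wedgeOp (hD _) (hD _) (hD _) (hD _) (h₁ _ _) (h₂ _ _)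
      (h₁₂ _ _) (h₁₂ _ _) _ _ _
  have hPP' : algSchouten P P f g h =
      -((2 : K)⁻¹ • (midForm br S F₁ G₁ H₁ + midForm br S F₂ G₂ H₂)) := by
    have hc₁ : ∀ x y : L, D (brV (i₁ x) (i₂ y)) g = 0 := fun x y => by
      rw [hbrV, h₁₂, sub_self]
    have hc₂ : ∀ x y : L, D (brV (i₂ x) (i₁ y)) g = 0 := fun x y => by
      rw [hbrV, h₁₂, sub_self]
    rw [hPP]
    simp only [cartanElement, doubled, map_sum, TensorProduct.map_tmul, TensorProduct.add_tmul,
      TensorProduct.tmul_add, TensorProduct.sum_tmul, TensorProduct.tmul_sum, map_add, map_smul,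
      midBracket_tmul, eval₃_tmul, neg_smul, map_neg, LinearMap.flip_apply, hc₁, hc₂, mul_zero,
      zero_mul, Finset.sum_const_zero, add_zero, zero_add, midForm, hF₁, hF₂, hG₁, hG₂, hH₁, hH₂,
      LinearMap.comp_apply, h₁, h₂, hbrV]
    congr 3 <;> exact Finset.sum_comm
  have hmid : midForm br S (F₁ + F₂) (G₁ + G₂) (H₁ + H₂) =
      midForm br S F₁ G₁ H₁ + midForm br S F₂ G₂ H₂ +
        (midForm br S F₁ G₂ H₂ + midForm br S F₂ G₁ H₂ + midForm br S F₂ G₂ H₁ +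
          midForm br S F₂ G₁ H₁ + midForm br S F₁ G₂ H₁ + midForm br S F₁ G₁ H₂) := by
    simp only [midForm, LinearMap.add_apply, add_mul, mul_add, Finset.sum_add_distrib]
    ring
  have hwedge : ∑ p ∈ S, ∑ q ∈ S,
      (wedge₃ (D (i₁ (br p.1 q.1))) (D (i₂ p.2)) (D (i₂ q.2)) f g h +
        wedge₃ (D (i₂ (br p.2 q.2))) (D (i₁ p.1)) (D (i₁ q.1)) f g h) =
      bracketForm br S F₁ G₂ H₂ - bracketForm br S F₁ H₂ G₂ - bracketForm br S G₁ F₂ H₂ +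
        bracketForm br S G₁ H₂ F₂ + bracketForm br S H₁ F₂ G₂ - bracketForm br S H₁ G₂ F₂ +
      (bracketForm br S F₂ G₁ H₁ - bracketForm br S F₂ H₁ G₁ - bracketForm br S G₂ F₁ H₁ +
        bracketForm br S G₂ H₁ F₁ + bracketForm br S H₂ F₁ G₁ - bracketForm br S H₂ G₁ F₁) := by
    have e (a b c : L →ₗ[K] B) := (bracketForm_symm (br := br) hsymm a b c).symm
    rw [e F₂ G₁, e F₂ H₁, e G₂ F₁, e G₂ H₁, e H₂ F₁, e H₂ G₁]
    simp only [bracketForm, ← Finset.sum_sub_distrib, ← Finset.sum_add_distrib]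
    exact Finset.sum_congr rfl fun p _ => Finset.sum_congr rfl fun q _ => by
      simp only [wedge₃, hF₁, hF₂, hG₁, hG₂, hH₁, hH₂, LinearMap.comp_apply, LinearMap.flip_apply]
      ring
  have hflip : ∀ a : B, D.flip a ∘ₗ (i₁ + i₂) = D.flip a ∘ₗ i₁ + D.flip a ∘ₗ i₂ :=
    fun a => LinearMap.comp_add _ _ _
  rw [hQχ, algSchouten_sub_left, algSchouten_comm, algSchouten_sub_left,
    algSchouten_comm χ (P - χ), algSchouten_sub_left, algSchouten_comm P χ, hχP, hχχ, hPP', hwedge,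
    hflip, hflip, hflip, eval₃_cartanElement, hmid,
    midForm_eq_first hbr hinv F₁ G₂ H₂, midForm_eq_second hsymm F₂ G₁ H₂,
    midForm_eq_third hsymm hinv F₂ G₂ H₁, midForm_eq_first hbr hinv F₂ G₁ H₁,
    midForm_eq_second hsymm F₁ G₂ H₁, midForm_eq_third hsymm hinv F₁ G₁ H₂,
    bracketForm_swap hbr F₁ G₂ H₂, bracketForm_swap hbr G₁ F₂ H₂, bracketForm_swap hbr H₁ F₂ G₂,
    bracketForm_swap hbr F₂ G₁ H₁, bracketForm_swap hbr G₂ F₁ H₁, bracketForm_swap hbr H₂ F₁ G₁]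
  have h2 : (2 : K) ≠ 0 := two_ne_zero
  match_scalars <;> field_simp <;> ring

end Derivations

/-! ### Convolution identities in a commutative Hopf algebra -/

section Convolution

open WithConv Coalgebra

variable {K : Type*} [Field K] {A : Type*} [CommRing A] [HopfAlgebra K A]
  {R : Type*} [CommRing R] [Algebra K R]

variable (R) in
/-- A functional on `A`, viewed as a map into the scalars of the `K`-algebra `R`. -/
def scal (X : A →ₗ[K] K) : WithConv (A →ₗ[K] R) := toConv (Algebra.linearMap K R ∘ₗ X)

lemma contrR_comul (X : Lie (K := K) A) (a : A) :
    contrR (comul (R := K) a) X = (toConv LinearMap.id * scal A X.1 : WithConv (A →ₗ[K] A)) a := by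
  have (t : A ⊗[K] A) : contrR t X =
      LinearMap.mul' K A (TensorProduct.map LinearMap.id (scal A X.1).ofConv t) := by
    induction t with
    | zero => simp [contrR]
    | tmul x y => simp [contrR, scal, Algebra.smul_def, mul_comm]
    | add x y hx hy => simp only [map_add, ← hx, ← hy]; simp [contrR]
  exact this _

lemma contrL_comul (X : Lie (K := K) A) (a : A) :
    contrL (comul (R := K) a) X = (scal A X.1 * toConv LinearMap.id : WithConv (A →ₗ[K] A)) a := by
  have (t : A ⊗[K] A) : contrL t X =
      LinearMap.mul' K A (TensorProduct.map (scal A X.1).ofConv LinearMap.id t) := by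
    induction t with
    | zero => simp [contrL]
    | tmul x y => simp [contrL, scal, Algebra.smul_def]
    | add x y hx hy => simp only [map_add, ← hx, ← hy]; simp [contrL]
  exact this _

/-- Post-composition with an algebra homomorphism, pointwise. -/
lemma algHom_convMul_apply {R' : Type*} [CommRing R'] [Algebra K R'] (e : R →ₐ[K] R')
    (φ ψ : WithConv (A →ₗ[K] R)) (a : A) :
    e ((φ * ψ) a) = (toConv (e.toLinearMap ∘ₗ φ.ofConv) * toConv (e.toLinearMap ∘ₗ ψ.ofConv)) a :=
  LinearMap.congr_fun (LinearMap.algHom_comp_convMul_distrib e φ ψ) a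

lemma algHom_comp_scal {R' : Type*} [CommRing R'] [Algebra K R'] (e : R →ₐ[K] R')
    (X : A →ₗ[K] K) : toConv (e.toLinearMap ∘ₗ (scal R X).ofConv) = scal R' X := by
  ext a; simp [scal]

/-- The function `(x, y) ↦ φ(x) ψ(y)` on a product of groups. -/
def tens (φ ψ : WithConv (A →ₗ[K] R)) : WithConv (A ⊗[K] A →ₗ[K] R) :=
  toConv (LinearMap.mul' K R ∘ₗ TensorProduct.map φ.ofConv ψ.ofConv)

@[simp] lemma tens_tmul (φ ψ : WithConv (A →ₗ[K] R)) (a b : A) :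
    tens φ ψ (a ⊗ₜ[K] b) = φ a * ψ b := rfl

/-- Restricting to the diagonal of a product of groups gives the convolution product. -/
lemma tens_comul (φ ψ : WithConv (A →ₗ[K] R)) (a : A) :
    tens φ ψ (comul (R := K) a) = (φ * ψ) a := rfl

/-- On a product of groups, convolution is computed in each variable. -/
lemma tens_mul_tens (φ₁ φ₂ ψ₁ ψ₂ : WithConv (A →ₗ[K] R)) :
    tens φ₁ φ₂ * tens ψ₁ ψ₂ = tens (φ₁ * ψ₁) (φ₂ * ψ₂) := by
  have (s t : A ⊗[K] A) : LinearMap.mul' K R (TensorProduct.map (tens φ₁ φ₂).ofConv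
      (tens ψ₁ ψ₂).ofConv
      (TensorProduct.AlgebraTensorModule.tensorTensorTensorComm K K K K A A A A (s ⊗ₜ[K] t))) =
      LinearMap.mul' K R (TensorProduct.map φ₁.ofConv ψ₁.ofConv s) *
        LinearMap.mul' K R (TensorProduct.map φ₂.ofConv ψ₂.ofConv t) := by
    induction s with
    | zero => simp
    | add x y hx hy => simp only [TensorProduct.add_tmul, map_add, add_mul, hx, hy]
    | tmul x y =>
      induction t with
      | zero => simp
      | add x y hx hy => simp only [TensorProduct.tmul_add, map_add, mul_add, hx, hy]
      | tmul z w => simp; ring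
  apply WithConv.ext
  apply TensorProduct.ext'
  intro a b
  exact this _ _

/-- Evaluation of the comorphism of conjugation: `f(g x g⁻¹)` is a threefold convolution. -/
lemma mul'_map_conj (α : A →ₐ[K] R) (β : A →ₗ[K] R) (f : A) :
    LinearMap.mul' K R (TensorProduct.map α.toLinearMap β (conj K A f)) =
      (toConv α.toLinearMap * (toConv β * toConv (α.toLinearMap ∘ₗ HopfAlgebra.antipode K))) f := by
  have h1 (b : A) (a : A) (s : A ⊗[K] A) : LinearMap.mul' K R (TensorProduct.map α.toLinearMap β
      (TensorProduct.map (LinearMap.mul' K A) LinearMap.id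
        ((TensorProduct.assoc K A A A).symm (a ⊗ₜ[K] (TensorProduct.map (HopfAlgebra.antipode K)
          LinearMap.id (TensorProduct.comm K A A s)))))) =
      α a * LinearMap.mul' K R
        (TensorProduct.map β (α.toLinearMap ∘ₗ HopfAlgebra.antipode K) s) := by
    induction s with
    | zero => simp
    | add x y hx hy => simp only [TensorProduct.tmul_add, map_add, mul_add, hx, hy]
    | tmul x y => simp; ring
  have h2 (t : A ⊗[K] A) : LinearMap.mul' K R (TensorProduct.map α.toLinearMap β
      (TensorProduct.map (LinearMap.mul' K A) LinearMap.id
        ((TensorProduct.assoc K A A A).symm (TensorProduct.map LinearMap.id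
          (TensorProduct.map (HopfAlgebra.antipode K) LinearMap.id ∘ₗ
            (TensorProduct.comm K A A).toLinearMap ∘ₗ comul) t)))) =
      LinearMap.mul' K R (TensorProduct.map α.toLinearMap
        (toConv β * toConv (α.toLinearMap ∘ₗ HopfAlgebra.antipode K)).ofConv t) := by
    induction t with
    | zero => simp
    | add x y hx hy => simp only [map_add, hx, hy]
    | tmul x y => exact h1 x x (comul y)
  exact h2 (comul f)

/-- The antipode is a convolution inverse of the identity, also after an algebra homomorphism. -/
lemma antipode_comp_mul (α : A →ₐ[K] R) :
    toConv (α.toLinearMap ∘ₗ HopfAlgebra.antipode K) * toConv α.toLinearMap = 1 := by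
  have := LinearMap.algHom_comp_convMul_distrib α (toConv (HopfAlgebra.antipode K (A := A)))
    (toConv LinearMap.id)
  rw [LinearMap.antipode_mul_id] at this
  apply WithConv.ext
  refine Eq.trans this.symm ?_
  ext a
  simp

/-- Along a point derivation at the identity, inversion has derivative `-1`. -/
lemma apply_antipode (X : Lie (K := K) A) (a : A) : X.1 (HopfAlgebra.antipode K a) = -X.1 a := by
  have h1 : X.1 1 = 0 := by
    have := X.2 1 1
    simpa using this
  have h2 (t : A ⊗[K] A) : X.1 (LinearMap.mul' K A (TensorProduct.map LinearMap.id
      (HopfAlgebra.antipode K) t)) =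
      X.1 (HopfAlgebra.antipode K (TensorProduct.lid K A (TensorProduct.map counit LinearMap.id t)))
      + X.1 (TensorProduct.rid K A (TensorProduct.map LinearMap.id counit t)) := by
    induction t with
    | zero => simp
    | add x y hx hy => simp only [map_add, hx, hy]; ring
    | tmul x y =>
      have := X.2 x (HopfAlgebra.antipode K y)
      simp [this, mul_comm]
  have h3 := h2 (comul a)
  have e1 := Coalgebra.rTensor_counit_comul (R := K) a
  have e2 := Coalgebra.lTensor_counit_comul (R := K) a
  have e3 := HopfAlgebra.mul_antipode_lTensor_comul_apply (R := K) a
  rw [LinearMap.rTensor] at e1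
  rw [LinearMap.lTensor] at e2 e3
  rw [e1, e2, e3, Algebra.algebraMap_eq_smul_one, map_smul, h1] at h3
  simp only [smul_zero, TensorProduct.lid_tmul, one_smul, TensorProduct.rid_tmul] at h3
  exact eq_neg_of_add_eq_zero_left h3.symm

lemma algBr_apply (X Y : Lie (K := K) A) (a : A) :
    (algBr K A X Y).1 a = (toConv X.1 * toConv Y.1 - toConv Y.1 * toConv X.1 :
      WithConv (A →ₗ[K] K)) a := by
  have h (X Y : Lie (K := K) A) (t : A ⊗[K] A) :
      X.1 (TensorProduct.rid K A (TensorProduct.map LinearMap.id Y.1 t)) =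
      LinearMap.mul' K K (TensorProduct.map X.1 Y.1 t) := by
    induction t with
    | zero => simp
    | add x y hx hy => simp only [map_add, hx, hy]
    | tmul x y => simp [mul_comm]
  exact congrArg₂ (· - ·) (h X Y (comul a)) (h Y X (comul a))

lemma algBr_skew (X Y : Lie (K := K) A) : algBr K A X Y = -algBr K A Y X := by
  ext a
  rw [algBr_apply]
  simp only [NegMemClass.coe_neg, LinearMap.neg_apply, algBr_apply, WithConv.ofConv_sub,
    LinearMap.sub_apply, neg_sub]

/-- A point derivation turns convolution products into sums. -/
lemma lie_comp_convMul (X : Lie (K := K) A) (φ ψ : WithConv (A →ₗ[K] A)) :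
    toConv (X.1 ∘ₗ (φ * ψ).ofConv) =
      toConv (counit ∘ₗ φ.ofConv) * toConv (X.1 ∘ₗ ψ.ofConv) +
        toConv (X.1 ∘ₗ φ.ofConv) * toConv (counit ∘ₗ ψ.ofConv) := by
  have (t : A ⊗[K] A) : X.1 (LinearMap.mul' K A (TensorProduct.map φ.ofConv ψ.ofConv t)) =
      LinearMap.mul' K K (TensorProduct.map (counit ∘ₗ φ.ofConv) (X.1 ∘ₗ ψ.ofConv) t) +
        LinearMap.mul' K K (TensorProduct.map (X.1 ∘ₗ φ.ofConv) (counit ∘ₗ ψ.ofConv) t) := by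
    induction t with
    | zero => simp
    | add x y hx hy => simp only [map_add, hx, hy]; ring
    | tmul x y => simpa using X.2 (φ x) (ψ y)
  ext a
  exact this (comul a)

lemma counit_comp_convMul (φ ψ : WithConv (A →ₗ[K] A)) :
    toConv (counit ∘ₗ (φ * ψ).ofConv) =
      toConv (counit ∘ₗ φ.ofConv) * toConv ((counit : A →ₗ[K] K) ∘ₗ ψ.ofConv) := by
  ext a
  exact algHom_convMul_apply (Bialgebra.counitAlgHom K A) φ ψ a

lemma toConv_counit : toConv (counit : A →ₗ[K] K) = 1 := by
  ext a; simp

/-- The function `g ↦ (Ad_g Y) f` as a threefold convolution. -/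
lemma contrR_conj (Y : Lie (K := K) A) (f : A) :
    contrR (conj K A f) Y = (toConv LinearMap.id * (scal A Y.1 *
      toConv (HopfAlgebra.antipode K)) : WithConv (A →ₗ[K] A)) f := by
  have h (t : A ⊗[K] A) : contrR t Y = LinearMap.mul' K A
      (TensorProduct.map (AlgHom.id K A).toLinearMap (scal A Y.1).ofConv t) := by
    induction t with
    | zero => simp [contrR]
    | tmul x y => simp [contrR, scal, Algebra.smul_def, mul_comm]
    | add x y hx hy => simp only [map_add, ← hx, ← hy]; simp [contrR]
  rw [h, mul'_map_conj]
  rfl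

/-- The differential of `g ↦ Ad_g Y` at the identity is the adjoint representation. -/
lemma apply_contrR_conj (X Y : Lie (K := K) A) (f : A) :
    X.1 (contrR (conj K A f) Y) = (algBr K A X Y).1 f := by
  have h1 : X.1 ∘ₗ (scal A Y.1).ofConv = 0 := by
    ext a
    have : X.1 1 = 0 := by simpa using X.2 1 1
    simp [scal, Algebra.algebraMap_eq_smul_one, this]
  have h2 : X.1 ∘ₗ HopfAlgebra.antipode K = -X.1 := by ext a; simp [apply_antipode]
  have h3 : (counit : A →ₗ[K] K) ∘ₗ (scal A Y.1).ofConv = Y.1 := by ext a; simp [scal]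
  have := congrArg (fun φ => φ.ofConv f) (lie_comp_convMul X (toConv LinearMap.id)
    (scal A Y.1 * toConv (HopfAlgebra.antipode K)))
  simp only at this
  rw [lie_comp_convMul, counit_comp_convMul, WithConv.ofConv_toConv, WithConv.ofConv_toConv,
    WithConv.ofConv_toConv, h1, h2, h3, LinearMap.comp_id, LinearMap.comp_id,
    HopfAlgebra.counit_comp_antipode, toConv_counit, WithConv.toConv_zero, one_mul, mul_one,
    mul_one, add_zero] at this
  have hneg : toConv Y.1 * toConv (-X.1) = -(toConv Y.1 * toConv X.1) :=
    mul_neg (toConv Y.1) (toConv X.1)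
  rw [hneg, neg_add_eq_sub] at this
  rw [contrR_conj, algBr_apply]
  exact this

/-- The value at `g = 1` of `g ↦ (Ad_g Y) f`. -/
lemma counit_contrR_conj (Y : Lie (K := K) A) (f : A) :
    counit (R := K) (contrR (conj K A f) Y) = Y.1 f := by
  have h3 : (counit : A →ₗ[K] K) ∘ₗ (scal A Y.1).ofConv = Y.1 := by ext a; simp [scal]
  have := congrArg (fun φ => φ.ofConv f) (counit_comp_convMul (toConv LinearMap.id)
    (scal A Y.1 * toConv (HopfAlgebra.antipode K)))
  simp only at this
  rw [counit_comp_convMul, WithConv.ofConv_toConv, WithConv.ofConv_toConv, h3, LinearMap.comp_id,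
    HopfAlgebra.counit_comp_antipode, toConv_counit, one_mul, mul_one] at this
  rw [contrR_conj]
  exact this

end Convolution

/-! ### Invariant tensors over an affine algebraic group -/

section InvariantTensor

variable {K : Type*} [Field K] {A : Type*} [CommRing A] [HopfAlgebra K A]

/-- Over a field, tensors in `V ⊗ W` are separated by the functionals of `V`. -/
lemma tensor_eq_zero_of_forall_dual {V W : Type*} [AddCommGroup V] [Module K V] [AddCommGroup W]
    [Module K W] {t : V ⊗[K] W}
    (h : ∀ α : V →ₗ[K] K, TensorProduct.lid K W (TensorProduct.map α LinearMap.id t) = 0) :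
    t = 0 := by
  classical
  let b := Module.Basis.ofVectorSpace K V
  apply (TensorProduct.equivFinsuppOfBasisLeft (N := W) b).injective
  ext i
  have : ∀ t : V ⊗[K] W, TensorProduct.equivFinsuppOfBasisLeft (N := W) b t i =
      TensorProduct.lid K W (TensorProduct.map (b.coord i) LinearMap.id t) := by
    intro t
    induction t with
    | zero => simp
    | tmul x y => simp
    | add x y hx hy => simp only [map_add, Finsupp.add_apply, hx, hy]
  simp [this, h]

/-- Tensors in `V ⊗ V` are separated by pairs of functionals from a separating family. -/
lemma tensor_eq_zero_of_separating {V ι : Type*} [AddCommGroup V] [Module K V]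
    (e : ι → V →ₗ[K] K) (he : ∀ v, (∀ i, e i v = 0) → v = 0) {t : V ⊗[K] V}
    (h : ∀ i j, eval₂ (e i) (e j) t = 0) : t = 0 := by
  have hl (α β : V →ₗ[K] K) (t : V ⊗[K] V) :
      β (TensorProduct.lid K V (TensorProduct.map α LinearMap.id t)) = eval₂ α β t := by
    induction t with
    | zero => simp
    | tmul x y => simp
    | add x y hx hy => simp only [map_add, hx, hy]
  have hr (α β : V →ₗ[K] K) (t : V ⊗[K] V) :
      α (TensorProduct.rid K V (TensorProduct.map LinearMap.id β t)) = eval₂ α β t := by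
    induction t with
    | zero => simp
    | tmul x y => simp [mul_comm]
    | add x y hx hy => simp only [map_add, hx, hy]
  refine tensor_eq_zero_of_forall_dual fun α => he _ fun j => ?_
  rw [hl, ← hr, he (TensorProduct.rid K V (TensorProduct.map LinearMap.id (e j) t)) fun i => by
    rw [hr, h], map_zero]

/-- An `Ad`-invariant tensor is `ad`-invariant. -/
lemma IsAlgInvSymm.ad_inv {H : Lie (K := K) A ⊗[K] Lie (K := K) A} (hH : IsAlgInvSymm H)
    (X : Lie (K := K) A) : TensorProduct.map (algBr K A X) LinearMap.id H +
      TensorProduct.map LinearMap.id (algBr K A X) H = 0 := by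
  let e (f : A) : Lie (K := K) A →ₗ[K] K := (LinearMap.applyₗ f) ∘ₗ (Lie (K := K) A).subtype
  have he (v : Lie (K := K) A) (hv : ∀ f, e f v = 0) : v = 0 :=
    Subtype.ext (LinearMap.ext fun a => hv a)
  refine tensor_eq_zero_of_separating (V := Lie (K := K) A) e he fun f h => ?_
  have key (t : Lie (K := K) A ⊗[K] Lie (K := K) A) :
      X.1 (eval₂ (contrR (conj K A f)) (contrR (conj K A h)) t) =
        eval₂ (e f) (e h) (TensorProduct.map (algBr K A X) LinearMap.id t +
          TensorProduct.map LinearMap.id (algBr K A X) t) := by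
    induction t with
    | zero => simp
    | tmul x y =>
      have := X.2 (contrR (conj K A f) x) (contrR (conj K A h) y)
      simp only [counit_contrR_conj, apply_contrR_conj] at this
      simp only [eval₂_tmul, this, map_add, TensorProduct.map_tmul, LinearMap.id_apply]
      simp only [e, LinearMap.comp_apply, LinearMap.applyₗ_apply_apply, Submodule.subtype_apply]
      ring
    | add x y hx hy =>
      simp only [map_add] at hx hy ⊢
      rw [hx, hy]; ring
  rw [← key, hH.inv]
  have : X.1 1 = 0 := by simpa using X.2 1 1
  simp [Algebra.algebraMap_eq_smul_one, this]

end InvariantTensor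

/-! ### Infinitesimal actions on affine varieties -/

section AlgebraicAction

open WithConv Coalgebra

variable {K : Type*} [Field K] {A : Type*} [CommRing A] [HopfAlgebra K A]
  {B : Type*} [CommRing B] [Algebra K B]

/-- Contraction of the first tensor factor with a functional. -/
def contract (φ : A →ₗ[K] K) : A ⊗[K] B →ₗ[K] B :=
  (TensorProduct.lid K B).toLinearMap ∘ₗ TensorProduct.map φ LinearMap.id

@[simp] lemma contract_tmul (φ : A →ₗ[K] K) (a : A) (b : B) :
    contract φ (a ⊗ₜ[K] b) = φ a • b := by simp [contract]

/-- The action of the Lie algebra by derivations, `X ↦ X_M`. -/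
def algDeriv (ρ : B →ₐ[K] A ⊗[K] B) : Lie (K := K) A →ₗ[K] B →ₗ[K] B where
  toFun X := -(contract X.1 ∘ₗ ρ.toLinearMap)
  map_add' X Y := by
    ext f
    have := (algFund ρ f).map_add X Y
    exact this
  map_smul' c X := by
    ext f
    have := (algFund ρ f).map_smul c X
    exact this

variable {ρ : B →ₐ[K] A ⊗[K] B}

lemma algDeriv_apply (X : Lie (K := K) A) (f : B) :
    algDeriv ρ X f = -contract X.1 (ρ f) := rfl

lemma contract_mul (X : Lie (K := K) A) (s t : A ⊗[K] B) :
    contract X.1 (s * t) = contract counit s * contract X.1 t +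
      contract X.1 s * contract counit t := by
  induction s with
  | zero => simp
  | add x y hx hy => simp only [add_mul, map_add, hx, hy]; ring
  | tmul a b =>
    induction t with
    | zero => simp
    | add x y hx hy => simp only [mul_add, map_add, hx, hy]; ring
    | tmul c d =>
      have := X.2 a c
      simp only [Algebra.TensorProduct.tmul_mul_tmul, contract_tmul, this, add_smul,
        smul_mul_smul_comm]

lemma algDeriv_isLeibniz (hρ : IsCoaction ρ) (X : Lie (K := K) A) : IsLeibniz (algDeriv ρ X) := by
  intro a b
  have h (f : B) : contract (counit : A →ₗ[K] K) (ρ f) = f := hρ.counit f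
  simp only [algDeriv_apply, map_mul, contract_mul, h]
  ring

/-- Acting twice amounts to acting by the convolution product, in the reverse order. -/
lemma contract_contract (hρ : IsCoaction ρ) (φ ψ : A →ₗ[K] K) (f : B) :
    contract φ (ρ (contract ψ (ρ f))) =
      contract (toConv ψ * toConv φ : WithConv (A →ₗ[K] K)).ofConv (ρ f) := by
  have h1 (t : A ⊗[K] B) : contract φ (ρ (contract ψ t)) =
      (contract ψ) (TensorProduct.map LinearMap.id (contract φ)
        (TensorProduct.map LinearMap.id ρ.toLinearMap t)) := by
    induction t with
    | zero => simp
    | add x y hx hy => simp only [map_add, hx, hy]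
    | tmul a b => simp
  have h2 (b : B) (s : A ⊗[K] A) : (contract ψ) (TensorProduct.map LinearMap.id (contract φ)
      (TensorProduct.assoc K A A B (s ⊗ₜ[K] b))) =
      LinearMap.mul' K K (TensorProduct.map ψ φ s) • b := by
    induction s with
    | zero => simp
    | add x y hx hy => simp only [map_add, TensorProduct.add_tmul, add_smul, hx, hy]
    | tmul a c => simp [mul_smul, smul_comm (φ c)]
  have h3 (t : A ⊗[K] B) : (contract ψ) (TensorProduct.map LinearMap.id (contract φ)
      (TensorProduct.assoc K A A B (TensorProduct.map comul LinearMap.id t))) =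
      contract (toConv ψ * toConv φ : WithConv (A →ₗ[K] K)).ofConv t := by
    induction t with
    | zero => simp
    | add x y hx hy => simp only [map_add, hx, hy]
    | tmul a b => exact h2 b (comul a)
  rw [h1, ← hρ.coassoc, h3]

/-- The infinitesimal action is a Lie algebra homomorphism into vector fields. -/
lemma algDeriv_algBr (hρ : IsCoaction ρ) (X Y : Lie (K := K) A) (f : B) :
    algDeriv ρ (algBr K A X Y) f =
      algDeriv ρ X (algDeriv ρ Y f) - algDeriv ρ Y (algDeriv ρ X f) := by
  have h (t : A ⊗[K] B) : contract (algBr K A X Y).1 t =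
      contract (toConv X.1 * toConv Y.1 : WithConv (A →ₗ[K] K)).ofConv t -
        contract (toConv Y.1 * toConv X.1 : WithConv (A →ₗ[K] K)).ofConv t := by
    induction t with
    | zero => simp
    | add x y hx hy => simp only [map_add, hx, hy]; ring
    | tmul a b =>
      simp only [contract_tmul, algBr_apply, WithConv.ofConv_sub, LinearMap.sub_apply, sub_smul]
  simp only [algDeriv_apply, map_neg, neg_neg, contract_contract hρ, h]
  ring

/-- Invariance of a bivector, infinitesimally. -/
lemma IsAlgInvBivector.algDeriv_apply_apply (hρ : IsCoaction ρ) {P : B →ₗ[K] B →ₗ[K] B}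
    (hP : IsAlgInvBivector ρ P) (X : Lie (K := K) A) (f g : B) :
    algDeriv ρ X (P f g) = P (algDeriv ρ X f) g + P f (algDeriv ρ X g) := by
  have h (f : B) : contract (counit : A →ₗ[K] K) (ρ f) = f := hρ.counit f
  have key (s t : A ⊗[K] B) : contract X.1 (TensorProduct.map₂ (LinearMap.mul K A) P s t) =
      P (contract counit s) (contract X.1 t) + P (contract X.1 s) (contract counit t) := by
    induction s with
    | zero => simp
    | add x y hx hy => simp only [map_add, LinearMap.add_apply, hx, hy]; ring
    | tmul a b =>
      induction t with
      | zero => simp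
      | add x y hx hy => simp only [map_add, hx, hy]; ring
      | tmul c d =>
        have := X.2 a c
        simp only [TensorProduct.map₂_apply_tmul, TensorProduct.map_tmul, LinearMap.mul_apply',
          contract_tmul, this,
          add_smul, map_smul, LinearMap.smul_apply, smul_smul]
        simp only [mul_comm]
  simp only [algDeriv_apply, ← hP.inv, key, h, map_neg, LinearMap.neg_apply]
  ring

/-- A homomorphism of groups induces a homomorphism of Lie algebras. -/
lemma lieMap_algBr {A' : Type*} [CommRing A'] [HopfAlgebra K A'] (p : A' →ₐc[K] A)
    (X Y : Lie (K := K) A) :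
    algBr K A' (lieMap p X) (lieMap p Y) = lieMap p (algBr K A X Y) := by
  have h (X Y : Lie (K := K) A) (a : A') :
      (toConv (lieMap p X).1 * toConv (lieMap p Y).1 : WithConv (A' →ₗ[K] K)) a =
      (toConv X.1 * toConv Y.1 : WithConv (A →ₗ[K] K)) (p a) :=
    (LinearMap.congr_fun (LinearMap.convMul_comp_coalgHom_distrib (toConv X.1) (toConv Y.1)
      (p : A' →ₗc[K] A)) a).symm
  ext a
  rw [algBr_apply, WithConv.ofConv_sub, LinearMap.sub_apply, h, h]
  exact (algBr_apply X Y (p a)).symm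

lemma algIncl₁_apply (X : Lie (K := K) A) (a b : A) :
    (algIncl₁ K A X).1 (a ⊗ₜ[K] b) = X.1 a * counit (R := K) b := by
  simp [algIncl₁, lieMap, mul_comm]

lemma algIncl₂_apply (X : Lie (K := K) A) (a b : A) :
    (algIncl₂ K A X).1 (a ⊗ₜ[K] b) = counit (R := K) a * X.1 b := by
  simp [algIncl₂, lieMap]

lemma toConv_algIncl₁ (X : Lie (K := K) A) :
    toConv (algIncl₁ K A X).1 = tens (toConv X.1) 1 := by
  apply WithConv.ext
  apply TensorProduct.ext'
  intro a b
  rw [WithConv.ofConv_toConv, algIncl₁_apply]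
  simp

lemma toConv_algIncl₂ (X : Lie (K := K) A) :
    toConv (algIncl₂ K A X).1 = tens 1 (toConv X.1) := by
  apply WithConv.ext
  apply TensorProduct.ext'
  intro a b
  rw [WithConv.ofConv_toConv, algIncl₂_apply]
  simp

lemma scal_algIncl₁ (R : Type*) [CommRing R] [Algebra K R] (X : Lie (K := K) A) :
    scal R (algIncl₁ K A X).1 = tens (scal R X.1) 1 := by
  apply WithConv.ext
  apply TensorProduct.ext'
  intro a b
  simp [scal, algIncl₁_apply]

lemma scal_algIncl₂ (R : Type*) [CommRing R] [Algebra K R] (X : Lie (K := K) A) :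
    scal R (algIncl₂ K A X).1 = tens 1 (scal R X.1) := by
  apply WithConv.ext
  apply TensorProduct.ext'
  intro a b
  simp [scal, algIncl₂_apply]

/-- The two copies of the Lie algebra in that of the product group commute. -/
lemma algBr_algIncl (X Y : Lie (K := K) A) :
    algBr K (A ⊗[K] A) (algIncl₁ K A X) (algIncl₂ K A Y) = 0 := by
  apply Subtype.ext
  apply TensorProduct.ext'
  intro a b
  rw [algBr_apply, WithConv.ofConv_sub, LinearMap.sub_apply,
    toConv_algIncl₁, toConv_algIncl₂, tens_mul_tens, tens_mul_tens]
  simp only [one_mul, mul_one, sub_self]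
  rfl

/-- The infinitesimal diagonal action is the sum of the two infinitesimal actions. -/
lemma algFund_diagCoaction (ρ : B →ₐ[K] (A ⊗[K] A) ⊗[K] B) (f : B) :
    algFund (diagCoaction ρ) f = algFund ρ f ∘ₗ (algIncl₁ K A + algIncl₂ K A) := by
  have h1 (X : Lie (K := K) A) (z : A ⊗[K] A) : X.1 (Algebra.TensorProduct.lmul' K z) =
      (algIncl₁ K A X).1 z + (algIncl₂ K A X).1 z := by
    induction z with
    | zero => simp
    | add x y hx hy => simp only [map_add, hx, hy]; ring
    | tmul a b =>
      have := X.2 a b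
      simp only [Algebra.TensorProduct.lmul'_apply_tmul, this, algIncl₁_apply, algIncl₂_apply]
      ring
  have h2 (X : Lie (K := K) A) (t : (A ⊗[K] A) ⊗[K] B) :
      contract X.1 (Algebra.TensorProduct.map (Algebra.TensorProduct.lmul' K) (AlgHom.id K B) t) =
        contract (algIncl₁ K A X).1 t + contract (algIncl₂ K A X).1 t := by
    induction t with
    | zero => simp
    | add x y hx hy => simp only [map_add, hx, hy]; ring
    | tmul a b => simp [h1, add_smul]
  ext X
  have := congrArg Neg.neg (h2 X (ρ f))
  rw [neg_add] at this
  simp only [LinearMap.comp_apply, LinearMap.add_apply, map_add]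
  exact this

end AlgebraicAction

/-! ### Fusion for affine algebraic groups -/

section AlgebraicFusion

open WithConv Coalgebra

variable {K : Type*} [Field K] {A : Type*} [CommRing A] [HopfAlgebra K A]
  {B : Type*} [CommRing B] [Algebra K B]

lemma eval₂_chi_algIncl (a b : Lie (K := K) (A ⊗[K] A) →ₗ[K] B)
    (H : Lie (K := K) A ⊗[K] Lie (K := K) A) :
    eval₂ a b (chi (V := Lie (K := K) (A ⊗[K] A)) (algIncl₁ K A) (algIncl₂ K A) H) = (2 : K)⁻¹ •
      (eval₂ (a ∘ₗ algIncl₁ K A) (b ∘ₗ algIncl₂ K A) H -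
        eval₂ (b ∘ₗ algIncl₁ K A) (a ∘ₗ algIncl₂ K A) H) := by
  have := eval₂_chi (k := K) (B := B) (L := Lie (K := K) A) (V := Lie (K := K) (A ⊗[K] A))
    (algIncl₁ K A) (algIncl₂ K A) H a b
  exact this

lemma algFusion_apply (ρ : B →ₐ[K] (A ⊗[K] A) ⊗[K] B) (H : Lie (K := K) A ⊗[K] Lie (K := K) A)
    (P : B →ₗ[K] B →ₗ[K] B) (f h : B) :
    algFusion ρ H P f h = P f h - (2 : K)⁻¹ •
      (eval₂ (algFund ρ f ∘ₗ algIncl₁ K A) (algFund ρ h ∘ₗ algIncl₂ K A) H -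
        eval₂ (algFund ρ h ∘ₗ algIncl₁ K A) (algFund ρ f ∘ₗ algIncl₂ K A) H) := by
  rw [← eval₂_chi_algIncl]
  rfl

lemma algFund_mul {ρ : B →ₐ[K] A ⊗[K] B} (hρ : IsCoaction ρ) (f g : B) :
    algFund ρ (f * g) = LinearMap.mulLeft K f ∘ₗ algFund ρ g +
      LinearMap.mulRight K g ∘ₗ algFund ρ f := by
  ext X
  exact algDeriv_isLeibniz hρ X f g

lemma isAlgBivector_algFusion {ρ : B →ₐ[K] (A ⊗[K] A) ⊗[K] B} (hρ : IsCoaction ρ)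
    (H : Lie (K := K) A ⊗[K] Lie (K := K) A)
    {P : B →ₗ[K] B →ₗ[K] B} (hP : IsAlgBivector P) : IsAlgBivector (algFusion ρ H P) where
  skew f h := by
    rw [algFusion_apply, algFusion_apply, hP.skew f h, neg_sub, ← neg_sub (eval₂ _ _ _), smul_neg]
    ring
  leibniz f g h := by
    have key (a : Lie (K := K) (A ⊗[K] A) →ₗ[K] B)
        (t : Lie (K := K) (A ⊗[K] A) ⊗[K] Lie (K := K) (A ⊗[K] A)) :
        eval₂ a (algFund ρ (g * h)) t =
          g * eval₂ a (algFund ρ h) t + eval₂ a (algFund ρ g) t * h := by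
      induction t with
      | zero => simp
      | add x y hx hy => simp only [map_add, hx, hy]; ring
      | tmul x y =>
        simp only [eval₂_tmul, algFund_mul hρ, LinearMap.add_apply, LinearMap.comp_apply,
          LinearMap.mulLeft_apply, LinearMap.mulRight_apply]
        ring
    change P f (g * h) - eval₂ _ _ _ = g * (P f h - eval₂ _ _ _) + (P f g - eval₂ _ _ _) * h
    rw [key, hP.leibniz]
    ring

/-- Let `z : G → G'` be a homomorphism with comorphism `m` and let `Z` be a functional on the
functions of `G'`. If `κ` is `Z` twisted by `Ad_z`, then acting by `Z` after `z` amounts to acting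
by `z` after `κ`. -/
lemma map_contract_map {A' : Type*} [CommRing A'] [HopfAlgebra K A'] {ρ : B →ₐ[K] A' ⊗[K] B}
    (hρ : IsCoaction ρ) (m : A' →ₐ[K] A) (Z : A' →ₗ[K] K) (κ : WithConv (A' →ₗ[K] A))
    (hκ : κ * toConv m.toLinearMap = toConv m.toLinearMap * scal A Z) (f : B) :
    TensorProduct.map LinearMap.id (contract Z ∘ₗ ρ.toLinearMap)
        (TensorProduct.map m.toLinearMap LinearMap.id (ρ f)) =
      LinearMap.mul' K (A ⊗[K] B) (TensorProduct.map
        (Algebra.TensorProduct.includeLeft.toLinearMap ∘ₗ κ.ofConv)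
        (TensorProduct.map m.toLinearMap LinearMap.id ∘ₗ ρ.toLinearMap) (ρ f)) := by
  have h1 : TensorProduct.map (LinearMap.id : A →ₗ[K] A) (contract Z ∘ₗ ρ.toLinearMap) ∘ₗ
      TensorProduct.map m.toLinearMap LinearMap.id =
      TensorProduct.map m.toLinearMap (contract Z) ∘ₗ
        TensorProduct.map LinearMap.id ρ.toLinearMap := by
    ext; simp
  have h2 : TensorProduct.map
        (Algebra.TensorProduct.includeLeft.toLinearMap ∘ₗ κ.ofConv : A' →ₗ[K] A ⊗[K] B)
        (TensorProduct.map m.toLinearMap LinearMap.id ∘ₗ ρ.toLinearMap) =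
      TensorProduct.map (Algebra.TensorProduct.includeLeft.toLinearMap ∘ₗ κ.ofConv)
        (TensorProduct.map m.toLinearMap LinearMap.id) ∘ₗ
        TensorProduct.map LinearMap.id ρ.toLinearMap := by
    ext; simp
  have h3 (b : B) (s : A' ⊗[K] A') : TensorProduct.map m.toLinearMap (contract Z)
      (TensorProduct.assoc K A' A' B (s ⊗ₜ[K] b)) =
      LinearMap.mul' K A (TensorProduct.map m.toLinearMap (scal A Z).ofConv s) ⊗ₜ[K] b := by
    induction s with
    | zero => simp
    | add x y hx hy => simp only [map_add, TensorProduct.add_tmul, hx, hy]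
    | tmul a c =>
      simp [scal, mul_comm, ← Algebra.smul_def, TensorProduct.smul_tmul]
  have h4 (b : B) (s : A' ⊗[K] A') : LinearMap.mul' K (A ⊗[K] B)
      (TensorProduct.map (Algebra.TensorProduct.includeLeft.toLinearMap ∘ₗ κ.ofConv)
        (TensorProduct.map m.toLinearMap LinearMap.id)
        (TensorProduct.assoc K A' A' B (s ⊗ₜ[K] b))) =
      LinearMap.mul' K A (TensorProduct.map κ.ofConv m.toLinearMap s) ⊗ₜ[K] b := by
    induction s with
    | zero => simp
    | add x y hx hy => simp only [map_add, TensorProduct.add_tmul, hx, hy]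
    | tmul a c => simp
  have h5 (t : A' ⊗[K] B) : TensorProduct.map m.toLinearMap (contract Z)
      (TensorProduct.assoc K A' A' B (TensorProduct.map comul LinearMap.id t)) =
      LinearMap.mul' K (A ⊗[K] B)
      (TensorProduct.map (Algebra.TensorProduct.includeLeft.toLinearMap ∘ₗ κ.ofConv)
        (TensorProduct.map m.toLinearMap LinearMap.id)
        (TensorProduct.assoc K A' A' B (TensorProduct.map comul LinearMap.id t))) := by
    induction t with
    | zero => simp
    | add x y hx hy => simp only [map_add, hx, hy]
    | tmul a b =>
      simp only [TensorProduct.map_tmul, h3, h4, LinearMap.id_apply]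
      congr 1
      exact (LinearMap.congr_fun (congrArg WithConv.ofConv hκ) a).symm
  rw [h2, ← LinearMap.comp_apply, h1, LinearMap.comp_apply, LinearMap.comp_apply, ← hρ.coassoc, h5]

/-- `Ad_g X` as a function of `g`. -/
def adConv (X : Lie (K := K) A) : WithConv (A →ₗ[K] A) :=
  toConv LinearMap.id * (scal A X.1 * toConv (HopfAlgebra.antipode K))

lemma adConv_mul (X : Lie (K := K) A) :
    adConv X * toConv LinearMap.id = toConv LinearMap.id * scal A X.1 := by
  rw [adConv, mul_assoc, mul_assoc, LinearMap.antipode_mul_id, mul_one]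

lemma toConv_lmul' : toConv (Algebra.TensorProduct.lmul' K : A ⊗[K] A →ₐ[K] A).toLinearMap =
    tens (toConv LinearMap.id) (toConv LinearMap.id) := by
  apply WithConv.ext
  apply TensorProduct.ext'
  intro a b
  simp

lemma map₂_sub_smul_sub (P P₁ P₂ : B →ₗ[K] B →ₗ[K] B) (c : K) (s t : A ⊗[K] B) :
    TensorProduct.map₂ (LinearMap.mul K A) (P - c • (P₁ - P₂)) s t =
      TensorProduct.map₂ (LinearMap.mul K A) P s t -
        c • (TensorProduct.map₂ (LinearMap.mul K A) P₁ s t -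
          TensorProduct.map₂ (LinearMap.mul K A) P₂ s t) := by
  induction s with
  | zero => simp
  | add x y hx hy =>
    simp only [map_add, LinearMap.add_apply, hx, hy, smul_sub, smul_add]; abel
  | tmul a b =>
    induction t with
    | zero => simp
    | add x y hx hy => simp only [map_add, hx, hy, smul_sub, smul_add]; abel
    | tmul c d => simp [TensorProduct.tmul_sub]

lemma map₂_mul_flip (P : B →ₗ[K] B →ₗ[K] B) (s t : A ⊗[K] B) :
    TensorProduct.map₂ (LinearMap.mul K A) P.flip s t =
      TensorProduct.map₂ (LinearMap.mul K A) P t s := by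
  induction s with
  | zero => simp
  | add x y hx hy => simp only [map_add, LinearMap.add_apply, hx, hy]
  | tmul a b =>
    induction t with
    | zero => simp
    | add x y hx hy => simp only [map_add, LinearMap.add_apply, hx, hy]
    | tmul c d => simp [mul_comm]

lemma map₂_mul_sum_compl₁₂ {ι : Type*} (S : Finset ι) (X Y : ι → B →ₗ[K] B) (s t : A ⊗[K] B) :
    TensorProduct.map₂ (LinearMap.mul K A)
        (∑ p ∈ S, (LinearMap.mul K B).compl₁₂ (X p) (Y p)) s t =
      ∑ p ∈ S, TensorProduct.map LinearMap.id (X p) s * TensorProduct.map LinearMap.id (Y p) t := by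
  induction s with
  | zero => simp
  | add x y hx hy => simp only [map_add, LinearMap.add_apply, hx, hy, add_mul,
      Finset.sum_add_distrib]
  | tmul a b =>
    induction t with
    | zero => simp
    | add x y hx hy => simp only [map_add, hx, hy, mul_add, Finset.sum_add_distrib]
    | tmul c d => simp [TensorProduct.tmul_sum]

/-- Extension of scalars of a bilinear operator is compatible with homomorphisms of scalars. -/
lemma map₂_mul_map {A' : Type*} [CommRing A'] [Algebra K A'] (m : A' →ₐ[K] A)
    (P : B →ₗ[K] B →ₗ[K] B) (s t : A' ⊗[K] B) :
    TensorProduct.map₂ (LinearMap.mul K A) P (Algebra.TensorProduct.map m (AlgHom.id K B) s)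
        (Algebra.TensorProduct.map m (AlgHom.id K B) t) =
      Algebra.TensorProduct.map m (AlgHom.id K B)
        (TensorProduct.map₂ (LinearMap.mul K A') P s t) := by
  induction s with
  | zero => simp
  | add x y hx hy => simp only [map_add, LinearMap.add_apply, hx, hy]
  | tmul a b =>
    induction t with
    | zero => simp
    | add x y hx hy => simp only [map_add, hx, hy]
    | tmul c d => simp

/-- For an invariant tensor, `∑ (Ad_g u)(a) (Ad_g v)(b)` does not depend on `g`. -/
lemma sum_adConv {S : Finset (Lie (K := K) A × Lie (K := K) A)}
    (hH : IsAlgInvSymm (∑ p ∈ S, p.1 ⊗ₜ[K] p.2)) (a b : A) :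
    ∑ p ∈ S, adConv p.1 a * adConv p.2 b = algebraMap K A (∑ p ∈ S, p.1.1 a * p.2.1 b) := by
  have := hH.inv a b
  simp only [map_sum, eval₂_tmul] at this
  rw [map_sum]
  refine (Finset.sum_congr rfl fun p _ => ?_).trans this
  rw [contrR_conj, contrR_conj]
  rfl

/-- The mixed part `∑ u¹ ⊗ v²` of the fusion term is invariant under the diagonal action. -/
lemma map₂_mul_mixed {ρ : B →ₐ[K] (A ⊗[K] A) ⊗[K] B} (hρ : IsCoaction ρ)
    {S : Finset (Lie (K := K) A × Lie (K := K) A)}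
    (hH : IsAlgInvSymm (∑ p ∈ S, p.1 ⊗ₜ[K] p.2)) {Q : B →ₗ[K] B →ₗ[K] B}
    (hQ : Q = ∑ p ∈ S, (LinearMap.mul K B).compl₁₂ (algDeriv ρ (algIncl₁ K A p.1))
      (algDeriv ρ (algIncl₂ K A p.2))) (f h : B) :
    TensorProduct.map₂ (LinearMap.mul K A) Q (diagCoaction ρ f) (diagCoaction ρ h) =
      diagCoaction ρ (Q f h) := by
  set m : A ⊗[K] A →ₐ[K] A := Algebra.TensorProduct.lmul' K with hm
  set κ₁ : Lie (K := K) A → WithConv (A ⊗[K] A →ₗ[K] A) := fun X => tens (adConv X) 1 with hκ₁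
  set κ₂ : Lie (K := K) A → WithConv (A ⊗[K] A →ₗ[K] A) := fun X => tens 1 (adConv X) with hκ₂
  have e₁ (X : Lie (K := K) A) :
      κ₁ X * toConv m.toLinearMap = toConv m.toLinearMap * scal A (algIncl₁ K A X).1 := by
    rw [hκ₁, hm, toConv_lmul', scal_algIncl₁, tens_mul_tens, tens_mul_tens, adConv_mul, one_mul,
      mul_one]
  have e₂ (X : Lie (K := K) A) :
      κ₂ X * toConv m.toLinearMap = toConv m.toLinearMap * scal A (algIncl₂ K A X).1 := by
    rw [hκ₂, hm, toConv_lmul', scal_algIncl₂, tens_mul_tens, tens_mul_tens, adConv_mul, one_mul,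
      mul_one]
  -- The operator `a' ⊗ b ↦ κ(a') ρ(b)`, with `ρ` restricted to the diagonal.
  set Λ : WithConv (A ⊗[K] A →ₗ[K] A) → (A ⊗[K] A) ⊗[K] B →ₗ[K] A ⊗[K] B := fun κ =>
    LinearMap.mul' K (A ⊗[K] B) ∘ₗ TensorProduct.map
      (Algebra.TensorProduct.includeLeft.toLinearMap ∘ₗ κ.ofConv)
      (TensorProduct.map m.toLinearMap LinearMap.id ∘ₗ ρ.toLinearMap) with hΛ
  have hdiag (b : B) : TensorProduct.map m.toLinearMap LinearMap.id (ρ b) = diagCoaction ρ b := rfl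
  have hΛt (κ : WithConv (A ⊗[K] A →ₗ[K] A)) (z : A ⊗[K] A) (b : B) :
      Λ κ (z ⊗ₜ[K] b) = (κ z ⊗ₜ[K] 1) * diagCoaction ρ b := by
    simp [hΛ, ← hdiag]
  have hspl (x y : A) : (x * y) ⊗ₜ[K] (1 : B) = x ⊗ₜ[K] 1 * y ⊗ₜ[K] 1 := by simp
  have hscal (r : K) : algebraMap K A r ⊗ₜ[K] (1 : B) = algebraMap K (A ⊗[K] B) r := rfl
  have key (s t : (A ⊗[K] A) ⊗[K] B) : ∑ p ∈ S, Λ (κ₁ p.1) s * Λ (κ₂ p.2) t =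
      diagCoaction ρ (∑ p ∈ S, contract (algIncl₁ K A p.1).1 s *
        contract (algIncl₂ K A p.2).1 t) := by
    induction s with
    | zero => simp
    | add x y hx hy => simp only [map_add, add_mul, Finset.sum_add_distrib, hx, hy]
    | tmul z b =>
      induction z with
      | zero => simp
      | add x y hx hy =>
        simp only [TensorProduct.add_tmul, map_add, add_mul, Finset.sum_add_distrib, hx, hy]
      | tmul a₁ a₂ =>
        induction t with
        | zero => simp
        | add x y hx hy => simp only [map_add, mul_add, Finset.sum_add_distrib, hx, hy]
        | tmul w d =>
          induction w with
          | zero => simp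
          | add x y hx hy =>
            simp only [TensorProduct.add_tmul, map_add, mul_add, Finset.sum_add_distrib, hx, hy]
          | tmul c₁ c₂ =>
            have h1 := congrArg (fun x : A => (x ⊗ₜ[K] (1 : B)) *
              ((counit (R := K) a₂ * counit (R := K) c₁) • diagCoaction ρ (b * d)))
              (sum_adConv hH a₁ c₂)
            simp only [TensorProduct.sum_tmul, Finset.sum_mul, hspl] at h1
            refine (Finset.sum_congr rfl fun p _ => ?_).trans (h1.trans ?_)
            · simp only [hΛt, hκ₁, hκ₂, tens_tmul, LinearMap.convOne_apply, hspl, hscal, map_mul,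
                Algebra.smul_def]
              ring
            · rw [hscal]
              simp only [contract_tmul, algIncl₁_apply, algIncl₂_apply, Algebra.smul_def, map_mul,
                map_sum, AlgHom.commutes, Finset.sum_mul]
              exact Finset.sum_congr rfl fun p _ => by ring
  have hf₁ (X : Lie (K := K) A) := map_contract_map hρ m (algIncl₁ K A X).1 (κ₁ X) (e₁ X) f
  have hh₂ (X : Lie (K := K) A) := map_contract_map hρ m (algIncl₂ K A X).1 (κ₂ X) (e₂ X) h
  have hneg (Z : Lie (K := K) (A ⊗[K] A)) (s : A ⊗[K] B) :
      TensorProduct.map LinearMap.id (algDeriv ρ Z) s =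
        -TensorProduct.map LinearMap.id (contract Z.1 ∘ₗ ρ.toLinearMap) s := by
    have : TensorProduct.map (LinearMap.id : A →ₗ[K] A) (-(contract Z.1 ∘ₗ ρ.toLinearMap)) =
        -TensorProduct.map (LinearMap.id : A →ₗ[K] A) (contract Z.1 ∘ₗ ρ.toLinearMap) := by
      ext; simp [TensorProduct.tmul_neg]
    exact LinearMap.congr_fun this s
  rw [hQ, map₂_mul_sum_compl₁₂]
  simp only [hneg, neg_mul_neg, ← hdiag, hf₁, hh₂]
  refine (key (ρ f) (ρ h)).trans ?_
  rw [hdiag]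
  simp [algDeriv_apply]

/-- Fusing an invariant bivector gives a bivector invariant under the diagonal action. -/
lemma isAlgInvBivector_algFusion {ρ : B →ₐ[K] (A ⊗[K] A) ⊗[K] B} (hρ : IsCoaction ρ)
    {H : Lie (K := K) A ⊗[K] Lie (K := K) A} (hH : IsAlgInvSymm H)
    {P : B →ₗ[K] B →ₗ[K] B} (hP : IsAlgInvBivector ρ P) :
    IsAlgInvBivector (diagCoaction ρ) (algFusion ρ H P) where
  toIsAlgBivector := isAlgBivector_algFusion hρ H hP.toIsAlgBivector
  inv f h := by
    obtain ⟨S, rfl⟩ := TensorProduct.exists_finset H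
    set Q : B →ₗ[K] B →ₗ[K] B := ∑ p ∈ S, (LinearMap.mul K B).compl₁₂
      (algDeriv ρ (algIncl₁ K A p.1)) (algDeriv ρ (algIncl₂ K A p.2)) with hQ
    have hfus : algFusion ρ (∑ p ∈ S, p.1 ⊗ₜ[K] p.2) P = P - (2 : K)⁻¹ • (Q - Q.flip) := by
      ext f h
      rw [algFusion_apply]
      simp only [map_sum, eval₂_tmul, hQ, LinearMap.sub_apply, LinearMap.smul_apply,
        LinearMap.flip_apply, LinearMap.sum_apply, LinearMap.compl₁₂_apply, LinearMap.mul_apply']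
      rfl
    rw [hfus, map₂_sub_smul_sub, map₂_mul_flip, map₂_mul_mixed hρ hH hQ, map₂_mul_mixed hρ hH hQ]
    have hPd : TensorProduct.map₂ (LinearMap.mul K A) P (diagCoaction ρ f) (diagCoaction ρ h) =
        diagCoaction ρ (P f h) := by
      change TensorProduct.map₂ _ P (Algebra.TensorProduct.map _ _ (ρ f))
        (Algebra.TensorProduct.map _ _ (ρ h)) = _
      rw [map₂_mul_map, hP.inv]
      rfl
    rw [hPd]
    simp only [LinearMap.sub_apply, LinearMap.smul_apply, LinearMap.flip_apply, map_sub, map_smul]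

end AlgebraicFusion

/-! ### Momentum mappings and quasi Poisson structures on affine varieties -/

section AlgebraicMomentum

open WithConv Coalgebra

variable {K : Type*} [Field K] {A : Type*} [CommRing A] [HopfAlgebra K A]
  {B : Type*} [CommRing B] [Algebra K B]

lemma mul'_map_include {A' : Type*} [AddCommGroup A'] [Module K A'] {C : Type*} [AddCommGroup C]
    [Module K C] (α : A' →ₗ[K] A) (β : C →ₗ[K] B) (t : A' ⊗[K] C) :
    LinearMap.mul' K (A ⊗[K] B) (TensorProduct.map
      (Algebra.TensorProduct.includeLeft.toLinearMap ∘ₗ α : A' →ₗ[K] A ⊗[K] B)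
      ((Algebra.TensorProduct.includeRight : B →ₐ[K] A ⊗[K] B).toLinearMap ∘ₗ β) t) =
      TensorProduct.map α β t := by
  induction t with
  | zero => simp
  | add x y hx hy => simp only [map_add, hx, hy]
  | tmul a b => simp

lemma toConv_mulComorphism (Φ₁ Φ₂ : A →ₐ[K] B) :
    toConv (mulComorphism Φ₁ Φ₂).toLinearMap =
      toConv Φ₁.toLinearMap * toConv Φ₂.toLinearMap := by
  have : (Algebra.TensorProduct.productMap Φ₁ Φ₂).toLinearMap =
      LinearMap.mul' K B ∘ₗ TensorProduct.map Φ₁.toLinearMap Φ₂.toLinearMap := by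
    ext; simp
  ext a
  exact LinearMap.congr_fun this (comul a)

lemma toConv_productMap (Φ₁ Φ₂ : A →ₐ[K] B) :
    toConv (Algebra.TensorProduct.productMap Φ₁ Φ₂).toLinearMap =
      tens (toConv Φ₁.toLinearMap) (toConv Φ₂.toLinearMap) := by
  apply WithConv.ext
  apply TensorProduct.ext'
  intro a b
  simp

lemma productMap_comul (Φ₁ Φ₂ : A →ₐ[K] B) (f : A) :
    Algebra.TensorProduct.productMap Φ₁ Φ₂ (comul (R := K) f) = mulComorphism Φ₁ Φ₂ f := rfl

/-- The infinitesimal conjugation action is the difference of the two translations. -/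
lemma contract_conj (X : Lie (K := K) A) (f : A) :
    contract X.1 (conj K A f) =
      (scal A X.1 * toConv LinearMap.id - toConv LinearMap.id * scal A X.1 :
        WithConv (A →ₗ[K] A)) f := by
  have h1 (a : A) (s : A ⊗[K] A) : contract X.1
      (TensorProduct.map (LinearMap.mul' K A) LinearMap.id
        ((TensorProduct.assoc K A A A).symm (a ⊗ₜ[K] (TensorProduct.map (HopfAlgebra.antipode K)
          LinearMap.id (TensorProduct.comm K A A s))))) =
      X.1 a • TensorProduct.rid K A (TensorProduct.map LinearMap.id counit s) -
        counit (R := K) a •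
          LinearMap.mul' K A (TensorProduct.map LinearMap.id (scal A X.1).ofConv s) := by
    induction s with
    | zero => simp
    | add x y hx hy =>
      simp only [TensorProduct.tmul_add, map_add, hx, hy, smul_add]; abel
    | tmul x y =>
      have := X.2 a (HopfAlgebra.antipode K y)
      rw [apply_antipode, HopfAlgebra.counit_antipode] at this
      simp [this, scal, Algebra.smul_def]
      ring
  have h2 (t : A ⊗[K] A) : contract X.1
      (TensorProduct.map (LinearMap.mul' K A) LinearMap.id
        ((TensorProduct.assoc K A A A).symm (TensorProduct.map LinearMap.id
          (TensorProduct.map (HopfAlgebra.antipode K) LinearMap.id ∘ₗ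
            (TensorProduct.comm K A A).toLinearMap ∘ₗ comul) t))) =
      LinearMap.mul' K A (TensorProduct.map (scal A X.1).ofConv LinearMap.id t) -
        (toConv LinearMap.id * scal A X.1 : WithConv (A →ₗ[K] A))
          (TensorProduct.lid K A (TensorProduct.map counit LinearMap.id t)) := by
    induction t with
    | zero => simp
    | add x y hx hy => simp only [map_add, hx, hy]; abel
    | tmul x y =>
      refine (h1 x (comul y)).trans ?_
      have e2 := Coalgebra.lTensor_counit_comul (R := K) y
      rw [LinearMap.lTensor] at e2
      rw [e2]
      simp only [TensorProduct.map_tmul, TensorProduct.rid_tmul, TensorProduct.lid_tmul, one_smul,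
        LinearMap.mul'_apply, LinearMap.id_apply, map_smul]
      rw [Algebra.smul_def]
      rfl
  refine (h2 (comul f)).trans ?_
  have e1 := Coalgebra.rTensor_counit_comul (R := K) f
  rw [LinearMap.rTensor] at e1
  rw [e1]
  simp

variable {ρ : B →ₐ[K] (A ⊗[K] A) ⊗[K] B} {Φ₁ Φ₂ : A →ₐ[K] B}

/-- The product of two equivariant maps is equivariant for the diagonal action. -/
lemma diagCoaction_mulComorphism
    (hΦ : ∀ z : A ⊗[K] A, ρ (Algebra.TensorProduct.productMap Φ₁ Φ₂ z) =
      TensorProduct.map LinearMap.id (Algebra.TensorProduct.productMap Φ₁ Φ₂).toLinearMap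
        (conj K (A ⊗[K] A) z)) (f : A) :
    diagCoaction ρ (mulComorphism Φ₁ Φ₂ f) =
      TensorProduct.map LinearMap.id (mulComorphism Φ₁ Φ₂).toLinearMap (conj K A f) := by
  set ι : A →ₐ[K] A ⊗[K] B := Algebra.TensorProduct.includeLeft with hι
  set ι' : B →ₐ[K] A ⊗[K] B := Algebra.TensorProduct.includeRight with hι'
  set α : A ⊗[K] A →ₐ[K] A ⊗[K] B := ι.comp (Algebra.TensorProduct.lmul' K) with hα
  set β := Algebra.TensorProduct.productMap Φ₁ Φ₂ with hβ
  have hα' : toConv α.toLinearMap = tens (toConv ι.toLinearMap) (toConv ι.toLinearMap) := by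
    apply WithConv.ext
    apply TensorProduct.ext'
    intro a b
    simp [hα]
  have hβ' : toConv (ι'.toLinearMap ∘ₗ β.toLinearMap) =
      tens (toConv (ι'.toLinearMap ∘ₗ Φ₁.toLinearMap))
        (toConv (ι'.toLinearMap ∘ₗ Φ₂.toLinearMap)) := by
    apply WithConv.ext
    apply TensorProduct.ext'
    intro a b
    simp [hβ]
  have hS : toConv (α.toLinearMap ∘ₗ HopfAlgebra.antipode K) =
      tens (toConv (ι.toLinearMap ∘ₗ HopfAlgebra.antipode K))
        (toConv (ι.toLinearMap ∘ₗ HopfAlgebra.antipode K)) := by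
    apply WithConv.ext
    apply TensorProduct.ext'
    intro a b
    simp [hα]
  have hprod : toConv (ι'.toLinearMap ∘ₗ (mulComorphism Φ₁ Φ₂).toLinearMap) =
      toConv (ι'.toLinearMap ∘ₗ Φ₁.toLinearMap) * toConv (ι'.toLinearMap ∘ₗ Φ₂.toLinearMap) := by
    ext a
    have := algHom_convMul_apply ι' (toConv Φ₁.toLinearMap) (toConv Φ₂.toLinearMap) a
    rw [← toConv_mulComorphism] at this
    exact this
  have hm : TensorProduct.map (Algebra.TensorProduct.lmul' K : A ⊗[K] A →ₐ[K] A).toLinearMap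
      (LinearMap.id : B →ₗ[K] B) ∘ₗ TensorProduct.map LinearMap.id β.toLinearMap =
      TensorProduct.map (Algebra.TensorProduct.lmul' K : A ⊗[K] A →ₐ[K] A).toLinearMap
        β.toLinearMap := by
    ext; simp
  have h1 : diagCoaction ρ (mulComorphism Φ₁ Φ₂ f) =
      (toConv α.toLinearMap * (toConv (ι'.toLinearMap ∘ₗ β.toLinearMap) *
        toConv (α.toLinearMap ∘ₗ HopfAlgebra.antipode K))) (comul (R := K) f) := by
    rw [← mul'_map_conj, hα, AlgHom.comp_toLinearMap, hι, hι', mul'_map_include, ← hm,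
      LinearMap.comp_apply, ← hΦ]
    rfl
  have h2 : TensorProduct.map LinearMap.id (mulComorphism Φ₁ Φ₂).toLinearMap (conj K A f) =
      (toConv ι.toLinearMap * (toConv (ι'.toLinearMap ∘ₗ (mulComorphism Φ₁ Φ₂).toLinearMap) *
        toConv (ι.toLinearMap ∘ₗ HopfAlgebra.antipode K))) f := by
    rw [← mul'_map_conj, ← mul'_map_include]
    rfl
  rw [h1, h2, hα', hβ', hS, tens_mul_tens, tens_mul_tens, tens_comul, hprod]
  have hc := antipode_comp_mul ι
  congr 1
  simp only [mul_assoc]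
  rw [← mul_assoc (toConv (ι.toLinearMap ∘ₗ HopfAlgebra.antipode K)) (toConv ι.toLinearMap), hc,
    one_mul]

/-- The product of the components of a momentum mapping is a momentum mapping for the fused
bivector. -/
theorem isAlgMomentumMap_mulComorphism (hρ : IsCoaction ρ) [CharZero K]
    {H : Lie (K := K) A ⊗[K] Lie (K := K) A} (hH : IsAlgInvSymm H) {P : B →ₗ[K] B →ₗ[K] B}
    (hP : IsAlgInvBivector ρ P)
    (hΦ : IsAlgMomentumMap ρ (doubled (algIncl₁ K A) (algIncl₂ K A) H) P
      (Algebra.TensorProduct.productMap Φ₁ Φ₂)) :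
    IsAlgMomentumMap (diagCoaction ρ) H (algFusion ρ H P) (mulComorphism Φ₁ Φ₂) where
  bivector := isAlgInvBivector_algFusion hρ hH hP
  equivariant := diagCoaction_mulComorphism hΦ.equivariant
  momentum f h := by
    set β := Algebra.TensorProduct.productMap Φ₁ Φ₂ with hβ
    set φ₁ := toConv Φ₁.toLinearMap with hφ₁
    set φ₂ := toConv Φ₂.toLinearMap with hφ₂
    -- The derivatives of `f(Φ₁ Φ₂)` along `X` inserted on the left, in the middle, on the right.
    set cR : Lie (K := K) A → B := fun X => (scal B X.1 * (φ₁ * φ₂)) f with hcR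
    set cM : Lie (K := K) A → B := fun X => (φ₁ * (scal B X.1 * φ₂)) f with hcM
    set cL : Lie (K := K) A → B := fun X => (φ₁ * (φ₂ * scal B X.1)) f with hcL
    have hR (Z : Lie (K := K) (A ⊗[K] A)) (z : A ⊗[K] A) :
        β (contrR (comul (R := K) z) Z) = (tens φ₁ φ₂ * scal B Z.1) z := by
      rw [contrR_comul, algHom_convMul_apply β, algHom_comp_scal, ← toConv_productMap]
      rfl
    have hL (Z : Lie (K := K) (A ⊗[K] A)) (z : A ⊗[K] A) :
        β (contrL (comul (R := K) z) Z) = (scal B Z.1 * tens φ₁ φ₂) z := by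
      rw [contrL_comul, algHom_convMul_apply β, algHom_comp_scal, ← toConv_productMap]
      rfl
    have r₁ (X : Lie (K := K) A) :
        (tens φ₁ φ₂ * scal B (algIncl₁ K A X).1) (comul (R := K) f) = cM X := by
      rw [scal_algIncl₁, tens_mul_tens, tens_comul, mul_one, mul_assoc]
    have r₂ (X : Lie (K := K) A) :
        (tens φ₁ φ₂ * scal B (algIncl₂ K A X).1) (comul (R := K) f) = cL X := by
      rw [scal_algIncl₂, tens_mul_tens, tens_comul, mul_one]
    have l₁ (X : Lie (K := K) A) :
        (scal B (algIncl₁ K A X).1 * tens φ₁ φ₂) (comul (R := K) f) = cR X := by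
      rw [scal_algIncl₁, tens_mul_tens, tens_comul, one_mul, mul_assoc]
    have l₂ (X : Lie (K := K) A) :
        (scal B (algIncl₂ K A X).1 * tens φ₁ φ₂) (comul (R := K) f) = cM X := by
      rw [scal_algIncl₂, tens_mul_tens, tens_comul, one_mul]
    -- The fundamental vector fields applied to `f(Φ₁ Φ₂)`, from equivariance.
    have hfund (Z : Lie (K := K) (A ⊗[K] A)) : algFund ρ (mulComorphism Φ₁ Φ₂ f) Z =
        (tens φ₁ φ₂ * scal B Z.1) (comul (R := K) f) -
          (scal B Z.1 * tens φ₁ φ₂) (comul (R := K) f) := by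
      have hc (t : (A ⊗[K] A) ⊗[K] (A ⊗[K] A)) :
          contract Z.1 (TensorProduct.map LinearMap.id β.toLinearMap t) = β (contract Z.1 t) := by
        induction t with
        | zero => simp
        | add x y hx hy => simp only [map_add, hx, hy]
        | tmul a b => simp
      change -contract Z.1 (ρ (β (comul f))) = _
      rw [hΦ.equivariant, hc, contract_conj, WithConv.ofConv_sub, LinearMap.sub_apply,
        ← contrL_comul, ← contrR_comul, map_sub, hL, hR, neg_sub]
    have hΦR (X : Lie (K := K) A) : mulComorphism Φ₁ Φ₂ (contrR (comul (R := K) f) X) = cL X := by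
      rw [contrR_comul, algHom_convMul_apply, algHom_comp_scal, hcL]
      simp only [← mul_assoc, hφ₁, hφ₂, ← toConv_mulComorphism]
      rfl
    have hΦL (X : Lie (K := K) A) : mulComorphism Φ₁ Φ₂ (contrL (comul (R := K) f) X) = cR X := by
      rw [contrL_comul, algHom_convMul_apply, algHom_comp_scal, hcR]
      simp only [hφ₁, hφ₂, ← toConv_mulComorphism]
      rfl
    rw [algFusion_apply, ← productMap_comul, hΦ.momentum, productMap_comul]
    have hsymm := eval₂_comm (algFund ρ h ∘ₗ algIncl₁ K A)
      (algFund ρ (mulComorphism Φ₁ Φ₂ f) ∘ₗ algIncl₂ K A) H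
    rw [hH.symm] at hsymm
    rw [hsymm, doubled, map_add, eval₂_map, eval₂_map, algFund_diagCoaction]
    obtain ⟨S, rfl⟩ := TensorProduct.exists_finset H
    simp only [map_sum, eval₂_tmul, LinearMap.comp_apply, LinearMap.smul_apply,
      LinearMap.add_apply, AlgHom.toLinearMap_apply, map_add, hΦL, hΦR, hfund, r₁, r₂, l₁, l₂,
      hR, hL, ← Finset.sum_sub_distrib, Finset.smul_sum,
      ← Finset.sum_add_distrib]
    refine Finset.sum_congr rfl fun p _ => ?_
    have h2 : (2 : K) ≠ 0 := two_ne_zero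
    simp only [Algebra.smul_def]
    ring

/-- Fusion of quasi Poisson structures for affine algebraic groups. -/
theorem isAlgQuasiPoisson_algFusion (hρ : IsCoaction ρ) [CharZero K]
    {H : Lie (K := K) A ⊗[K] Lie (K := K) A} (hH : IsAlgInvSymm H) {P : B →ₗ[K] B →ₗ[K] B}
    (hP : IsAlgQuasiPoisson ρ (doubled (algIncl₁ K A) (algIncl₂ K A) H) P) :
    IsAlgQuasiPoisson (diagCoaction ρ) H (algFusion ρ H P) where
  toIsAlgInvBivector := isAlgInvBivector_algFusion hρ hH hP.toIsAlgInvBivector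
  schouten_eq f g h := by
    have hi₁ (X Y : Lie (K := K) A) : algIncl₁ K A (algBr K A X Y) =
      algBr K (A ⊗[K] A) (algIncl₁ K A X) (algIncl₁ K A Y) := (lieMap_algBr _ X Y).symm
    have hi₂ (X Y : Lie (K := K) A) : algIncl₂ K A (algBr K A X Y) =
      algBr K (A ⊗[K] A) (algIncl₂ K A X) (algIncl₂ K A Y) := (lieMap_algBr _ X Y).symm
    have hfus (f h : B) : algFusion ρ H P f h = P f h - eval₂ ((algDeriv ρ).flip f)
        ((algDeriv ρ).flip h)
        (chi (V := Lie (K := K) (A ⊗[K] A)) (algIncl₁ K A) (algIncl₂ K A) H) := by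
      rw [algFusion_apply, ← eval₂_chi_algIncl]
      rfl
    have hbr (X Y : Lie (K := K) (A ⊗[K] A)) (f : B) : algDeriv ρ (algBr K (A ⊗[K] A) X Y) f =
        algDeriv ρ X (algDeriv ρ Y f) - algDeriv ρ Y (algDeriv ρ X f) := algDeriv_algBr hρ X Y f
    have h₁ (X Y : Lie (K := K) A) (f : B) := (congrArg (fun Z => algDeriv ρ Z f) (hi₁ X Y)).trans
      (hbr _ _ f)
    have h₂ (X Y : Lie (K := K) A) (f : B) := (congrArg (fun Z => algDeriv ρ Z f) (hi₂ X Y)).trans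
      (hbr _ _ f)
    have h₁₂ (X Y : Lie (K := K) A) (f : B) :
        algDeriv ρ (algIncl₁ K A X) (algDeriv ρ (algIncl₂ K A Y) f) =
          algDeriv ρ (algIncl₂ K A Y) (algDeriv ρ (algIncl₁ K A X) f) := by
      rw [← sub_eq_zero, ← hbr, algBr_algIncl, map_zero, LinearMap.zero_apply]
    have hschouten := hP.schouten_eq f g h
    simp only [algFund_diagCoaction]
    have key := algSchouten_fusion (K := K) (B := B) (L := Lie (K := K) A)
      (V := Lie (K := K) (A ⊗[K] A)) (D := algDeriv ρ) (br := algBr K A)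
      (brV := algBr K (A ⊗[K] A)) (i₁ := algIncl₁ K A) (i₂ := algIncl₂ K A) (H := H) (P := P)
      (Q := algFusion ρ H P) (f := f) (g := g) (h := h) (algDeriv_isLeibniz hρ) hbr
    have key := key h₁ h₂ h₁₂
    have key := key algBr_skew hH.symm hH.ad_inv
    have key := key hP.toIsAlgBivector (hP.algDeriv_apply_apply hρ)
    exact key hfus hschouten

end AlgebraicMomentum

/-! ### Differentials of scalar functions in charts -/

section Calculus

variable {𝕜 : Type*} [RCLike 𝕜]
  {E : Type*} [NormedAddCommGroup E] [NormedSpace 𝕜 E]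
  {F : Type*} [NormedAddCommGroup F] [NormedSpace 𝕜 F]

/-- Partial derivatives of a function of class `C^2` on a product commute. -/
lemma fderiv_fderiv_comm {f : E × F → 𝕜} {x₀ : E} {y₀ : F} (hf : ContDiffAt 𝕜 2 f (x₀, y₀))
    (a : E) (b : F) :
    fderiv 𝕜 (fun x => fderiv 𝕜 (fun y => f (x, y)) y₀ b) x₀ a =
      fderiv 𝕜 (fun y => fderiv 𝕜 (fun x => f (x, y)) x₀ a) y₀ b := by
  have hd : ∀ᶠ z in nhds (x₀, y₀), DifferentiableAt 𝕜 f z :=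
    (hf.eventually (by simp)).mono fun z hz => hz.differentiableAt (by norm_num)
  have hd₂ : DifferentiableAt 𝕜 (fderiv 𝕜 f) (x₀, y₀) :=
    (hf.fderiv_right (m := 1) (by norm_num)).differentiableAt (by norm_num)
  have hx : (fun x => fderiv 𝕜 (fun y => f (x, y)) y₀ b) =ᶠ[nhds x₀]
      fun x => fderiv 𝕜 f (x, y₀) (0, b) := by
    have hc : Filter.Tendsto (fun x : E => (x, y₀)) (nhds x₀) (nhds (x₀, y₀)) :=
      (Continuous.prodMk_left y₀).tendsto x₀
    filter_upwards [hc.eventually hd] with x hx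
    have := HasFDerivAt.comp (f := fun y : F => (x, y)) y₀ hx.hasFDerivAt
      (hasFDerivAt_prodMk_right x y₀)
    rw [show (fun y => f (x, y)) = f ∘ fun y => (x, y) from rfl, this.fderiv]
    simp
  have hy : (fun y => fderiv 𝕜 (fun x => f (x, y)) x₀ a) =ᶠ[nhds y₀]
      fun y => fderiv 𝕜 f (x₀, y) (a, 0) := by
    have hc : Filter.Tendsto (fun y : F => (x₀, y)) (nhds y₀) (nhds (x₀, y₀)) :=
      (Continuous.prodMk_right x₀).tendsto y₀
    filter_upwards [hc.eventually hd] with y hy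
    have := HasFDerivAt.comp (f := fun x : E => (x, y)) x₀ hy.hasFDerivAt
      (hasFDerivAt_prodMk_left x₀ y)
    rw [show (fun x => f (x, y)) = f ∘ fun x => (x, y) from rfl, this.fderiv]
    simp
  rw [hx.fderiv_eq, hy.fderiv_eq]
  have h₁ := (HasFDerivAt.comp (f := fun x : E => (x, y₀)) x₀ hd₂.hasFDerivAt
    (hasFDerivAt_prodMk_left x₀ y₀)).clm_apply
    (hasFDerivAt_const ((0 : E), b) x₀)
  have h₂ := (HasFDerivAt.comp (f := fun y : F => (x₀, y)) y₀ hd₂.hasFDerivAt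
    (hasFDerivAt_prodMk_right x₀ y₀)).clm_apply
    (hasFDerivAt_const (a, (0 : F)) y₀)
  have e₁ : fderiv 𝕜 (fun x => fderiv 𝕜 f (x, y₀) (0, b)) x₀ a =
      fderiv 𝕜 (fderiv 𝕜 f) (x₀, y₀) (a, 0) (0, b) := by
    refine (congrArg (fun T => T a) h₁.fderiv).trans ?_
    simp
  have e₂ : fderiv 𝕜 (fun y => fderiv 𝕜 f (x₀, y) (a, 0)) y₀ b =
      fderiv 𝕜 (fderiv 𝕜 f) (x₀, y₀) (0, b) (a, 0) := by
    refine (congrArg (fun T => T b) h₂.fderiv).trans ?_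
    simp
  rw [e₁, e₂]
  exact (hf.isSymmSndFDerivAt (by simp [minSmoothness_of_isRCLikeNormedField])).eq _ _

variable {HM : Type*} [TopologicalSpace HM] {I : ModelWithCorners 𝕜 E HM}
  {M : Type*} [TopologicalSpace M] [ChartedSpace HM M]
  {HN : Type*} [TopologicalSpace HN] {J : ModelWithCorners 𝕜 F HN}
  {N : Type*} [TopologicalSpace N] [ChartedSpace HN N]

/-- The differential is computed in the preferred chart. No differentiability is needed: if the
expression of `f` in the chart is differentiable, then `f` is differentiable. -/
lemma dif_eq_fderiv [I.Boundaryless] (f : M → 𝕜) (p : M) (a : TangentSpace I p) :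
    dif I f p a = fderiv 𝕜 (f ∘ (extChartAt I p).symm) (extChartAt I p p) a := by
  by_cases hf : MDifferentiableAt I 𝓘(𝕜, 𝕜) f p
  · simp only [dif, mfderiv, hf]
    rw [I.range_eq_univ, fderivWithin_univ]
    rfl
  · have hg : ¬ DifferentiableAt 𝕜 (f ∘ (extChartAt I p).symm) (extChartAt I p p) := by
      intro hd
      apply hf
      rw [mdifferentiableAt_iff]
      refine ⟨?_, ?_⟩
      · have hc : ContinuousAt ((f ∘ (extChartAt I p).symm) ∘ extChartAt I p) p :=
          hd.continuousAt.comp (continuousAt_extChartAt p)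
        refine hc.congr ?_
        filter_upwards [extChartAt_source_mem_nhds (I := I) p] with x hx
        simp only [Function.comp_apply, (extChartAt I p).left_inv hx]
      · rw [I.range_eq_univ, differentiableWithinAt_univ]
        exact hd
    rw [fderiv_zero_of_not_differentiableAt hg]
    simp only [dif, mfderiv, hf]
    rfl

lemma dif_congr {f g : M → 𝕜} {p : M} (h : f =ᶠ[nhds p] g) : dif I f p = dif I g p := by
  ext a
  exact congrArg (fun T : E →L[𝕜] 𝕜 => T a) (h.mfderiv_eq (I := I) (I' := 𝓘(𝕜, 𝕜)))

/-- The expression of a function on a product manifold in product charts. -/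
lemma contDiffAt_prod_chart [I.Boundaryless] [J.Boundaryless] {n : WithTop ℕ∞} {f : M × N → 𝕜}
    {p : M} {q : N}
    (hf : ContMDiffAt (I.prod J) 𝓘(𝕜, 𝕜) n f (p, q)) :
    ContDiffAt 𝕜 n (fun z : E × F => f ((extChartAt I p).symm z.1, (extChartAt J q).symm z.2))
      (extChartAt I p p, extChartAt J q q) := by
  have := (contMDiffAt_iff.1 hf).2
  rw [(I.prod J).range_eq_univ, contDiffWithinAt_univ] at this
  rw [extChartAt_prod] at this
  exact this

/-- Partial differentials of a function of class `C^2` on a product manifold commute. -/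
lemma dif_dif_comm [I.Boundaryless] [J.Boundaryless] {f : M × N → 𝕜} {p : M} {q : N}
    (hf : ContMDiffAt (I.prod J) 𝓘(𝕜, 𝕜) 2 f (p, q)) (a : TangentSpace I p)
    (b : TangentSpace J q) :
    dif I (fun x => dif J (fun y => f (x, y)) q b) p a =
      dif J (fun y => dif I (fun x => f (x, y)) p a) q b := by
  simp only [dif_eq_fderiv]
  exact fderiv_fderiv_comm (contDiffAt_prod_chart hf) a b

/-- A partial differential of a `C^n` function is of class `C^m` in the other variable. -/
lemma contMDiffAt_dif [I.Boundaryless] [J.Boundaryless] {m n : WithTop ℕ∞} [IsManifold I m M]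
    {f : M × N → 𝕜} {p : M} {q : N}
    (hf : ContMDiffAt (I.prod J) 𝓘(𝕜, 𝕜) n f (p, q)) (hmn : m + 1 ≤ n) (b : TangentSpace J q) :
    ContMDiffAt I 𝓘(𝕜, 𝕜) m (fun x => dif J (fun y => f (x, y)) q b) p := by
  have h := ContDiffAt.fderiv (𝕜 := 𝕜) (m := m) (x₀ := extChartAt I p p)
    (f := fun u v => f ((extChartAt I p).symm u, (extChartAt J q).symm v))
    (g := fun _ => extChartAt J q q) (contDiffAt_prod_chart hf) contDiffAt_const hmn
  have h' := (h.clm_apply (contDiffAt_const (c := show F from b))).contMDiffAt.comp p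
    (contMDiffAt_extChartAt (I := I) (x := p) (n := m))
  refine h'.congr_of_eventuallyEq ?_
  filter_upwards [extChartAt_source_mem_nhds (I := I) p] with x hx
  simp only [Function.comp_apply, (extChartAt I p).left_inv hx, dif_eq_fderiv]
  rfl

/-- The chain rule. -/
lemma dif_comp {f : N → 𝕜} {φ : M → N} {p : M} (hf : MDifferentiableAt J 𝓘(𝕜, 𝕜) f (φ p))
    (hφ : MDifferentiableAt I J φ p) (a : TangentSpace I p) :
    dif I (fun x => f (φ x)) p a = dif J f (φ p) (mfderiv I J φ p a) :=
  congrArg (fun T : E →L[𝕜] 𝕜 => T a) (mfderiv_comp p hf hφ)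

/-- Tangent spaces at equal points are identified with the same model vector space. -/
lemma dif_congr_point (f : M → 𝕜) {p p' : M} (h : p = p') (a : E) :
    dif I f p a = dif I f p' a := by
  subst h; rfl

lemma dif_const (c : 𝕜) (p : M) : dif I (fun _ => c) p = 0 := by
  ext a
  exact congrArg (fun T : E →L[𝕜] 𝕜 => T a) (mfderiv_const (I := I) (I' := 𝓘(𝕜, 𝕜)) (x := p))

lemma dif_add {f g : M → 𝕜} {p : M} (hf : MDifferentiableAt I 𝓘(𝕜, 𝕜) f p)
    (hg : MDifferentiableAt I 𝓘(𝕜, 𝕜) g p) : dif I (f + g) p = dif I f p + dif I g p := by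
  ext a
  exact congrArg (fun T : E →L[𝕜] 𝕜 => T a) (mfderiv_add hf hg)

lemma dif_sub {f g : M → 𝕜} {p : M} (hf : MDifferentiableAt I 𝓘(𝕜, 𝕜) f p)
    (hg : MDifferentiableAt I 𝓘(𝕜, 𝕜) g p) :
    dif I (fun x => f x - g x) p = dif I f p - dif I g p := by
  ext a
  exact congrArg (fun T : E →L[𝕜] 𝕜 => T a) (mfderiv_sub hf hg)

lemma dif_neg_fun (f : M → 𝕜) (p : M) : dif I (fun x => -f x) p = -dif I f p := by
  ext a
  exact congrArg (fun T : E →L[𝕜] 𝕜 => T a) (mfderiv_neg (f := f) (x := p))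

lemma dif_mul {f g : M → 𝕜} {p : M} (hf : MDifferentiableAt I 𝓘(𝕜, 𝕜) f p)
    (hg : MDifferentiableAt I 𝓘(𝕜, 𝕜) g p) :
    dif I (f * g) p = f p • dif I g p + g p • dif I f p := by
  ext a
  exact congrArg (fun T : E →L[𝕜] 𝕜 => T a) (hf.hasMFDerivAt.mul hg.hasMFDerivAt).mfderiv

lemma dif_smul (c : 𝕜) {f : M → 𝕜} {p : M} (hf : MDifferentiableAt I 𝓘(𝕜, 𝕜) f p) :
    dif I (c • f) p = c • dif I f p := by
  ext a
  exact congrArg (fun T : E →L[𝕜] 𝕜 => T a) (const_smul_mfderiv hf c)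

/-- The chain rule in two variables. -/
lemma dif_prodMk {E' : Type*} [NormedAddCommGroup E'] [NormedSpace 𝕜 E']
    {HM' : Type*} [TopologicalSpace HM'] {I' : ModelWithCorners 𝕜 E' HM'}
    {M' : Type*} [TopologicalSpace M'] [ChartedSpace HM' M']
    {f : M × N → 𝕜} {φ : M' → M} {ψ : M' → N} {p : M'}
    (hf : MDifferentiableAt (I.prod J) 𝓘(𝕜, 𝕜) f (φ p, ψ p))
    (hφ : MDifferentiableAt I' I φ p) (hψ : MDifferentiableAt I' J ψ p)
    (a : TangentSpace I' p) :
    dif I' (fun x => f (φ x, ψ x)) p a =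
      dif I' (fun x => f (φ x, ψ p)) p a + dif I' (fun x => f (φ p, ψ x)) p a := by
  have e₀ : dif I' (fun x => f (φ x, ψ x)) p a = _ :=
    dif_comp (J := I.prod J) (φ := fun x => (φ x, ψ x)) hf (hφ.prodMk hψ) a
  rw [e₀, mfderiv_prodMk hφ hψ]
  have h₁ : MDifferentiableAt I 𝓘(𝕜, 𝕜) (fun z => f (z, ψ p)) (φ p) :=
    MDifferentiableAt.comp (φ p) (f := fun z : M => (z, ψ p)) hf
      (mdifferentiableAt_id.prodMk mdifferentiableAt_const)
  have h₂ : MDifferentiableAt J 𝓘(𝕜, 𝕜) (fun z => f (φ p, z)) (ψ p) :=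
    MDifferentiableAt.comp (ψ p) (f := fun z : N => (φ p, z)) hf
      (mdifferentiableAt_const.prodMk mdifferentiableAt_id)
  have e₁ : dif I' (fun x => f (φ x, ψ p)) p a = _ := dif_comp (φ := φ) h₁ hφ a
  have e₂ : dif I' (fun x => f (φ p, ψ x)) p a = _ := dif_comp (φ := ψ) h₂ hψ a
  rw [e₁, e₂]
  exact mfderiv_prod_eq_add_apply hf

/-- The bracket of vector fields is the commutator of the corresponding derivations. -/
lemma dif_mlieBracket [I.Boundaryless] [CompleteSpace E] [IsManifold I 2 M] {f : M → 𝕜}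
    {V W : Π x : M, TangentSpace I x} {p : M} (hf : ContMDiffAt I 𝓘(𝕜, 𝕜) 2 f p)
    (hV : MDifferentiableAt I I.tangent (fun x => (V x : TangentBundle I M)) p)
    (hW : MDifferentiableAt I I.tangent (fun x => (W x : TangentBundle I M)) p) :
    dif I f p (VectorField.mlieBracket I V W p) =
      dif I (fun x => dif I f x (W x)) p (V p) - dif I (fun x => dif I f x (V x)) p (W p) := by
  have hM : IsManifold I 1 M := IsManifold.of_le (n := 2) (by norm_num)
  set φ := extChartAt I p with hφ
  set pull : (Π x : M, TangentSpace I x) → E → E :=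
    fun V => VectorField.mpullbackWithin 𝓘(𝕜, E) I φ.symm V (Set.range I) with hpull
  have hpd {V : Π x : M, TangentSpace I x}
      (hV : MDifferentiableAt I I.tangent (fun x => (V x : TangentBundle I M)) p) :
      DifferentiableAt 𝕜 (pull V) (φ p) := by
    have := MDifferentiableWithinAt.differentiableWithinAt_mpullbackWithin_vectorField (s := Set.univ)
      hV.mdifferentiableWithinAt
    have hu : φ.symm ⁻¹' Set.univ ∩ Set.range I = Set.univ := by simp [I.range_eq_univ]
    have h' : DifferentiableWithinAt 𝕜 (pull V) (φ.symm ⁻¹' Set.univ ∩ Set.range I) (φ p) := this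
    rwa [hu, differentiableWithinAt_univ] at h'
  have hp0 (V : Π x : M, TangentSpace I x) : pull V (φ p) = V p := by
    refine Eq.trans ?_ (mfderivWithin_extChartAt_symm_inverse_apply (I := I) (V p))
    change (mfderivWithin 𝓘(𝕜, E) I φ.symm (Set.range I) (φ p)).inverse (V (φ.symm (φ p))) = _
    rw [extChartAt_to_inv]
  have hfC : ContDiffAt 𝕜 2 (f ∘ φ.symm) (φ p) := by
    have := (contMDiffAt_iff.1 hf).2
    rw [I.range_eq_univ, contDiffWithinAt_univ] at this
    exact this
  have hev (V : Π x : M, TangentSpace I x) :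
      (fun u => fderiv 𝕜 (f ∘ φ.symm) u (pull V u)) =ᶠ[nhds (φ p)]
        (fun x => dif I f x (V x)) ∘ φ.symm := by
    have hd : ∀ᶠ x in nhds (φ.symm (φ p)), ContMDiffAt I 𝓘(𝕜, 𝕜) 2 f x := by
      rw [extChartAt_to_inv]
      exact contMDiffAt_iff_contMDiffAt_nhds (by simp) |>.1 hf
    have ht : φ.target ∈ nhds (φ p) := extChartAt_target_mem_nhds p
    filter_upwards [(continuousAt_extChartAt_symm p).eventually hd, ht] with u hu hut
    have h₁ := hu.mdifferentiableAt (by norm_num)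
    have h₂ : MDifferentiableAt 𝓘(𝕜, E) I φ.symm u := by
      have := mdifferentiableWithinAt_extChartAt_symm (I := I) hut
      rwa [I.range_eq_univ, mdifferentiableWithinAt_univ] at this
    have h₃ := mfderiv_comp u h₁ h₂
    rw [mfderiv_eq_fderiv] at h₃
    have h₄ := isInvertible_mfderivWithin_extChartAt_symm (I := I) hut
    change fderiv 𝕜 (f ∘ φ.symm) u
      ((mfderivWithin 𝓘(𝕜, E) I φ.symm (Set.range I) u).inverse (V (φ.symm u))) = _
    have h₅ : (mfderivWithin 𝓘(𝕜, E) I φ.symm (Set.range I) u)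
        ((mfderivWithin 𝓘(𝕜, E) I φ.symm (Set.range I) u).inverse (V (φ.symm u))) =
          V (φ.symm u) := h₄.self_apply_inverse _
    rw [I.range_eq_univ, mfderivWithin_univ] at h₅
    rw [h₃, I.range_eq_univ, mfderivWithin_univ]
    exact congrArg (dif I f (φ.symm u)) h₅
  have hbr : VectorField.mlieBracket I V W p =
      VectorField.lieBracket 𝕜 (pull V) (pull W) (φ p) := by
    have hu : φ.symm ⁻¹' Set.univ ∩ Set.range I = Set.univ := by simp [I.range_eq_univ]
    have h₁ : VectorField.mlieBracket I V W p =
        (show E →L[𝕜] E from mfderiv I 𝓘(𝕜, E) φ p).inverse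
          (VectorField.lieBracketWithin 𝕜 (pull V) (pull W)
            (φ.symm ⁻¹' Set.univ ∩ Set.range I) (φ p)) :=
      VectorField.mlieBracketWithin_apply
    have h₂ : (show E →L[𝕜] E from mfderiv I 𝓘(𝕜, E) φ p) = ContinuousLinearMap.id 𝕜 E :=
      mfderiv_extChartAt_self
    rw [h₁, h₂, hu, VectorField.lieBracketWithin_univ, ContinuousLinearMap.inverse_id]
    rfl
  have hd (V W : Π x : M, TangentSpace I x) : dif I (fun x => dif I f x (W x)) p (V p) =
      fderiv 𝕜 (fun u => fderiv 𝕜 (f ∘ φ.symm) u (pull W u)) (φ p) (pull V (φ p)) := by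
    rw [(hev W).fderiv_eq, hp0, dif_eq_fderiv]
  rw [hbr, hd, hd]
  refine (dif_eq_fderiv f p _).trans ?_
  exact VectorField.fderiv_apply_lieBracket hfC
    (by simp [minSmoothness_of_isRCLikeNormedField]) (hpd hW) (hpd hV)

end Calculus

/-! ### The bracket and the adjoint action on a Lie group -/

section LieGroups

variable {𝕜 : Type*} [RCLike 𝕜]
  {E : Type*} [NormedAddCommGroup E] [NormedSpace 𝕜 E]
  {HG : Type*} [TopologicalSpace HG] {I : ModelWithCorners 𝕜 E HG}
  {G : Type*} [TopologicalSpace G] [ChartedSpace HG G] [Group G] [LieGroup I 3 G]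

/-- The value of `[X, Y]` on the differential of `F` at the identity is
`∂_g ∂_k (F (g k)) (X, Y) - ∂_g ∂_k (F (g k)) (Y, X)`. -/
lemma dif_bracket [I.Boundaryless] [CompleteSpace E] {F : G → 𝕜} (hF : ContMDiffAt I 𝓘(𝕜, 𝕜) 2 F 1)
    (X Y : GroupLieAlgebra I G) :
    dif I F 1 ⁅X, Y⁆ = dif I (fun g : G => dif I (fun k : G => F (g * k)) 1 Y) 1 X -
      dif I (fun g : G => dif I (fun k : G => F (g * k)) 1 X) 1 Y := by
  have : LieGroup I (minSmoothness 𝕜 3) G := by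
    rwa [minSmoothness_of_isRCLikeNormedField]
  have : IsManifold I 2 G := IsManifold.of_le (n := 3) (by norm_num)
  have h1 (X : GroupLieAlgebra I G) : mulInvariantVectorField X (1 : G) = X := by
    have : (fun x : G => 1 * x) = id := by ext; simp
    have h : mfderiv I I (fun x : G => 1 * x) 1 = ContinuousLinearMap.id 𝕜 E := by
      rw [this]; exact mfderiv_id
    exact congrArg (fun T : E →L[𝕜] E => T X) h
  have hF' : ∀ᶠ g in nhds (1 : G), ContMDiffAt I 𝓘(𝕜, 𝕜) 2 F g :=
    contMDiffAt_iff_contMDiffAt_nhds (by simp) |>.1 hF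
  have hev (X : GroupLieAlgebra I G) : (fun g => dif I F g (mulInvariantVectorField X g))
      =ᶠ[nhds 1] fun g => dif I (fun k : G => F (g * k)) 1 X := by
    filter_upwards [hF'] with g hg
    have hg1 : MDifferentiableAt I 𝓘(𝕜, 𝕜) F (g * 1) := by
      rw [mul_one]; exact hg.mdifferentiableAt (by norm_num)
    have hm : MDifferentiableAt I I (fun k : G => g * k) 1 :=
      (contMDiff_mul_left (I := I) (n := 3)).contMDiffAt.mdifferentiableAt (by norm_num)
    have e : dif I (fun k : G => F (g * k)) 1 X = _ := dif_comp (φ := fun k : G => g * k) hg1 hm X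
    rw [e]
    exact (dif_congr_point F (mul_one g) _).symm
  rw [GroupLieAlgebra.bracket_def, dif_mlieBracket hF (mdifferentiableAt_mulInvariantVectorField X)
    (mdifferentiableAt_mulInvariantVectorField Y), dif_congr (hev X), dif_congr (hev Y), h1, h1]

lemma contMDiffAt_comp_mul {F : G → 𝕜} {n : WithTop ℕ∞} (hn : n ≤ 3) {g h : G}
    (hF : ContMDiffAt I 𝓘(𝕜, 𝕜) n F (g * h)) :
    ContMDiffAt (I.prod I) 𝓘(𝕜, 𝕜) n (fun z : G × G => F (z.1 * z.2)) (g, h) :=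
  ContMDiffAt.comp (g, h) (f := fun z : G × G => z.1 * z.2) hF
    ((contMDiff_mul I 3).contMDiffAt.of_le hn)

/-- For functions of `h g` instead of `g h` the commutator changes sign. -/
lemma dif_bracket_swap [I.Boundaryless] [CompleteSpace E] {F : G → 𝕜}
    (hF : ContMDiffAt I 𝓘(𝕜, 𝕜) 2 F 1)
    (X Y : GroupLieAlgebra I G) :
    dif I (fun g : G => dif I (fun h : G => F (h * g)) 1 Y) 1 X -
      dif I (fun g : G => dif I (fun h : G => F (h * g)) 1 X) 1 Y = -dif I F 1 ⁅X, Y⁆ := by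
  have hm : ContMDiffAt (I.prod I) 𝓘(𝕜, 𝕜) 2 (fun z : G × G => F (z.2 * z.1)) (1, 1) := by
    have hF' : ContMDiffAt I 𝓘(𝕜, 𝕜) 2 F ((1 : G) * 1) := by rwa [mul_one]
    have : ContMDiffAt (I.prod I) I 2 (fun z : G × G => z.2 * z.1) (1, 1) :=
      ((contMDiff_snd.mul contMDiff_fst : ContMDiff (I.prod I) I 3
        (fun z : G × G => z.2 * z.1)).of_le (by norm_num)).contMDiffAt
    exact ContMDiffAt.comp (1, 1) (f := fun z : G × G => z.2 * z.1) hF' this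
  rw [dif_dif_comm hm, dif_dif_comm hm, dif_bracket hF]
  ring

/-- Inversion acts by `-1` on the tangent space at the identity. -/
lemma dif_inv {F : G → 𝕜} (hF : MDifferentiableAt I 𝓘(𝕜, 𝕜) F 1) (X : GroupLieAlgebra I G) :
    dif I (fun g : G => F g⁻¹) 1 X = -dif I F 1 X := by
  have hm : MDifferentiableAt (I.prod I) 𝓘(𝕜, 𝕜) (fun z : G × G => F (z.1 * z.2))
      ((1 : G), (1 : G)⁻¹) := by
    have hF' : MDifferentiableAt I 𝓘(𝕜, 𝕜) F ((1 : G) * 1⁻¹) := by simpa using hF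
    have : MDifferentiableAt (I.prod I) I (fun z : G × G => z.1 * z.2) ((1 : G), (1 : G)⁻¹) :=
      (contMDiff_mul I 3).contMDiffAt.mdifferentiableAt (by norm_num)
    exact MDifferentiableAt.comp _ (f := fun z : G × G => z.1 * z.2) hF' this
  have hi : MDifferentiableAt I I (fun g : G => g⁻¹) 1 :=
    (contMDiff_inv I 3).contMDiffAt.mdifferentiableAt (by norm_num)
  have := dif_prodMk (φ := fun g : G => g) hm mdifferentiableAt_id hi X
  simp only [mul_inv_cancel, inv_one, mul_one, one_mul] at this
  rw [dif_const] at this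
  simp only [LinearMap.zero_apply] at this
  exact (neg_eq_of_add_eq_zero_right this.symm).symm

lemma contMDiffAt_comp_conj {F : G → 𝕜} (hF : ContMDiffAt I 𝓘(𝕜, 𝕜) 2 F 1) :
    ContMDiffAt (I.prod I) 𝓘(𝕜, 𝕜) 2 (fun z : G × G => F (z.1 * z.2 * z.1⁻¹)) (1, 1) := by
  have h1 : ContMDiffAt I 𝓘(𝕜, 𝕜) 2 F ((1 : G) * 1 * 1⁻¹) := by simpa using hF
  have : ContMDiffAt (I.prod I) I 2 (fun z : G × G => z.1 * z.2 * z.1⁻¹) (1, 1) :=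
    (((contMDiff_fst.mul contMDiff_snd).mul contMDiff_fst.inv : ContMDiff (I.prod I) I 3
      (fun z : G × G => z.1 * z.2 * z.1⁻¹)).of_le (by norm_num)).contMDiffAt
  exact ContMDiffAt.comp (1, 1) (f := fun z : G × G => z.1 * z.2 * z.1⁻¹) h1 this

/-- The differential of the adjoint action: `∂_g (F, Ad_g Y) = (F, [X, Y])` along `X`. -/
lemma dif_conj [I.Boundaryless] [CompleteSpace E] {F : G → 𝕜} (hF : ContMDiffAt I 𝓘(𝕜, 𝕜) 2 F 1)
    (X Y : GroupLieAlgebra I G) :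
    dif I (fun g : G => dif I (fun k : G => F (g * k * g⁻¹)) 1 Y) 1 X = dif I F 1 ⁅X, Y⁆ := by
  have hF' : ∀ᶠ k in nhds (1 : G), ContMDiffAt I 𝓘(𝕜, 𝕜) 2 F k :=
    contMDiffAt_iff_contMDiffAt_nhds (by simp) |>.1 hF
  have hF1 : ContMDiffAt I 𝓘(𝕜, 𝕜) 2 F ((1 : G) * 1) := by rwa [mul_one]
  have hm : ContMDiffAt (I.prod I) 𝓘(𝕜, 𝕜) 2 (fun z : G × G => F (z.1 * z.2)) (1, 1) :=
    contMDiffAt_comp_mul (by norm_num) hF1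
  have hm' : ContMDiffAt (I.prod I) 𝓘(𝕜, 𝕜) 2 (fun z : G × G => F (z.2 * z.1)) (1, 1) :=
    ContMDiffAt.comp (1, 1) (f := Prod.swap) hm (contMDiff_snd.prodMk contMDiff_fst).contMDiffAt
  have hc := contMDiffAt_comp_conj hF
  have hev : (fun k : G => dif I (fun g : G => F (g * k * g⁻¹)) 1 X) =ᶠ[nhds 1]
      fun k => dif I (fun g : G => F (g * k)) 1 X - dif I (fun g : G => F (k * g)) 1 X := by
    filter_upwards [hF'] with k hk
    have h₁ : MDifferentiableAt (I.prod I) 𝓘(𝕜, 𝕜) (fun z : G × G => F (z.1 * k * z.2))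
        ((1 : G), (1 : G)⁻¹) := by
      have h1 : ContMDiffAt I 𝓘(𝕜, 𝕜) 2 F ((1 : G) * k * 1⁻¹) := by simpa using hk
      have : ContMDiff (I.prod I) I 3 (fun z : G × G => z.1 * k * z.2) :=
        (contMDiff_fst.mul contMDiff_const).mul contMDiff_snd
      exact MDifferentiableAt.comp _ (f := fun z : G × G => z.1 * k * z.2)
        (h1.mdifferentiableAt (by norm_num)) (this.contMDiffAt.mdifferentiableAt (by norm_num))
    have h₂ : MDifferentiableAt I 𝓘(𝕜, 𝕜) (fun g : G => F (k * g)) 1 := by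
      have h1 : ContMDiffAt I 𝓘(𝕜, 𝕜) 2 F (k * 1) := by simpa using hk
      exact MDifferentiableAt.comp _ (f := fun g : G => k * g)
        (h1.mdifferentiableAt (by norm_num))
        ((contMDiff_mul_left (n := 3)).contMDiffAt.mdifferentiableAt (by norm_num))
    have := dif_prodMk (φ := fun g : G => g) h₁ mdifferentiableAt_id
      ((contMDiff_inv I 3).contMDiffAt.mdifferentiableAt (by norm_num)) X
    simp only [inv_one, mul_one, one_mul] at this
    rw [this, dif_inv h₂, sub_eq_add_neg]
  have hd₁ : MDifferentiableAt I 𝓘(𝕜, 𝕜) (fun k : G => dif I (fun g : G => F (g * k)) 1 X) 1 :=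
    (contMDiffAt_dif (m := 1) hm' (by norm_num) X).mdifferentiableAt (by norm_num)
  have hd₂ : MDifferentiableAt I 𝓘(𝕜, 𝕜) (fun k : G => dif I (fun g : G => F (k * g)) 1 X) 1 :=
    (contMDiffAt_dif (m := 1) hm (by norm_num) X).mdifferentiableAt (by norm_num)
  rw [dif_dif_comm hc, dif_congr hev, dif_sub hd₁ hd₂, LinearMap.sub_apply, dif_dif_comm hm',
    dif_bracket hF]

end LieGroups

/-! ### Infinitesimal invariance of `Ad`-invariant tensors -/

section AdInvariance

variable {𝕜 : Type*} [RCLike 𝕜]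
  {E : Type*} [NormedAddCommGroup E] [NormedSpace 𝕜 E]
  {HG : Type*} [TopologicalSpace HG] {I : ModelWithCorners 𝕜 E HG}

/-- The product rule for the evaluation of a fixed tensor on varying covectors. -/
lemma dif_eval₂ {M : Type*} [TopologicalSpace M] [ChartedSpace HG M] {V : Type*} [AddCommGroup V]
    [Module 𝕜 V] {a b : M → V →ₗ[𝕜] 𝕜} {a' b' : V →ₗ[𝕜] 𝕜} {p : M} {ξ : TangentSpace I p}
    (ha : ∀ v, MDifferentiableAt I 𝓘(𝕜, 𝕜) (fun x => a x v) p)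
    (hb : ∀ v, MDifferentiableAt I 𝓘(𝕜, 𝕜) (fun x => b x v) p)
    (ha' : ∀ v, dif I (fun x => a x v) p ξ = a' v)
    (hb' : ∀ v, dif I (fun x => b x v) p ξ = b' v) (t : V ⊗[𝕜] V) :
    MDifferentiableAt I 𝓘(𝕜, 𝕜) (fun x => eval₂ (a x) (b x) t) p ∧
      dif I (fun x => eval₂ (a x) (b x) t) p ξ = eval₂ a' (b p) t + eval₂ (a p) b' t := by
  induction t with
  | zero =>
    simp only [map_zero, dif_const]
    exact ⟨mdifferentiableAt_const, by simp⟩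
  | tmul u v =>
    simp only [eval₂_tmul]
    refine ⟨(ha u).mul (hb v), ?_⟩
    have : dif I (fun x => a x u * b x v) p = _ := dif_mul (ha u) (hb v)
    rw [this, LinearMap.add_apply, LinearMap.smul_apply, LinearMap.smul_apply, ha', hb']
    simp only [smul_eq_mul]
    ring
  | add s t hs ht =>
    simp only [map_add]
    refine ⟨hs.1.add ht.1, ?_⟩
    have : dif I (fun x => eval₂ (a x) (b x) s + eval₂ (a x) (b x) t) p = _ := dif_add hs.1 ht.1
    rw [this, LinearMap.add_apply, hs.2, ht.2]
    ring

/-- Every continuous linear functional on a tangent space is the differential of a function. -/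
lemma exists_dif_eq {M : Type*} [TopologicalSpace M] [ChartedSpace HG M] [IsManifold I 3 M]
    (p : M) (α : E →L[𝕜] 𝕜) : ∃ f : M → 𝕜, ContMDiffAt I 𝓘(𝕜, 𝕜) 2 f p ∧
      dif I f p = α.toLinearMap := by
  have hc : ContMDiffAt I 𝓘(𝕜, E) 3 (extChartAt I p) p := contMDiffAt_extChartAt
  have hα : ContMDiff 𝓘(𝕜, E) 𝓘(𝕜, 𝕜) 3 α := α.contDiff.contMDiff
  refine ⟨fun x => α (extChartAt I p x), ContMDiffAt.of_le (hα.contMDiffAt.comp p hc) (by norm_num),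
    ?_⟩
  ext v
  have : dif I (fun x : M => α (extChartAt I p x)) p v = _ :=
    dif_comp (J := 𝓘(𝕜, E)) (φ := extChartAt I p)
      (hα.contMDiffAt.mdifferentiableAt (by norm_num)) (hc.mdifferentiableAt (by norm_num)) v
  rw [this]
  have h₁ : mfderiv I 𝓘(𝕜, E) (extChartAt I p) p = ContinuousLinearMap.id 𝕜 E :=
    have : IsManifold I 1 M := IsManifold.of_le (n := 3) (by norm_num)
    mfderiv_extChartAt_self
  have h₂ : dif 𝓘(𝕜, E) α (extChartAt I p p) = α.toLinearMap := by
    ext w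
    exact congrArg (fun T : E →L[𝕜] 𝕜 => T w) (mfderiv_eq_fderiv.trans α.fderiv)
  exact (congrArg (fun T : E →L[𝕜] E => dif 𝓘(𝕜, E) α (extChartAt I p p) (T v)) h₁).trans
    (congrArg (fun T : E →ₗ[𝕜] 𝕜 => T v) h₂)

/-- Tangent vectors are separated by the differentials of functions. -/
lemma tangent_ext {M : Type*} [TopologicalSpace M] [ChartedSpace HG M] [IsManifold I 3 M]
    {p : M} {v w : TangentSpace I p}
    (h : ∀ f : M → 𝕜, ContMDiffAt I 𝓘(𝕜, 𝕜) 2 f p → dif I f p v = dif I f p w) : v = w := by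
  refine (SeparatingDual.eq_iff_forall_dual_eq (R := 𝕜) (V := E)).2 fun α => ?_
  obtain ⟨f, hf, hα⟩ := exists_dif_eq (I := I) p α
  have := h f hf
  rwa [hα] at this

variable {G : Type*} [TopologicalSpace G] [ChartedSpace HG G] [Group G] [LieGroup I 3 G]

lemma dif_Ad {F : G → 𝕜} (hF : MDifferentiableAt I 𝓘(𝕜, 𝕜) F 1) (g : G)
    (X : GroupLieAlgebra I G) :
    dif I (fun k : G => F (g * k * g⁻¹)) 1 X = dif I F 1 (Ad I g X) := by
  have h1 : g * 1 * g⁻¹ = 1 := by simp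
  have hm : MDifferentiableAt I I (fun k : G => g * k * g⁻¹) 1 :=
    ((contMDiff_mul_right (n := 3) (a := g⁻¹)).comp
      (contMDiff_mul_left (n := 3) (a := g))).contMDiffAt.mdifferentiableAt (by norm_num)
  have : dif I (fun k : G => F (g * k * g⁻¹)) 1 X = _ :=
    dif_comp (φ := fun k : G => g * k * g⁻¹) (by rwa [h1]) hm X
  rw [this]
  exact dif_congr_point F h1 _

/-- An `Ad`-invariant tensor is invariant under the adjoint action of the Lie algebra. -/
lemma IsInvSymm.bracket_inv [I.Boundaryless] [CompleteSpace E]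
    {H : GroupLieAlgebra I G ⊗[𝕜] GroupLieAlgebra I G} (hH : IsInvSymm I H)
    {br : GroupLieAlgebra I G →ₗ[𝕜] GroupLieAlgebra I G →ₗ[𝕜] GroupLieAlgebra I G}
    (hbr : ∀ X Y, br X Y = ⁅X, Y⁆) (X : GroupLieAlgebra I G) :
    TensorProduct.map (br X) LinearMap.id H + TensorProduct.map LinearMap.id (br X) H = 0 := by
  refine tensor_eq_zero_of_separating (V := GroupLieAlgebra I G)
    (fun α : E →L[𝕜] 𝕜 => (α.toLinearMap : E →ₗ[𝕜] 𝕜))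
    (fun v hv => SeparatingDual.eq_zero_of_forall_dual_eq_zero (R := 𝕜) (V := E) hv)
    fun α β => ?_
  obtain ⟨F₁, hF₁, h₁⟩ := exists_dif_eq (I := I) (1 : G) α
  obtain ⟨F₂, hF₂, h₂⟩ := exists_dif_eq (I := I) (1 : G) β
  have hd {F : G → 𝕜} (hF : ContMDiffAt I 𝓘(𝕜, 𝕜) 2 F 1) (Y : GroupLieAlgebra I G) :
      MDifferentiableAt I 𝓘(𝕜, 𝕜) (fun g : G => (dif I F 1 ∘ₗ Ad I g) Y) 1 := by
    simp only [LinearMap.comp_apply, ← dif_Ad (hF.mdifferentiableAt (by norm_num))]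
    exact (contMDiffAt_dif (m := 1) (contMDiffAt_comp_conj hF) (by norm_num)
      Y).mdifferentiableAt (by norm_num)
  have hd' {F : G → 𝕜} (hF : ContMDiffAt I 𝓘(𝕜, 𝕜) 2 F 1) (Y : GroupLieAlgebra I G) :
      dif I (fun g : G => (dif I F 1 ∘ₗ Ad I g) Y) 1 X = (dif I F 1 ∘ₗ br X) Y := by
    simp only [LinearMap.comp_apply, ← dif_Ad (hF.mdifferentiableAt (by norm_num)), dif_conj hF,
      hbr]
  have key := (dif_eval₂ (hd hF₁) (hd hF₂) (hd' hF₁) (hd' hF₂) H).2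
  have hc : (fun g : G => eval₂ (dif I F₁ 1 ∘ₗ Ad I g) (dif I F₂ 1 ∘ₗ Ad I g) H) =
      fun _ => eval₂ (dif I F₁ 1) (dif I F₂ 1) H := by
    funext g
    rw [← eval₂_map, hH.inv]
  have hA : Ad I (1 : G) = LinearMap.id := by
    have h : (fun x : G => 1 * x * 1⁻¹) = id := by ext; simp
    have h' : mfderiv I I (fun x : G => 1 * x * 1⁻¹) 1 = ContinuousLinearMap.id 𝕜 E := by
      rw [h]; exact mfderiv_id
    exact congrArg (fun T : E →L[𝕜] E => T.toLinearMap) h'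
  rw [hc, dif_const, hA, ← eval₂_map, ← eval₂_map, ← map_add] at key
  rw [← h₁, ← h₂]
  exact key.symm

end AdInvariance

/-! ### Derivatives along the orbits of an action -/

section Actions

variable {𝕜 : Type*} [RCLike 𝕜]
  {E : Type*} [NormedAddCommGroup E] [NormedSpace 𝕜 E]
  {HG : Type*} [TopologicalSpace HG] {I : ModelWithCorners 𝕜 E HG}
  {G : Type*} [TopologicalSpace G] [ChartedSpace HG G] [Group G]
  {F : Type*} [NormedAddCommGroup F] [NormedSpace 𝕜 F]
  {HM : Type*} [TopologicalSpace HM] {J : ModelWithCorners 𝕜 F HM}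
  {M : Type*} [TopologicalSpace M] [ChartedSpace HM M]

variable (I J) in
/-- The map `σ` is an action of class `C^n` of `G` on `M`. Actions are kept as plain functions here
because several actions of the same group on the same manifold are compared: those of the two
factors of `G × G` and that of the diagonal. -/
structure IsSmoothAction (n : WithTop ℕ∞) (σ : G → M → M) : Prop where
  one : ∀ q, σ 1 q = q
  mul : ∀ g h q, σ (g * h) q = σ g (σ h q)
  contMDiff : ContMDiff (I.prod J) J n fun z : G × M => σ z.1 z.2

variable (I) in
/-- The derivative of `f` along the fundamental vector field of `X`, as the derivative at `t = 0`
of `f (σ (exp (-tX)) q)`. -/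
def orbitDeriv (σ : G → M → M) (X : GroupLieAlgebra I G) (f : M → 𝕜) (q : M) : 𝕜 :=
  -dif I (fun g : G => f (σ g q)) 1 X

namespace IsSmoothAction

variable {n m : WithTop ℕ∞} {σ : G → M → M}

lemma of_le (hσ : IsSmoothAction I J n σ) (hmn : m ≤ n) :
    IsSmoothAction I J m σ :=
  ⟨hσ.one, hσ.mul, hσ.contMDiff.of_le hmn⟩

lemma contMDiffAt_comp (hσ : IsSmoothAction I J n σ) (hmn : m ≤ n) {f : M → 𝕜} {g : G} {q : M}
    (hf : ContMDiffAt J 𝓘(𝕜, 𝕜) m f (σ g q)) :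
    ContMDiffAt (I.prod J) 𝓘(𝕜, 𝕜) m (fun z : G × M => f (σ z.1 z.2)) (g, q) :=
  ContMDiffAt.comp (g, q) (f := fun z : G × M => σ z.1 z.2) hf (hσ.contMDiff.of_le hmn).contMDiffAt

lemma contMDiff_orbit (hσ : IsSmoothAction I J n σ) (q : M) : ContMDiff I J n fun g => σ g q :=
  hσ.contMDiff.comp (contMDiff_id.prodMk contMDiff_const)

lemma contMDiff_apply (hσ : IsSmoothAction I J n σ) (g : G) : ContMDiff J J n (σ g) :=
  hσ.contMDiff.comp (contMDiff_const.prodMk contMDiff_id)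

lemma tendsto_orbit (hσ : IsSmoothAction I J n σ) (q : M) :
    Filter.Tendsto (fun g => σ g q) (nhds 1) (nhds q) := by
  have := (hσ.contMDiff_orbit q).continuous.tendsto 1
  rwa [hσ.one] at this

lemma orbitDeriv_congr (hσ : IsSmoothAction I J n σ) {f f' : M → 𝕜} {q : M} (h : f =ᶠ[nhds q] f')
    (X : GroupLieAlgebra I G) :
    orbitDeriv I σ X f q = orbitDeriv I σ X f' q := by
  have : (fun g => f (σ g q)) =ᶠ[nhds 1] fun g => f' (σ g q) := (hσ.tendsto_orbit q).eventually h
  rw [orbitDeriv, orbitDeriv, dif_congr this]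

lemma contMDiffAt_orbitDeriv (hσ : IsSmoothAction I J n σ) [I.Boundaryless] [J.Boundaryless]
    [IsManifold J m M] (hmn : m + 1 ≤ n)
    {f : M → 𝕜} {q : M} (hf : ContMDiffAt J 𝓘(𝕜, 𝕜) (m + 1) f q) (X : GroupLieAlgebra I G) :
    ContMDiffAt J 𝓘(𝕜, 𝕜) m (orbitDeriv I σ X f) q := by
  have h : ContMDiffAt (I.prod J) 𝓘(𝕜, 𝕜) (m + 1) (fun z : G × M => f (σ z.1 z.2)) (1, q) :=
    hσ.contMDiffAt_comp hmn (by rwa [hσ.one])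
  have h' : ContMDiffAt (J.prod I) 𝓘(𝕜, 𝕜) (m + 1) (fun z : M × G => f (σ z.2 z.1)) (q, 1) :=
    ContMDiffAt.comp (q, 1) (f := Prod.swap) h (contMDiff_snd.prodMk contMDiff_fst).contMDiffAt
  exact (contMDiffAt_dif h' le_rfl X).neg

lemma orbitDeriv_eq_dif (hσ : IsSmoothAction I J n σ) (hn : 1 ≤ n) {f : M → 𝕜} {q : M}
    (hf : MDifferentiableAt J 𝓘(𝕜, 𝕜) f q)
    (X : GroupLieAlgebra I G) :
    orbitDeriv I σ X f q =
      -dif J f q (show F from mfderiv I J (fun g : G => σ g q) 1 X) := by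
  have : dif I (fun g : G => f (σ g q)) 1 X = _ := dif_comp (φ := fun g : G => σ g q)
    (by rwa [hσ.one]) ((hσ.contMDiff_orbit q).contMDiffAt.mdifferentiableAt (by positivity)) X
  rw [orbitDeriv, this]
  exact congrArg Neg.neg (dif_congr_point f (hσ.one q) _)

/-- The action of the Lie algebra by derivations is a homomorphism of Lie algebras. -/
lemma orbitDeriv_bracket (hσ : IsSmoothAction I J n σ) [I.Boundaryless] [CompleteSpace E]
    [LieGroup I 3 G] (hn : 2 ≤ n)
    {f : M → 𝕜} {q : M} (hf : ContMDiffAt J 𝓘(𝕜, 𝕜) 2 f q) (X Y : GroupLieAlgebra I G) :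
    orbitDeriv I σ ⁅X, Y⁆ f q =
      orbitDeriv I σ X (orbitDeriv I σ Y f) q - orbitDeriv I σ Y (orbitDeriv I σ X f) q := by
  have hF : ContMDiffAt I 𝓘(𝕜, 𝕜) 2 (fun g : G => f (σ g q)) 1 :=
    ContMDiffAt.comp 1 (f := fun g => σ g q) (by rwa [hσ.one])
      ((hσ.contMDiff_orbit q).of_le hn).contMDiffAt
  have h (X Y : GroupLieAlgebra I G) : orbitDeriv I σ X (orbitDeriv I σ Y f) q =
      dif I (fun g : G => dif I (fun h : G => f (σ (h * g) q)) 1 Y) 1 X := by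
    simp only [orbitDeriv, ← hσ.mul, dif_neg_fun, LinearMap.neg_apply, neg_neg]
  rw [h, h, dif_bracket_swap hF]
  rfl

/-- Derivatives along the orbits of commuting actions commute. -/
lemma orbitDeriv_comm {E' : Type*} [NormedAddCommGroup E'] [NormedSpace 𝕜 E']
    {HG' : Type*} [TopologicalSpace HG'] {I' : ModelWithCorners 𝕜 E' HG'}
    {G' : Type*} [TopologicalSpace G'] [ChartedSpace HG' G'] [Group G'] {τ : G' → M → M}
    [I.Boundaryless] [I'.Boundaryless] (hσ : IsSmoothAction I J n σ)
    (hτ : IsSmoothAction I' J n τ) (hn : 2 ≤ n)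
    (hστ : ∀ g h q, σ g (τ h q) = τ h (σ g q)) {f : M → 𝕜} {q : M}
    (hf : ContMDiffAt J 𝓘(𝕜, 𝕜) 2 f q) (X : GroupLieAlgebra I G) (Y : GroupLieAlgebra I' G') :
    orbitDeriv I σ X (orbitDeriv I' τ Y f) q = orbitDeriv I' τ Y (orbitDeriv I σ X f) q := by
  have hm : ContMDiffAt (I.prod I') 𝓘(𝕜, 𝕜) 2 (fun z : G × G' => f (σ z.1 (τ z.2 q)))
      (1, 1) := by
    have h₁ : ContMDiffAt (I.prod J) 𝓘(𝕜, 𝕜) 2 (fun z : G × M => f (σ z.1 z.2)) (1, τ 1 q) :=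
      hσ.contMDiffAt_comp hn (by rwa [hσ.one, hτ.one])
    exact ContMDiffAt.comp (1, 1) (f := fun z : G × G' => (z.1, τ z.2 q)) h₁
      (contMDiff_fst.prodMk ((hτ.contMDiff_orbit q).of_le hn |>.comp contMDiff_snd)).contMDiffAt
  have := dif_dif_comm hm X Y
  simp only [orbitDeriv, dif_neg_fun, LinearMap.neg_apply, neg_neg]
  rw [← this]
  simp only [hστ]

end IsSmoothAction

end Actions

/-! ### Fundamental vector fields and invariant bivectors -/

section Fundamental

variable {𝕜 : Type*} [RCLike 𝕜]
  {E : Type*} [NormedAddCommGroup E] [NormedSpace 𝕜 E]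
  {HG : Type*} [TopologicalSpace HG] {I : ModelWithCorners 𝕜 E HG}
  {G : Type*} [TopologicalSpace G] [ChartedSpace HG G] [Group G]
  {F : Type*} [NormedAddCommGroup F] [NormedSpace 𝕜 F]
  {HM : Type*} [TopologicalSpace HM] {J : ModelWithCorners 𝕜 F HM}
  {M : Type*} [TopologicalSpace M] [ChartedSpace HM M] [MulAction G M]
  {n : WithTop ℕ∞}

variable (I J n G M) in
lemma isSmoothAction_smul [ContMDiffSMul I J n G M] :
    IsSmoothAction I J n (fun (g : G) (q : M) => g • q) :=
  ⟨one_smul G, mul_smul, contMDiff_smul⟩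

lemma orbitDeriv_smul [ContMDiffSMul I J n G M] (hn : 1 ≤ n) {f : M → 𝕜} {q : M}
    (hf : MDifferentiableAt J 𝓘(𝕜, 𝕜) f q) (X : GroupLieAlgebra I G) :
    orbitDeriv I (fun (g : G) (q : M) => g • q) X f q = dif J f q (fund I J q X) :=
  ((isSmoothAction_smul I G J M n).orbitDeriv_eq_dif hn hf X).trans ((dif J f q).map_neg _).symm

variable (I J G) in
/-- The linear map `i` of Lie algebras is compatible with the action `σ` of `G₁` and the given
action of `G`: the fundamental vector fields of `X` and of `i X` agree. -/
def IsFundHom {E₁ : Type*} [NormedAddCommGroup E₁] [NormedSpace 𝕜 E₁]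
    {H₁ : Type*} [TopologicalSpace H₁] {I₁ : ModelWithCorners 𝕜 E₁ H₁}
    {G₁ : Type*} [TopologicalSpace G₁] [ChartedSpace H₁ G₁] [Group G₁] (σ : G₁ → M → M)
    (i : GroupLieAlgebra I₁ G₁ →ₗ[𝕜] GroupLieAlgebra I G) : Prop :=
  ∀ (X : GroupLieAlgebra I₁ G₁) (f : M → 𝕜) (q : M), MDifferentiableAt J 𝓘(𝕜, 𝕜) f q →
    orbitDeriv I₁ σ X f q = dif J f q (fund I J q (i X))

lemma isFundHom_id [ContMDiffSMul I J n G M] (hn : 1 ≤ n) :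
    IsFundHom I G J (fun (g : G) (q : M) => g • q) (LinearMap.id : GroupLieAlgebra I G →ₗ[𝕜] _) :=
  fun X _ _ hf => orbitDeriv_smul hn hf X

/-- The fundamental vector fields of an action through a homomorphism `ι` are those of the images
under the differential of `ι`. -/
lemma orbitDeriv_hom {E' : Type*} [NormedAddCommGroup E'] [NormedSpace 𝕜 E']
    {HG' : Type*} [TopologicalSpace HG'] {I' : ModelWithCorners 𝕜 E' HG'}
    {G' : Type*} [TopologicalSpace G'] [ChartedSpace HG' G'] [Group G']
    [ContMDiffSMul I J n G M] (hn : 1 ≤ n) {ι : G' → G} (hι : MDifferentiableAt I' I ι 1)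
    (hι1 : ι 1 = 1) {f : M → 𝕜} {q : M}
    (hf : MDifferentiableAt J 𝓘(𝕜, 𝕜) f q) (X : GroupLieAlgebra I' G') :
    orbitDeriv I' (fun (g : G') (q : M) => ι g • q) X f q =
      dif J f q (fund (G := G) I J q (show E from mfderiv I' I ι 1 X)) := by
  have hσ := isSmoothAction_smul I G J M n
  have h : MDifferentiableAt I 𝓘(𝕜, 𝕜) (fun g : G => f (g • q)) 1 :=
    MDifferentiableAt.comp 1 (f := fun g : G => g • q) (by rwa [one_smul])
      ((hσ.contMDiff_orbit q).contMDiffAt.mdifferentiableAt (by positivity))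
  have e : dif I' (fun g : G' => f (ι g • q)) 1 X = _ :=
    dif_comp (φ := ι) (by rwa [hι1]) hι X
  refine Eq.trans ?_ (orbitDeriv_smul hn hf _)
  change -dif I' (fun g : G' => f (ι g • q)) 1 X =
    -dif I (fun g : G => f (g • q)) 1 (show E from mfderiv I' I ι 1 X)
  rw [e]
  exact congrArg Neg.neg (dif_congr_point (fun g : G => f (g • q)) hι1 _)

/-- An invariant bivector is invariant under the derivatives along the orbits. -/
lemma IsInvBivector.orbitDeriv_bidiff [I.Boundaryless] [J.Boundaryless]
    [IsManifold I 1 G] [IsManifold J 2 M] [ContMDiffSMul I J n G M] (hn : 2 ≤ n)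
    {P : TensorField₂ J M} (hP : IsInvBivector G J n P)
    {f h : M → 𝕜} {q : M} (hf : ContMDiffAt J 𝓘(𝕜, 𝕜) 2 f q) (hh : ContMDiffAt J 𝓘(𝕜, 𝕜) 2 h q)
    (X : GroupLieAlgebra I G) :
    orbitDeriv I (fun (g : G) (q : M) => g • q) X (bidiff J P f h) q =
      bidiff J P (orbitDeriv I (fun (g : G) (q : M) => g • q) X f) h q +
        bidiff J P f (orbitDeriv I (fun (g : G) (q : M) => g • q) X h) q := by
  have hσ := isSmoothAction_smul I G J M n
  have hmd {f : M → 𝕜} (hf : ContMDiffAt J 𝓘(𝕜, 𝕜) 2 f q) :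
      ∀ᶠ g : G in nhds 1, MDifferentiableAt J 𝓘(𝕜, 𝕜) f (g • q) := by
    have : ∀ᶠ x in nhds q, MDifferentiableAt J 𝓘(𝕜, 𝕜) f x :=
      (contMDiffAt_iff_contMDiffAt_nhds (by simp) |>.1 hf).mono fun x hx =>
        hx.mdifferentiableAt (by norm_num)
    exact (hσ.tendsto_orbit q).eventually this
  have hev : (fun g : G => bidiff J P f h (g • q)) =ᶠ[nhds 1] fun g =>
      eval₂ (dif J (fun x => f (g • x)) q) (dif J (fun x => h (g • x)) q) (P q) := by
    filter_upwards [hmd hf, hmd hh] with g hfg hhg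
    have hd {f : M → 𝕜} (hf : MDifferentiableAt J 𝓘(𝕜, 𝕜) f (g • q)) :
        dif J (fun x => f (g • x)) q =
          dif J f (g • q) ∘ₗ (mfderiv J J (fun x : M => g • x) q).toLinearMap :=
      LinearMap.ext fun v => dif_comp (φ := fun x => g • x) hf
        ((hσ.contMDiff_apply g).contMDiffAt.mdifferentiableAt (by positivity)) v
    rw [bidiff, hd hfg, hd hhg, ← eval₂_map, hP.inv]
  have hc {f : M → 𝕜} (hf : ContMDiffAt J 𝓘(𝕜, 𝕜) 2 f q) :
      ContMDiffAt (I.prod J) 𝓘(𝕜, 𝕜) 2 (fun z : G × M => f (z.1 • z.2)) (1, q) :=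
    hσ.contMDiffAt_comp hn (by rwa [one_smul])
  have ha {f : M → 𝕜} (hf : ContMDiffAt J 𝓘(𝕜, 𝕜) 2 f q) (v : TangentSpace J q) :
      MDifferentiableAt I 𝓘(𝕜, 𝕜) (fun g : G => dif J (fun x => f (g • x)) q v) 1 :=
    (contMDiffAt_dif (m := 1) (hc hf) (by norm_num) v).mdifferentiableAt (by norm_num)
  have ha' {f : M → 𝕜} (hf : ContMDiffAt J 𝓘(𝕜, 𝕜) 2 f q) (v : TangentSpace J q) :
      dif I (fun g : G => dif J (fun x => f (g • x)) q v) 1 X =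
        (-dif J (orbitDeriv I (fun (g : G) (q : M) => g • q) X f) q) v := by
    rw [dif_dif_comm (hc hf)]
    have : orbitDeriv I (fun (g : G) (q : M) => g • q) X f =
      fun x => -dif I (fun g : G => f (g • x)) 1 X := rfl
    rw [this, dif_neg_fun, neg_neg]
  have key := (dif_eval₂ (ha hf) (ha hh) (ha' hf) (ha' hh) (P q)).2
  rw [orbitDeriv, dif_congr hev, key]
  simp only [one_smul, bidiff]
  have hneg (a b : TangentSpace J q →ₗ[𝕜] 𝕜) (t : TangentSpace J q ⊗[𝕜] TangentSpace J q) :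
      eval₂ (-a) b t = -eval₂ a b t ∧ eval₂ a (-b) t = -eval₂ a b t := by
    induction t with
    | zero => simp
    | tmul u v => simp
    | add s t hs ht => simp only [map_add, hs, ht, neg_add]; simp
  rw [(hneg _ _ _).1, (hneg _ _ _).2]
  ring

end Fundamental

/-! ### Operators on the algebra of functions on an open set -/

lemma add_one_le_of_infty_le {n : WithTop ℕ∞} (hn : ∞ ≤ n) : n + 1 ≤ n := by
  induction n using WithTop.recTopCoe with
  | top => exact le_top
  | coe n =>
    have : n = ⊤ := top_le_iff.1 (WithTop.coe_le_coe.1 hn)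
    subst this
    exact le_of_eq rfl

lemma natCast_le_of_infty_le {n : WithTop ℕ∞} (hn : ∞ ≤ n) (k : ℕ) : (k : WithTop ℕ∞) ≤ n :=
  le_trans (WithTop.coe_le_coe.2 le_top) hn

section

variable {k : Type*} [Field k] {V : Type*} [AddCommMonoid V] [Module k V]
  {B : Type*} [CommRing B] [Algebra k B]

lemma eval₂_add_left (a a' b : V →ₗ[k] B) (t : V ⊗[k] V) :
    eval₂ (a + a') b t = eval₂ a b t + eval₂ a' b t := by
  simp [eval₂, TensorProduct.map_add_left]

lemma eval₂_add_right (a b b' : V →ₗ[k] B) (t : V ⊗[k] V) :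
    eval₂ a (b + b') t = eval₂ a b t + eval₂ a b' t := by
  simp [eval₂, TensorProduct.map_add_right]

lemma eval₂_smul_left (c : k) (a b : V →ₗ[k] B) (t : V ⊗[k] V) :
    eval₂ (c • a) b t = c • eval₂ a b t := by
  simp [eval₂, TensorProduct.map_smul_left]

lemma eval₂_smul_right (c : k) (a b : V →ₗ[k] B) (t : V ⊗[k] V) :
    eval₂ a (c • b) t = c • eval₂ a b t := by
  simp [eval₂, TensorProduct.map_smul_right]

end

section Operators

variable {𝕜 : Type*} [RCLike 𝕜]
  {E : Type*} [NormedAddCommGroup E] [NormedSpace 𝕜 E]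
  {HG : Type*} [TopologicalSpace HG] {I : ModelWithCorners 𝕜 E HG}
  {G : Type*} [TopologicalSpace G] [ChartedSpace HG G] [Group G] [LieGroup I 3 G]
  {F : Type*} [NormedAddCommGroup F] [NormedSpace 𝕜 F]
  {HM : Type*} [TopologicalSpace HM] {J : ModelWithCorners 𝕜 F HM}
  {M : Type*} [TopologicalSpace M] [ChartedSpace HM M]
  {n : WithTop ℕ∞} {U : Set M}

variable (J n U) in
/-- The algebra of functions on `M` that are of class `C^n` on `U`. The values outside `U` are
arbitrary, so that operators on this algebra have to be truncated by the indicator of `U`. -/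
def smoothOn : Subalgebra 𝕜 (M → 𝕜) where
  carrier := {f | ContMDiffOn J 𝓘(𝕜, 𝕜) n f U}
  mul_mem' hf hg := hf.mul hg
  add_mem' hf hg := hf.add hg
  algebraMap_mem' _ := contMDiffOn_const

lemma contMDiffAt_smoothOn (hU : IsOpen U) (f : smoothOn J n U) {q : M} (hq : q ∈ U) :
    ContMDiffAt J 𝓘(𝕜, 𝕜) n (f : M → 𝕜) q :=
  (f.2 q hq).contMDiffAt (hU.mem_nhds hq)

lemma mdifferentiableAt_smoothOn (hn : 1 ≤ n) (hU : IsOpen U) (f : smoothOn J n U) {q : M}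
    (hq : q ∈ U) : MDifferentiableAt J 𝓘(𝕜, 𝕜) (f : M → 𝕜) q :=
  (contMDiffAt_smoothOn hU f hq).mdifferentiableAt (by positivity)

lemma indicator_eventuallyEq (hU : IsOpen U) (f : M → 𝕜) {q : M} (hq : q ∈ U) :
    U.indicator f =ᶠ[nhds q] f :=
  Filter.eventuallyEq_of_mem (hU.mem_nhds hq) fun _ hx => Set.indicator_of_mem hx f

lemma indicator_mem_smoothOn {f : M → 𝕜} (hf : ContMDiffOn J 𝓘(𝕜, 𝕜) n f U) :
    U.indicator f ∈ smoothOn J n U :=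
  hf.congr fun _ hx => Set.indicator_of_mem hx f

/-- Evaluation at a point, as a homomorphism of algebras. -/
def evalAt (q : M) : smoothOn J n U →ₐ[𝕜] 𝕜 :=
  (Pi.evalAlgHom 𝕜 (fun _ : M => 𝕜) q).comp (smoothOn J n U).val

/-- The action of a `2`-tensor field on functions. -/
def bivOp (hn : 1 ≤ n) (hU : IsOpen U) {P : TensorField₂ J M} (hP : IsBivector J n P) :
    smoothOn J n U →ₗ[𝕜] smoothOn J n U →ₗ[𝕜] smoothOn J n U :=
  LinearMap.mk₂ 𝕜
    (fun f h => ⟨U.indicator (bidiff J P f h),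
      indicator_mem_smoothOn (hP.contMDiffOn U f h hU f.2 h.2)⟩)
    (fun f f' h => by
      ext q
      by_cases hq : q ∈ U
      · have := dif_add (mdifferentiableAt_smoothOn hn hU f hq)
          (mdifferentiableAt_smoothOn hn hU f' hq)
        simp [hq, bidiff, this, eval₂_add_left]
      · simp [hq])
    (fun c f h => by
      ext q
      by_cases hq : q ∈ U
      · have := dif_smul c (mdifferentiableAt_smoothOn hn hU f hq)
        simp [hq, bidiff, this, eval₂_smul_left]
      · simp [hq])
    (fun f h h' => by
      ext q
      by_cases hq : q ∈ U
      · have := dif_add (mdifferentiableAt_smoothOn hn hU h hq)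
          (mdifferentiableAt_smoothOn hn hU h' hq)
        simp [hq, bidiff, this, eval₂_add_right]
      · simp [hq])
    (fun c f h => by
      ext q
      by_cases hq : q ∈ U
      · have := dif_smul c (mdifferentiableAt_smoothOn hn hU h hq)
        simp [hq, bidiff, this, eval₂_smul_right]
      · simp [hq])

lemma bivOp_apply (hn : 1 ≤ n) (hU : IsOpen U) {P : TensorField₂ J M} (hP : IsBivector J n P)
    (f h : smoothOn J n U) :
    (bivOp hn hU hP f h : M → 𝕜) = U.indicator (bidiff J P f h) := rfl

/-- The truncated operator of a bivector is a skew-symmetric biderivation. -/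
lemma isAlgBivector_bivOp (hn : 1 ≤ n) (hU : IsOpen U) {P : TensorField₂ J M}
    (hP : IsBivector J n P) : IsAlgBivector (bivOp hn hU hP) where
  skew f h := by
    ext q
    by_cases hq : q ∈ U
    · have := eval₂_comm (dif J (f : M → 𝕜) q) (dif J (h : M → 𝕜) q) (P q)
      rw [hP.skew, map_neg] at this
      simp [hq, bivOp_apply, bidiff, ← this]
    · simp [hq, bivOp_apply]
  leibniz f g h := by
    ext q
    by_cases hq : q ∈ U
    · have := dif_mul (mdifferentiableAt_smoothOn hn hU g hq)
          (mdifferentiableAt_smoothOn hn hU h hq)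
      simp [hq, bivOp_apply, bidiff, this, eval₂_add_right, eval₂_smul_right]
      ring
    · simp [hq, bivOp_apply]

lemma bidiff_congr {f f' h h' : M → 𝕜} {q : M} (P : TensorField₂ J M) (hf : f =ᶠ[nhds q] f')
    (hh : h =ᶠ[nhds q] h') : bidiff J P f h q = bidiff J P f' h' q := by
  rw [bidiff, bidiff, dif_congr hf, dif_congr hh]

/-- The Schouten bracket of bivectors is that of the corresponding operators. -/
lemma algSchouten_bivOp (hn : 1 ≤ n) (hU : IsOpen U) {P Q : TensorField₂ J M}
    (hP : IsBivector J n P) (hQ : IsBivector J n Q) (f g h : smoothOn J n U) {q : M} (hq : q ∈ U) :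
    (algSchouten (bivOp hn hU hP) (bivOp hn hU hQ) f g h : smoothOn J n U).1 q =
      schouten J P Q (f : M → 𝕜) g h q := by
  have key {P Q : TensorField₂ J M} (hP : IsBivector J n P) (hQ : IsBivector J n Q)
      (f g h : smoothOn J n U) : (bivOp hn hU hP f (bivOp hn hU hQ g h) : M → 𝕜) q =
        bidiff J P f (bidiff J Q g h) q := by
    rw [bivOp_apply, Set.indicator_of_mem hq]
    exact bidiff_congr P (Filter.EventuallyEq.refl _ _) (indicator_eventuallyEq hU _ hq)
  simp only [algSchouten, schouten, Subalgebra.coe_add, Pi.add_apply, key]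

variable [MulAction G M]

variable (I G) in
/-- The action of the Lie algebra on functions by fundamental vector fields. -/
def fundOp [I.Boundaryless] [J.Boundaryless] [IsManifold J n M] [ContMDiffSMul I J n G M]
    (hn : ∞ ≤ n) (hU : IsOpen U) :
    GroupLieAlgebra I G →ₗ[𝕜] smoothOn J n U →ₗ[𝕜] smoothOn J n U :=
  LinearMap.mk₂ 𝕜
    (fun X f => ⟨U.indicator fun q => dif J (f : M → 𝕜) q (fund I J q X),
      indicator_mem_smoothOn fun q hq => by
        have hn1 : (1 : WithTop ℕ∞) ≤ n := natCast_le_of_infty_le hn 1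
        have h := (isSmoothAction_smul I G J M n).contMDiffAt_orbitDeriv (m := n)
          (add_one_le_of_infty_le hn)
          ((contMDiffAt_smoothOn hU f hq).of_le (add_one_le_of_infty_le hn)) X
        exact (h.congr_of_eventuallyEq (Filter.eventuallyEq_of_mem (hU.mem_nhds hq)
          fun x hx => (orbitDeriv_smul hn1 (mdifferentiableAt_smoothOn hn1 hU f hx)
            X).symm)).contMDiffWithinAt⟩)
    (fun X Y f => by
      ext q
      by_cases hq : q ∈ U <;> simp [hq])
    (fun c X f => by
      ext q
      by_cases hq : q ∈ U <;> simp [hq])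
    (fun X f g => by
      ext q
      by_cases hq : q ∈ U
      · have hn1 : (1 : WithTop ℕ∞) ≤ n := natCast_le_of_infty_le hn 1
        have := dif_add (mdifferentiableAt_smoothOn hn1 hU f hq)
          (mdifferentiableAt_smoothOn hn1 hU g hq)
        simp [hq, this]
      · simp [hq])
    (fun c X f => by
      ext q
      by_cases hq : q ∈ U
      · have hn1 : (1 : WithTop ℕ∞) ≤ n := natCast_le_of_infty_le hn 1
        have := dif_smul c (mdifferentiableAt_smoothOn hn1 hU f hq)
        simp [hq, this]
      · simp [hq])

end Operators

/-! ### Fundamental vector fields as derivations -/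

section FundamentalOperators

variable {𝕜 : Type*} [RCLike 𝕜]
  {E : Type*} [NormedAddCommGroup E] [NormedSpace 𝕜 E]
  {HG : Type*} [TopologicalSpace HG] {I : ModelWithCorners 𝕜 E HG} [I.Boundaryless]
  {G : Type*} [TopologicalSpace G] [ChartedSpace HG G] [Group G]
  {F : Type*} [NormedAddCommGroup F] [NormedSpace 𝕜 F]
  {HM : Type*} [TopologicalSpace HM] {J : ModelWithCorners 𝕜 F HM} [J.Boundaryless]
  {M : Type*} [TopologicalSpace M] [ChartedSpace HM M] [MulAction G M]
  {n : WithTop ℕ∞} {U : Set M} [IsManifold J n M] [ContMDiffSMul I J n G M]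
  {E₁ : Type*} [NormedAddCommGroup E₁] [NormedSpace 𝕜 E₁]
  {H₁ : Type*} [TopologicalSpace H₁] {I₁ : ModelWithCorners 𝕜 E₁ H₁}
  {G₁ : Type*} [TopologicalSpace G₁] [ChartedSpace H₁ G₁] [Group G₁]
  {E₂ : Type*} [NormedAddCommGroup E₂] [NormedSpace 𝕜 E₂]
  {H₂ : Type*} [TopologicalSpace H₂] {I₂ : ModelWithCorners 𝕜 E₂ H₂}
  {G₂ : Type*} [TopologicalSpace G₂] [ChartedSpace H₂ G₂] [Group G₂]

lemma fundOp_apply (hn : ∞ ≤ n) (hU : IsOpen U) (X : GroupLieAlgebra I G) (f : smoothOn J n U) :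
    (fundOp I G hn hU X f : M → 𝕜) =
      U.indicator fun q => dif J (f : M → 𝕜) q (fund I J q X) := rfl

lemma isLeibniz_fundOp (hn : ∞ ≤ n) (hU : IsOpen U) (X : GroupLieAlgebra I G) :
    IsLeibniz (fundOp (J := J) I G hn hU X) := by
  intro f g
  ext q
  by_cases hq : q ∈ U
  · have hn1 : (1 : WithTop ℕ∞) ≤ n := natCast_le_of_infty_le hn 1
    have := dif_mul (mdifferentiableAt_smoothOn hn1 hU f hq)
      (mdifferentiableAt_smoothOn hn1 hU g hq)
    simp [hq, fundOp_apply, this]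
    ring
  · simp [hq, fundOp_apply]

lemma IsFundHom.fundOp_eventuallyEq {σ : G₁ → M → M}
    {i : GroupLieAlgebra I₁ G₁ →ₗ[𝕜] GroupLieAlgebra I G} (hi : IsFundHom I G J σ i)
    (hn : ∞ ≤ n) (hU : IsOpen U) (X : GroupLieAlgebra I₁ G₁) (f : smoothOn J n U)
    {q : M} (hq : q ∈ U) :
    (fundOp I G hn hU (i X) f : M → 𝕜) =ᶠ[nhds q] orbitDeriv I₁ σ X f := by
  filter_upwards [hU.mem_nhds hq] with x hx
  rw [fundOp_apply, Set.indicator_of_mem hx,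
    hi X f x (mdifferentiableAt_smoothOn (natCast_le_of_infty_le hn 1) hU f hx)]

lemma IsFundHom.fundOp_fundOp {σ : G₁ → M → M} {τ : G₂ → M → M} (hσ : IsSmoothAction I₁ J n σ)
    {i : GroupLieAlgebra I₁ G₁ →ₗ[𝕜] GroupLieAlgebra I G} (hi : IsFundHom I G J σ i)
    {j : GroupLieAlgebra I₂ G₂ →ₗ[𝕜] GroupLieAlgebra I G} (hj : IsFundHom I G J τ j)
    (hn : ∞ ≤ n) (hU : IsOpen U) (X : GroupLieAlgebra I₁ G₁) (Y : GroupLieAlgebra I₂ G₂)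
    (f : smoothOn J n U) {q : M} (hq : q ∈ U) :
    (fundOp I G hn hU (i X) (fundOp I G hn hU (j Y) f) : M → 𝕜) q =
      orbitDeriv I₁ σ X (orbitDeriv I₂ τ Y f) q := by
  rw [(hi.fundOp_eventuallyEq hn hU X _ hq).eq_of_nhds,
    hσ.orbitDeriv_congr (hj.fundOp_eventuallyEq hn hU Y f hq)]

/-- The truncated operators represent the bracket. -/
lemma IsFundHom.fundOp_bracket [I₁.Boundaryless] [CompleteSpace E₁] [LieGroup I₁ 3 G₁]
    {σ : G₁ → M → M}
    (hσ : IsSmoothAction I₁ J n σ)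
    {i : GroupLieAlgebra I₁ G₁ →ₗ[𝕜] GroupLieAlgebra I G} (hi : IsFundHom I G J σ i)
    (hn : ∞ ≤ n) (hU : IsOpen U) (X Y : GroupLieAlgebra I₁ G₁) (f : smoothOn J n U) :
    fundOp I G hn hU (i ⁅X, Y⁆) f = fundOp I G hn hU (i X) (fundOp I G hn hU (i Y) f) -
      fundOp I G hn hU (i Y) (fundOp I G hn hU (i X) f) := by
  have hn2 : (2 : WithTop ℕ∞) ≤ n := natCast_le_of_infty_le hn 2
  ext q
  by_cases hq : q ∈ U
  · rw [(hi.fundOp_eventuallyEq hn hU _ f hq).eq_of_nhds, Subalgebra.coe_sub, Pi.sub_apply,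
      hi.fundOp_fundOp hσ hi hn hU X Y f hq, hi.fundOp_fundOp hσ hi hn hU Y X f hq,
      hσ.orbitDeriv_bracket hn2 ((contMDiffAt_smoothOn hU f hq).of_le hn2)]
  · simp [hq, fundOp_apply]

/-- The truncated operators of commuting actions commute. -/
lemma IsFundHom.fundOp_comm [I₁.Boundaryless] [I₂.Boundaryless] {σ : G₁ → M → M} {τ : G₂ → M → M}
    (hσ : IsSmoothAction I₁ J n σ)
    (hτ : IsSmoothAction I₂ J n τ) (hστ : ∀ g h q, σ g (τ h q) = τ h (σ g q))
    {i : GroupLieAlgebra I₁ G₁ →ₗ[𝕜] GroupLieAlgebra I G} (hi : IsFundHom I G J σ i)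
    {j : GroupLieAlgebra I₂ G₂ →ₗ[𝕜] GroupLieAlgebra I G} (hj : IsFundHom I G J τ j)
    (hn : ∞ ≤ n) (hU : IsOpen U) (X : GroupLieAlgebra I₁ G₁) (Y : GroupLieAlgebra I₂ G₂)
    (f : smoothOn J n U) :
    fundOp I G hn hU (i X) (fundOp I G hn hU (j Y) f) =
      fundOp I G hn hU (j Y) (fundOp I G hn hU (i X) f) := by
  have hn2 : (2 : WithTop ℕ∞) ≤ n := natCast_le_of_infty_le hn 2
  ext q
  by_cases hq : q ∈ U
  · rw [hi.fundOp_fundOp hσ hj hn hU X Y f hq, hj.fundOp_fundOp hτ hi hn hU Y X f hq,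
      hσ.orbitDeriv_comm hτ hn2 hστ ((contMDiffAt_smoothOn hU f hq).of_le hn2)]
  · simp [hq, fundOp_apply]

/-- The truncated operators preserve an invariant bivector. -/
lemma fundOp_bivOp [IsManifold I 1 G] (hn : ∞ ≤ n) (hn1 : 1 ≤ n) (hU : IsOpen U)
    {P : TensorField₂ J M} (hP : IsInvBivector G J n P) (X : GroupLieAlgebra I G)
    (f h : smoothOn J n U) :
    fundOp I G hn hU X (bivOp hn1 hU hP.toIsBivector f h) =
      bivOp hn1 hU hP.toIsBivector (fundOp I G hn hU X f) h +
        bivOp hn1 hU hP.toIsBivector f (fundOp I G hn hU X h) := by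
  have hn2 : (2 : WithTop ℕ∞) ≤ n := natCast_le_of_infty_le hn 2
  have : IsManifold J 2 M := IsManifold.of_le hn2
  have hi := isFundHom_id (I := I) (J := J) (G := G) (M := M) hn1
  ext q
  by_cases hq : q ∈ U
  · have hX (f : smoothOn J n U) : (fundOp I G hn hU X f : M → 𝕜) =ᶠ[nhds q]
        orbitDeriv I (fun (g : G) (q : M) => g • q) X f := hi.fundOp_eventuallyEq hn hU X f hq
    have h2 (f : smoothOn J n U) := (contMDiffAt_smoothOn hU f hq).of_le hn2
    rw [(hX (bivOp hn1 hU hP.toIsBivector f h)).eq_of_nhds, Subalgebra.coe_add, Pi.add_apply]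
    simp only [bivOp_apply, Set.indicator_of_mem hq]
    rw [(isSmoothAction_smul I G J M n).orbitDeriv_congr (indicator_eventuallyEq hU _ hq),
      hP.orbitDeriv_bidiff hn2 (h2 f) (h2 h),
      bidiff_congr P (hX f).symm (Filter.EventuallyEq.refl _ _),
      bidiff_congr P (Filter.EventuallyEq.refl _ _) (hX h).symm]
  · simp [hq, fundOp_apply, bivOp_apply]

end FundamentalOperators

/-! ### The two factors and the diagonal -/

section ProductGroup

variable {𝕜 : Type*} [RCLike 𝕜]
  {E : Type*} [NormedAddCommGroup E] [NormedSpace 𝕜 E]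
  {HG : Type*} [TopologicalSpace HG] {I : ModelWithCorners 𝕜 E HG}
  {G : Type*} [TopologicalSpace G] [ChartedSpace HG G] [Group G]
  {F : Type*} [NormedAddCommGroup F] [NormedSpace 𝕜 F]
  {HM : Type*} [TopologicalSpace HM] {J : ModelWithCorners 𝕜 F HM}
  {M : Type*} [TopologicalSpace M] [ChartedSpace HM M] [MulAction (G × G) M]
  {n : WithTop ℕ∞} [ContMDiffSMul (I.prod I) J n (G × G) M]

variable (I G J M n) in
lemma isSmoothAction_left :
    IsSmoothAction I J n (fun (g : G) (q : M) => (g, (1 : G)) • q) where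
  one q := one_smul (G × G) q
  mul g h q := by simp [smul_smul]
  contMDiff := (isSmoothAction_smul (I.prod I) (G × G) J M n).contMDiff.comp
    ((contMDiff_fst.prodMk contMDiff_const).prodMk contMDiff_snd)

variable (I G J M n) in
lemma isSmoothAction_right :
    IsSmoothAction I J n (fun (g : G) (q : M) => ((1 : G), g) • q) where
  one q := one_smul (G × G) q
  mul g h q := by simp [smul_smul]
  contMDiff := (isSmoothAction_smul (I.prod I) (G × G) J M n).contMDiff.comp
    ((contMDiff_const.prodMk contMDiff_fst).prodMk contMDiff_snd)

variable (I G J M n) in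
lemma contMDiffSMul_diagAction :
    letI := diagAction G M
    ContMDiffSMul I J n G M :=
  letI := diagAction G M
  ⟨(isSmoothAction_smul (I.prod I) (G × G) J M n).contMDiff.comp
    ((contMDiff_fst.prodMk contMDiff_fst).prodMk contMDiff_snd)⟩

lemma isFundHom_incl₁ (hn : 1 ≤ n) : IsFundHom (I.prod I) (G × G) J
    (fun (g : G) (q : M) => (g, (1 : G)) • q) (incl₁ I G) := fun X _ _ hf =>
  orbitDeriv_hom hn (ι := fun x : G => (x, (1 : G)))
    (mdifferentiableAt_id.prodMk mdifferentiableAt_const) rfl hf X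

lemma isFundHom_incl₂ (hn : 1 ≤ n) : IsFundHom (I.prod I) (G × G) J
    (fun (g : G) (q : M) => ((1 : G), g) • q) (incl₂ I G) := fun X _ _ hf =>
  orbitDeriv_hom hn (ι := fun x : G => ((1 : G), x))
    (mdifferentiableAt_const.prodMk mdifferentiableAt_id) rfl hf X

/-- The fundamental vector fields of the diagonal action are the sums of those of the factors. -/
lemma fund_diagAction [IsManifold J 3 M] (hn : 1 ≤ n) (q : M) :
    letI := diagAction G M
    fund (G := G) I J q =
      fund (G := G × G) (I.prod I) J q ∘ₗ (incl₁ I G + incl₂ I G) := by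
  let := diagAction G M
  have := contMDiffSMul_diagAction I G J M n
  ext X
  refine tangent_ext fun f hf => ?_
  have hf' := hf.mdifferentiableAt (by norm_num)
  have hd := orbitDeriv_smul (I := I) (G := G) hn hf' X
  rw [← hd, LinearMap.comp_apply, LinearMap.add_apply, map_add, map_add,
    ← isFundHom_incl₁ hn X f q hf', ← isFundHom_incl₂ hn X f q hf']
  have hσ := isSmoothAction_smul (I.prod I) (G × G) J M n
  have hm : MDifferentiableAt (I.prod I) 𝓘(𝕜, 𝕜) (fun z : G × G => f (z • q)) ((1 : G), (1 : G)) :=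
    MDifferentiableAt.comp _ (f := fun z : G × G => z • q)
      (by
        have : ((1 : G), (1 : G)) • q = q := one_smul (G × G) q
        rwa [this])
      ((hσ.contMDiff_orbit q).contMDiffAt.mdifferentiableAt (by positivity))
  have := dif_prodMk (φ := fun g : G => g) (ψ := fun g : G => g) hm mdifferentiableAt_id
    mdifferentiableAt_id X
  refine (congrArg Neg.neg this).trans ?_
  rw [neg_add]
  rfl

/-- The action of `(g, g)` intertwines the fundamental vector fields of `X` and `Ad_g X`. -/
lemma mfderiv_diag_fund [IsManifold J 3 M] [LieGroup I 3 G] (hn : 1 ≤ n) {σ : G → M → M}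
    (hσ : IsSmoothAction I J n σ) {i : GroupLieAlgebra I G →ₗ[𝕜] GroupLieAlgebra (I.prod I) (G × G)}
    (hi : IsFundHom (I.prod I) (G × G) J σ i)
    (hdiag : ∀ g x q, (g, g) • σ x q = σ (g * x * g⁻¹) ((g, g) • q)) (g : G) (q : M) :
    (mfderiv J J (fun x : M => (g, g) • x) q).toLinearMap ∘ₗ fund (G := G × G) (I.prod I) J q ∘ₗ i =
      fund (G := G × G) (I.prod I) J ((g, g) • q) ∘ₗ i ∘ₗ Ad I g := by
  ext X
  refine tangent_ext fun f hf => ?_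
  have hf' := hf.mdifferentiableAt (by norm_num)
  have hg : MDifferentiableAt J J (fun x : M => (g, g) • x) q :=
    ((isSmoothAction_smul (I.prod I) (G × G) J M n).contMDiff_apply (g, g)).contMDiffAt
      |>.mdifferentiableAt (by positivity)
  have hfg : MDifferentiableAt J 𝓘(𝕜, 𝕜) (fun x : M => f ((g, g) • x)) q := hf'.comp q hg
  have e := dif_comp (φ := fun x : M => (g, g) • x) hf' hg (fund (I.prod I) J q (i X))
  refine e.symm.trans ?_
  rw [← hi X _ q hfg]
  refine Eq.trans ?_ (hi (Ad I g X) f _ hf')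
  have hF : MDifferentiableAt I 𝓘(𝕜, 𝕜) (fun x : G => f (σ x ((g, g) • q))) 1 :=
    MDifferentiableAt.comp 1 (f := fun x : G => σ x ((g, g) • q)) (by rwa [hσ.one])
      ((hσ.contMDiff_orbit _).contMDiffAt.mdifferentiableAt (by positivity))
  rw [orbitDeriv, orbitDeriv, ← dif_Ad hF]
  simp only [hdiag]

/-- The tensor `χ_H` is skew-symmetric. -/
lemma comm_chi {L V : Type*} [AddCommGroup L] [Module 𝕜 L] [AddCommGroup V] [Module 𝕜 V]
    (i₁ i₂ : L →ₗ[𝕜] V) (H : L ⊗[𝕜] L) :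
    TensorProduct.comm 𝕜 V V (chi i₁ i₂ H) = -chi i₁ i₂ H := by
  have h (t : V ⊗[𝕜] V) : TensorProduct.comm 𝕜 V V (TensorProduct.comm 𝕜 V V t) = t :=
    (TensorProduct.comm 𝕜 V V).symm_apply_apply t
  simp only [chi, map_smul, map_sub, h, ← smul_neg, neg_sub]

end ProductGroup

/-! ### Fusion of bivectors on manifolds -/

section ManifoldFusion

lemma map_map_comm {k : Type*} [CommSemiring k] {V W : Type*} [AddCommMonoid V] [Module k V]
    [AddCommMonoid W] [Module k W] (S T : V →ₗ[k] W) (t : V ⊗[k] V) :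
    TensorProduct.comm k W W (TensorProduct.map S T t) =
      TensorProduct.map T S (TensorProduct.comm k V V t) := by
  induction t with
  | zero => simp
  | tmul u v => simp
  | add s t hs ht => simp only [map_add, hs, ht]

lemma map_map {k : Type*} [CommSemiring k] {V W Z V' W' Z' : Type*} [AddCommMonoid V] [Module k V]
    [AddCommMonoid W] [Module k W] [AddCommMonoid Z] [Module k Z] [AddCommMonoid V'] [Module k V']
    [AddCommMonoid W'] [Module k W'] [AddCommMonoid Z'] [Module k Z'] (S : V →ₗ[k] W)
    (S' : V' →ₗ[k] W') (T : W →ₗ[k] Z) (T' : W' →ₗ[k] Z') (t : V ⊗[k] V') :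
    TensorProduct.map T T' (TensorProduct.map S S' t) =
      TensorProduct.map (T ∘ₗ S) (T' ∘ₗ S') t := by
  rw [TensorProduct.map_comp]; rfl

variable {𝕜 : Type*} [RCLike 𝕜]
  {E : Type*} [NormedAddCommGroup E] [NormedSpace 𝕜 E]
  {HG : Type*} [TopologicalSpace HG] {I : ModelWithCorners 𝕜 E HG}
  {G : Type*} [TopologicalSpace G] [ChartedSpace HG G] [Group G]
  {F : Type*} [NormedAddCommGroup F] [NormedSpace 𝕜 F]
  {HM : Type*} [TopologicalSpace HM] {J : ModelWithCorners 𝕜 F HM}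
  {M : Type*} [TopologicalSpace M] [ChartedSpace HM M] [MulAction (G × G) M]
  {n : WithTop ℕ∞}
  {H : GroupLieAlgebra I G ⊗[𝕜] GroupLieAlgebra I G} {P : TensorField₂ J M}

lemma bidiff_fusion (f h : M → 𝕜) (q : M) :
    bidiff J (fusion I J H P) f h q = bidiff J P f h q -
      eval₂ (dif J f q ∘ₗ fund (G := G × G) (I.prod I) J q)
        (dif J h q ∘ₗ fund (G := G × G) (I.prod I) J q) (chi (incl₁ I G) (incl₂ I G) H) := by
  rw [bidiff, fusion, map_sub, eval₂_map]
  rfl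

variable [I.Boundaryless] [J.Boundaryless] [IsManifold J n M]
  [ContMDiffSMul (I.prod I) J n (G × G) M]

lemma evalAt_comp_fundOp {U : Set M} (hn : ∞ ≤ n) (hU : IsOpen U) (f : smoothOn J n U) {q : M}
    (hq : q ∈ U) :
    (evalAt q).toLinearMap ∘ₗ (fundOp (I.prod I) (G × G) hn hU).flip f =
      dif J (f : M → 𝕜) q ∘ₗ fund (G := G × G) (I.prod I) J q := by
  ext X
  exact Set.indicator_of_mem hq fun q => dif J (f : M → 𝕜) q (fund (I.prod I) J q X)

lemma isBivector_fusion (hn : ∞ ≤ n) (hP : IsBivector J n P) :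
    IsBivector J n (fusion I J H P) where
  skew q := by
    simp only [fusion, map_sub, hP.skew, map_map_comm, comm_chi, map_neg]
    abel
  contMDiffOn U f h hU hf hh := by
    have hn1 : (1 : WithTop ℕ∞) ≤ n := natCast_le_of_infty_le hn 1
    let f' : smoothOn J n U := ⟨f, hf⟩
    let h' : smoothOn J n U := ⟨h, hh⟩
    let D := fundOp (J := J) (n := n) (U := U) (I.prod I) (G × G) hn hU
    refine (bivOp hn1 hU hP f' h' -
      eval₂ (D.flip f') (D.flip h') (chi (incl₁ I G) (incl₂ I G) H)).2.congr fun q hq => ?_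
    have := map_eval₂ (evalAt q) (D.flip f') (D.flip h') (chi (incl₁ I G) (incl₂ I G) H)
    rw [evalAt_comp_fundOp hn hU f' hq, evalAt_comp_fundOp hn hU h' hq] at this
    rw [bidiff_fusion, Subalgebra.coe_sub, Pi.sub_apply, bivOp_apply, Set.indicator_of_mem hq,
      ← this]
    rfl

variable [LieGroup I n G]

/-- Under the diagonal, `Ad`-invariance of `H` applied to both legs of `χ_H` keeps it fixed. -/
lemma isInvBivector_fusion (hn : ∞ ≤ n) (hH : IsInvSymm I H) (hP : IsInvBivector (G × G) J n P) :
    letI := diagAction G M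
    IsInvBivector G J n (fusion I J H P) := by
  let := diagAction G M
  have hn1 : (1 : WithTop ℕ∞) ≤ n := natCast_le_of_infty_le hn 1
  have hn3 : (3 : WithTop ℕ∞) ≤ n := natCast_le_of_infty_le hn 3
  have : LieGroup I 3 G := LieGroup.of_le hn3
  have : IsManifold J 3 M := IsManifold.of_le hn3
  refine ⟨isBivector_fusion hn hP.toIsBivector, fun g q => ?_⟩
  have h₁ := mfderiv_diag_fund hn1 (isSmoothAction_left I G J M n) (isFundHom_incl₁ hn1)
    (fun g x q => by simp [smul_smul]) g q
  have h₂ := mfderiv_diag_fund hn1 (isSmoothAction_right I G J M n) (isFundHom_incl₂ hn1)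
    (fun g x q => by simp [smul_smul]) g q
  change TensorProduct.map (mfderiv J J (fun x : M => (g, g) • x) q).toLinearMap
    (mfderiv J J (fun x : M => (g, g) • x) q).toLinearMap (fusion I J H P q) =
      fusion I J H P ((g, g) • q)
  have hχ (T : GroupLieAlgebra (I.prod I) (G × G) →ₗ[𝕜] TangentSpace J ((g, g) • q)) :
      TensorProduct.map T T (chi (incl₁ I G) (incl₂ I G) H) = (2 : 𝕜)⁻¹ •
        (TensorProduct.map (T ∘ₗ incl₁ I G) (T ∘ₗ incl₂ I G) H - TensorProduct.comm 𝕜 _ _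
          (TensorProduct.map (T ∘ₗ incl₁ I G) (T ∘ₗ incl₂ I G) H)) := by
    simp only [chi, map_smul, map_sub, map_map_comm, map_map]
  simp only [fusion]
  rw [map_sub, map_map, hχ, LinearMap.comp_assoc, LinearMap.comp_assoc, h₁, h₂, hP.inv, hχ]
  simp only [← LinearMap.comp_assoc]
  rw [← map_map (Ad I g), hH.inv]

/-- Fusion of quasi Poisson structures on manifolds. -/
theorem isQuasiPoisson_fusion [CompleteSpace E] (hn : ∞ ≤ n) (hH : IsInvSymm I H)
    (hP : IsQuasiPoisson (G := G × G) (I.prod I) J n hn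
      (doubled (incl₁ I G) (incl₂ I G) H) P) :
    letI := diagAction G M
    IsQuasiPoisson (G := G) I J n hn H (fusion I J H P) := by
  let := diagAction G M
  have hn1 : (1 : WithTop ℕ∞) ≤ n := natCast_le_of_infty_le hn 1
  have hn3 : (3 : WithTop ℕ∞) ≤ n := natCast_le_of_infty_le hn 3
  have : LieGroup I 3 G := LieGroup.of_le hn3
  have : LieGroup (I.prod I) 3 (G × G) := LieGroup.of_le hn3
  have : IsManifold J 3 M := IsManifold.of_le hn3
  have : IsManifold (I.prod I) 1 (G × G) := IsManifold.of_le (n := 3) (by norm_num)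
  refine ⟨isInvBivector_fusion hn hH hP.toIsInvBivector, fun U f g h hU hf hg hh q hq => ?_⟩
  let f' : smoothOn J n U := ⟨f, hf⟩
  let g' : smoothOn J n U := ⟨g, hg⟩
  let h' : smoothOn J n U := ⟨h, hh⟩
  let D := fundOp (J := J) (n := n) (U := U) (I.prod I) (G × G) hn hU
  let P' := bivOp hn1 hU hP.toIsBivector
  have hQ : IsBivector J n (fusion I J H P) := isBivector_fusion hn hP.toIsBivector
  let Q' := bivOp hn1 hU hQ
  have hi₁ := isFundHom_incl₁ (I := I) (G := G) (J := J) (M := M) hn1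
  have hi₂ := isFundHom_incl₂ (I := I) (G := G) (J := J) (M := M) hn1
  have hσ₁ := isSmoothAction_left I G J M n
  have hσ₂ := isSmoothAction_right I G J M n
  have hbrV : ∀ x y f, D (lieBr (I.prod I) (G × G) n hn x y) f = D x (D y f) - D y (D x f) :=
    fun x y f => (isFundHom_id hn1).fundOp_bracket
      (isSmoothAction_smul (I.prod I) (G × G) J M n) hn hU x y f
  have h₁ : ∀ x y f, D (incl₁ I G (lieBr I G n hn x y)) f =
      D (incl₁ I G x) (D (incl₁ I G y) f) - D (incl₁ I G y) (D (incl₁ I G x) f) :=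
    fun x y f => hi₁.fundOp_bracket hσ₁ hn hU x y f
  have h₂ : ∀ x y f, D (incl₂ I G (lieBr I G n hn x y)) f =
      D (incl₂ I G x) (D (incl₂ I G y) f) - D (incl₂ I G y) (D (incl₂ I G x) f) :=
    fun x y f => hi₂.fundOp_bracket hσ₂ hn hU x y f
  have h₁₂ : ∀ x y f, D (incl₁ I G x) (D (incl₂ I G y) f) =
      D (incl₂ I G y) (D (incl₁ I G x) f) :=
    fun x y f => hi₁.fundOp_comm hσ₁ hσ₂ (fun g h q => by simp [smul_smul]) hi₂ hn hU x y f
  have hbr : ∀ x y, lieBr I G n hn x y = -lieBr I G n hn y x := by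
    have : LieGroup I (minSmoothness 𝕜 3) G := by rwa [minSmoothness_of_isRCLikeNormedField]
    exact fun x y => (lie_skew x y).symm
  have hinv : ∀ x, TensorProduct.map (lieBr I G n hn x) LinearMap.id H +
      TensorProduct.map LinearMap.id (lieBr I G n hn x) H = 0 :=
    fun x => hH.bracket_inv (fun _ _ => rfl) x
  have hev (q : M) (hq : q ∈ U) (f : smoothOn J n U) : (evalAt q).toLinearMap ∘ₗ D.flip f =
      dif J (f : M → 𝕜) q ∘ₗ fund (G := G × G) (I.prod I) J q := evalAt_comp_fundOp hn hU f hq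
  have hev0 (q : M) (hq : q ∉ U) (f : smoothOn J n U) : (evalAt q).toLinearMap ∘ₗ D.flip f = 0 := by
    ext X
    exact Set.indicator_of_notMem hq fun q => dif J (f : M → 𝕜) q (fund (I.prod I) J q X)
  have hQ' : ∀ f h, Q' f h = P' f h -
      eval₂ (D.flip f) (D.flip h) (chi (incl₁ I G) (incl₂ I G) H) := by
    intro f h
    ext q
    change (Q' f h).1 q = (P' f h).1 q - evalAt q _
    rw [map_eval₂]
    by_cases hq : q ∈ U
    · rw [hev q hq, hev q hq]
      simp only [Q', P', bivOp_apply, Set.indicator_of_mem hq, bidiff_fusion]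
    · rw [hev0 q hq, hev0 q hq]
      simp [Q', P', bivOp_apply, hq, eval₂]
  have hPP : algSchouten P' P' f' g' h' = eval₃ (D.flip f') (D.flip g') (D.flip h')
      (cartanElement (lieBr (I.prod I) (G × G) n hn) (doubled (incl₁ I G) (incl₂ I G) H)) := by
    ext q
    change _ = evalAt q _
    rw [map_eval₃]
    by_cases hq : q ∈ U
    · rw [hev q hq, hev q hq, hev q hq, ← eval₃_push₃]
      exact (algSchouten_bivOp hn1 hU hP.toIsBivector hP.toIsBivector f' g' h' hq).trans
        (hP.schouten_eq U f g h hU hf hg hh q hq)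
    · rw [hev0 q hq, hev0 q hq, hev0 q hq]
      simp [algSchouten, P', bivOp_apply, hq, eval₃]
  have key := algSchouten_fusion (K := 𝕜) (B := smoothOn J n U) (L := GroupLieAlgebra I G)
      (V := GroupLieAlgebra (I.prod I) (G × G)) (D := D) (br := lieBr I G n hn)
      (brV := lieBr (I.prod I) (G × G) n hn) (i₁ := incl₁ I G) (i₂ := incl₂ I G) (H := H) (P := P')
      (Q := Q') (f := f') (g := g') (h := h') (isLeibniz_fundOp hn hU) hbrV
  have key := key h₁ h₂ h₁₂
  have key := key hbr hH.symm hinv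
  have key := key (isAlgBivector_bivOp hn1 hU hP.toIsBivector)
    (fundOp_bivOp hn hn1 hU hP.toIsInvBivector)
  have key := key hQ' hPP
  have key := congrArg (evalAt q) key
  rw [map_eval₃] at key
  simp only [← LinearMap.comp_assoc, hev q hq] at key
  refine (algSchouten_bivOp hn1 hU hQ hQ f' g' h' hq).symm.trans (key.trans ?_)
  rw [eval₃_push₃, fund_diagAction hn1 q]
  rfl

end ManifoldFusion

/-! ### Momentum mappings on manifolds -/

section Translations

variable {𝕜 : Type*} [RCLike 𝕜]
  {E : Type*} [NormedAddCommGroup E] [NormedSpace 𝕜 E]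
  {HG : Type*} [TopologicalSpace HG] {I : ModelWithCorners 𝕜 E HG}
  {G : Type*} [TopologicalSpace G] [ChartedSpace HG G] [Group G]

variable (I) in
/-- The differential at the identity of `x ↦ a x b`, with values in `T_{ab} G`. -/
def midTrans (a b : G) : GroupLieAlgebra I G →ₗ[𝕜] TangentSpace I (a * b) :=
  (mfderiv I I (fun x : G => a * x * b) 1 :
    GroupLieAlgebra I G →L[𝕜] TangentSpace I (a * 1 * b)).toLinearMap

lemma dif_incl₁ {f : G × G → 𝕜} (hf : MDifferentiableAt (I.prod I) 𝓘(𝕜, 𝕜) f 1)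
    (X : GroupLieAlgebra I G) :
    dif (I.prod I) f 1 (incl₁ I G X) = dif I (fun x : G => f (x, 1)) 1 X :=
  (dif_comp (φ := fun x : G => (x, (1 : G))) hf
    (mdifferentiableAt_id.prodMk mdifferentiableAt_const) X).symm

lemma dif_incl₂ {f : G × G → 𝕜} (hf : MDifferentiableAt (I.prod I) 𝓘(𝕜, 𝕜) f 1)
    (X : GroupLieAlgebra I G) :
    dif (I.prod I) f 1 (incl₂ I G X) = dif I (fun x : G => f (1, x)) 1 X :=
  (dif_comp (φ := fun x : G => ((1 : G), x)) hf
    (mdifferentiableAt_const.prodMk mdifferentiableAt_id) X).symm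

variable [LieGroup I 3 G]

lemma dif_leftTrans {f : G → 𝕜} {g : G} (hf : MDifferentiableAt I 𝓘(𝕜, 𝕜) f g)
    (X : GroupLieAlgebra I G) :
    dif I f g (leftTrans I g X) = dif I (fun x : G => f (g * x)) 1 X := by
  have hm : MDifferentiableAt I I (fun x : G => g * x) 1 :=
    (contMDiff_mul_left (n := 3)).contMDiffAt.mdifferentiableAt (by norm_num)
  have e := dif_comp (φ := fun x : G => g * x) (by rwa [mul_one]) hm X
  exact (e.trans (dif_congr_point f (mul_one g) _)).symm

lemma dif_rightTrans {f : G → 𝕜} {g : G} (hf : MDifferentiableAt I 𝓘(𝕜, 𝕜) f g)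
    (X : GroupLieAlgebra I G) :
    dif I f g (rightTrans I g X) = dif I (fun x : G => f (x * g)) 1 X := by
  have hm : MDifferentiableAt I I (fun x : G => x * g) 1 :=
    (contMDiff_mul_right (n := 3)).contMDiffAt.mdifferentiableAt (by norm_num)
  have e := dif_comp (φ := fun x : G => x * g) (by rwa [one_mul]) hm X
  exact (e.trans (dif_congr_point f (one_mul g) _)).symm

lemma mdifferentiableAt_midTrans (a b x : G) : MDifferentiableAt I I (fun x : G => a * x * b) x :=
  ((contMDiff_mul_right (n := 3) (a := b)).comp
    (contMDiff_mul_left (n := 3) (a := a))).contMDiffAt.mdifferentiableAt (by norm_num)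

lemma dif_midTrans {f : G → 𝕜} {a b : G} (hf : MDifferentiableAt I 𝓘(𝕜, 𝕜) f (a * b))
    (X : GroupLieAlgebra I G) :
    dif I f (a * b) (midTrans I a b X) = dif I (fun x : G => f (a * x * b)) 1 X := by
  have e := dif_comp (φ := fun x : G => a * x * b) (by rwa [mul_one])
    (mdifferentiableAt_midTrans a b 1) X
  exact (e.trans (dif_congr_point f (by rw [mul_one]) _)).symm

lemma mdifferentiableAt_mul (z : G × G) :
    MDifferentiableAt (I.prod I) I (fun z : G × G => z.1 * z.2) z :=
  (contMDiff_mul I 3).contMDiffAt.mdifferentiableAt (by norm_num)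

variable (I) in
/-- The differential of the multiplication at `(a, b)`. -/
def mulDeriv (a b : G) : TangentSpace (I.prod I) (a, b) →ₗ[𝕜] TangentSpace I (a * b) :=
  (mfderiv (I.prod I) I (fun z : G × G => z.1 * z.2) (a, b)).toLinearMap

lemma dif_mulDeriv {f : G → 𝕜} {a b : G} (hf : MDifferentiableAt I 𝓘(𝕜, 𝕜) f (a * b))
    (v : TangentSpace (I.prod I) (a, b)) :
    dif I f (a * b) (mulDeriv I a b v) =
      dif (I.prod I) (fun z : G × G => f (z.1 * z.2)) (a, b) v :=
  (dif_comp (φ := fun z : G × G => z.1 * z.2) hf (mdifferentiableAt_mul (a, b)) v).symm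

/-- Under multiplication, left and right translation in one of the factors become left, middle or
right translation. -/
lemma mulDeriv_comp_trans (a b : G) :
    mulDeriv I a b ∘ₗ leftTrans (I.prod I) (a, b) ∘ₗ incl₁ I G = midTrans I a b ∧
    mulDeriv I a b ∘ₗ rightTrans (I.prod I) (a, b) ∘ₗ incl₁ I G = rightTrans I (a * b) ∧
    mulDeriv I a b ∘ₗ leftTrans (I.prod I) (a, b) ∘ₗ incl₂ I G = leftTrans I (a * b) ∧
    mulDeriv I a b ∘ₗ rightTrans (I.prod I) (a, b) ∘ₗ incl₂ I G = midTrans I a b := by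
  have hf₂ {f : G → 𝕜} (hf : ContMDiffAt I 𝓘(𝕜, 𝕜) 2 f (a * b)) :
      MDifferentiableAt (I.prod I) 𝓘(𝕜, 𝕜) (fun z : G × G => f (z.1 * z.2)) (a, b) :=
    (contMDiffAt_comp_mul (by norm_num) hf).mdifferentiableAt (by norm_num)
  have hl {f : G → 𝕜} (hf : ContMDiffAt I 𝓘(𝕜, 𝕜) 2 f (a * b)) : MDifferentiableAt (I.prod I)
      𝓘(𝕜, 𝕜) (fun z : G × G => f (((a, b) * z).1 * ((a, b) * z).2)) 1 :=
    MDifferentiableAt.comp 1 (f := fun z : G × G => (a, b) * z) (by simpa using hf₂ hf)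
      ((contMDiff_mul_left (I := I.prod I) (n := 3)).contMDiffAt.mdifferentiableAt (by norm_num))
  have hr {f : G → 𝕜} (hf : ContMDiffAt I 𝓘(𝕜, 𝕜) 2 f (a * b)) : MDifferentiableAt (I.prod I)
      𝓘(𝕜, 𝕜) (fun z : G × G => f ((z * (a, b)).1 * (z * (a, b)).2)) 1 :=
    MDifferentiableAt.comp 1 (f := fun z : G × G => z * (a, b)) (by simpa using hf₂ hf)
      ((contMDiff_mul_right (I := I.prod I) (n := 3)).contMDiffAt.mdifferentiableAt (by norm_num))
  have h1 {f : G → 𝕜} (hf : ContMDiffAt I 𝓘(𝕜, 𝕜) 2 f (a * b)) := hf.mdifferentiableAt (by norm_num)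
  refine ⟨?_, ?_, ?_, ?_⟩ <;> ext X <;> refine tangent_ext fun f hf => ?_ <;>
    refine (dif_mulDeriv (h1 hf) _).trans ?_
  · refine ((dif_leftTrans (hf₂ hf) _).trans (dif_incl₁ (hl hf) X)).trans ?_
    rw [dif_midTrans (h1 hf)]
    simp
  · refine ((dif_rightTrans (hf₂ hf) _).trans (dif_incl₁ (hr hf) X)).trans ?_
    rw [dif_rightTrans (h1 hf)]
    simp [mul_assoc]
  · refine ((dif_leftTrans (hf₂ hf) _).trans (dif_incl₂ (hl hf) X)).trans ?_
    rw [dif_leftTrans (h1 hf)]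
    simp [mul_assoc]
  · refine ((dif_rightTrans (hf₂ hf) _).trans (dif_incl₂ (hr hf) X)).trans ?_
    rw [dif_midTrans (h1 hf)]
    simp [mul_assoc]

end Translations

section ManifoldMomentum

variable {𝕜 : Type*} [RCLike 𝕜]
  {E : Type*} [NormedAddCommGroup E] [NormedSpace 𝕜 E]
  {HG : Type*} [TopologicalSpace HG] {I : ModelWithCorners 𝕜 E HG}
  {G : Type*} [TopologicalSpace G] [ChartedSpace HG G] [Group G]

/-- The derivative of a conjugation inside a product. -/
lemma dif_mul_conj_mul [LieGroup I 3 G] {f : G → 𝕜} {u v w : G}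
    (hf : MDifferentiableAt I 𝓘(𝕜, 𝕜) f (u * v * w)) (X : GroupLieAlgebra I G) :
    dif I (fun x : G => f (u * (x * v * x⁻¹) * w)) 1 X =
      dif I (fun x : G => f (u * x * (v * w))) 1 X -
        dif I (fun x : G => f (u * v * x * w)) 1 X := by
  have h₁ : MDifferentiableAt (I.prod I) 𝓘(𝕜, 𝕜) (fun z : G × G => f (u * (z.1 * v * z.2) * w))
      ((1 : G), (1 : G)⁻¹) := by
    have : ContMDiff (I.prod I) I 3 (fun z : G × G => u * (z.1 * v * z.2) * w) :=
      (contMDiff_const.mul ((contMDiff_fst.mul contMDiff_const).mul contMDiff_snd)).mul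
        contMDiff_const
    exact MDifferentiableAt.comp _ (f := fun z : G × G => u * (z.1 * v * z.2) * w)
      (by simpa using hf) (this.contMDiffAt.mdifferentiableAt (by norm_num))
  have h₂ : MDifferentiableAt I 𝓘(𝕜, 𝕜) (fun x : G => f (u * v * x * w)) 1 :=
    MDifferentiableAt.comp _ (f := fun x : G => u * v * x * w) (by simpa using hf)
      (mdifferentiableAt_midTrans (u * v) w 1)
  have := dif_prodMk (φ := fun x : G => x) h₁ mdifferentiableAt_id
    ((contMDiff_inv I 3).contMDiffAt.mdifferentiableAt (by norm_num)) X
  rw [this, sub_eq_add_neg, ← dif_inv h₂]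
  simp [mul_assoc]

/-- The linear algebra behind the momentum condition of a fused bivector: `C`, `L` and `R` are the
derivatives of the product of the components with a group element inserted in the middle, on the
right and on the left, and `A₁`, `A₂` are the two infinitesimal actions. -/
lemma momentum_tensor_identity {V S T : Type*} [AddCommGroup V] [Module 𝕜 V] [AddCommGroup S]
    [Module 𝕜 S] [AddCommGroup T] [Module 𝕜 T] (C L R : V →ₗ[𝕜] T) (A₁ A₂ : V →ₗ[𝕜] S)
    (t : V ⊗[𝕜] V) :
    TensorProduct.map ((2 : 𝕜)⁻¹ • (C + R)) A₁ t + TensorProduct.map ((2 : 𝕜)⁻¹ • (L + C)) A₂ t -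
        (2 : 𝕜)⁻¹ • (TensorProduct.map (C - R) A₂ t - TensorProduct.map (L - C) A₁ t) =
      TensorProduct.map ((2 : 𝕜)⁻¹ • (L + R)) (A₁ + A₂) t := by
  induction t with
  | zero => simp
  | tmul x y =>
    simp only [TensorProduct.map_tmul, LinearMap.smul_apply, LinearMap.add_apply,
      LinearMap.sub_apply, ← TensorProduct.smul_tmul', TensorProduct.add_tmul,
      TensorProduct.sub_tmul, TensorProduct.tmul_add, smul_add]
    module
  | add s t hs ht =>
    simp only [map_add, ← hs, ← ht]
    module

variable [I.Boundaryless]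
  {F : Type*} [NormedAddCommGroup F] [NormedSpace 𝕜 F]
  {HM : Type*} [TopologicalSpace HM] {J : ModelWithCorners 𝕜 F HM} [J.Boundaryless]
  {M : Type*} [TopologicalSpace M] [ChartedSpace HM M] [MulAction (G × G) M]
  {n : WithTop ℕ∞} [LieGroup I n G] [IsManifold J n M]
  [ContMDiffSMul (I.prod I) J n (G × G) M]
  {H : GroupLieAlgebra I G ⊗[𝕜] GroupLieAlgebra I G} {P : TensorField₂ J M}

/-- The product of the components of a momentum mapping is a momentum mapping for the fused
bivector. -/
theorem isMomentumMap_fusion (hn : ∞ ≤ n) (hH : IsInvSymm I H) {Φ₁ Φ₂ : M → G}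
    (hΦ : IsMomentumMap (I.prod I) J n (doubled (incl₁ I G) (incl₂ I G) H) P
      (fun q => (Φ₁ q, Φ₂ q))) :
    letI := diagAction G M
    IsMomentumMap I J n H (fusion I J H P) (fun q => Φ₁ q * Φ₂ q) := by
  let := diagAction G M
  have hn1 : (1 : WithTop ℕ∞) ≤ n := natCast_le_of_infty_le hn 1
  have hn3 : (3 : WithTop ℕ∞) ≤ n := natCast_le_of_infty_le hn 3
  have : LieGroup I 3 G := LieGroup.of_le hn3
  have : IsManifold J 3 M := IsManifold.of_le hn3
  have hΦc : ContMDiff J I n fun q => Φ₁ q * Φ₂ q := (contMDiff_mul I n).comp hΦ.contMDiff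
  have hequi (g h : G) (q : M) : Φ₁ ((g, h) • q) = g * Φ₁ q * g⁻¹ ∧
      Φ₂ ((g, h) • q) = h * Φ₂ q * h⁻¹ := Prod.ext_iff.1 (hΦ.equivariant (g, h) q)
  refine ⟨isInvBivector_fusion hn hH hΦ.bivector, hΦc, fun g q => ?_, fun q => ?_⟩
  · change Φ₁ ((g, g) • q) * Φ₂ ((g, g) • q) = _
    rw [(hequi g g q).1, (hequi g g q).2]
    group
  set a := Φ₁ q with ha
  set b := Φ₂ q with hb
  let T : TangentSpace J q →ₗ[𝕜] TangentSpace I (a * b) :=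
    (mfderiv J I (fun q => Φ₁ q * Φ₂ q) q).toLinearMap
  let S := fund (G := G × G) (I.prod I) J q
  have hΦd : MDifferentiableAt J I (fun q => Φ₁ q * Φ₂ q) q :=
    hΦc.contMDiffAt.mdifferentiableAt (by positivity)
  have hT {f : G → 𝕜} (hf : MDifferentiableAt I 𝓘(𝕜, 𝕜) f (a * b)) (v : TangentSpace J q) :
      dif I f (a * b) (T v) = dif J (fun q => f (Φ₁ q * Φ₂ q)) q v :=
    (dif_comp (φ := fun q => Φ₁ q * Φ₂ q) hf hΦd v).symm
  -- The momentum mapping maps fundamental vector fields to those of the conjugation action.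
  have hT₁ : T ∘ₗ S ∘ₗ incl₁ I G = midTrans I a b - rightTrans I (a * b) := by
    ext X
    refine tangent_ext fun f hf => ?_
    have hf' := hf.mdifferentiableAt (by norm_num)
    refine (hT hf' _).trans ?_
    have hc := dif_mul_conj_mul (u := 1) (v := a) (w := b) (by rwa [one_mul]) X
    refine (isFundHom_incl₁ hn1 X _ q (hf'.comp q hΦd)).symm.trans ?_
    rw [LinearMap.sub_apply, map_sub, dif_midTrans hf', dif_rightTrans hf', orbitDeriv]
    simp only [Function.comp_apply, hequi, ← ha, ← hb, inv_one, mul_one, one_mul] at hc ⊢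
    rw [hc, neg_sub]
  have hT₂ : T ∘ₗ S ∘ₗ incl₂ I G = leftTrans I (a * b) - midTrans I a b := by
    ext X
    refine tangent_ext fun f hf => ?_
    have hf' := hf.mdifferentiableAt (by norm_num)
    refine (hT hf' _).trans ?_
    have hc := dif_mul_conj_mul (u := a) (v := b) (w := 1) (by rwa [mul_one]) X
    refine (isFundHom_incl₂ hn1 X _ q (hf'.comp q hΦd)).symm.trans ?_
    rw [LinearMap.sub_apply, map_sub, dif_midTrans hf', dif_leftTrans hf', orbitDeriv]
    simp only [Function.comp_apply, hequi, ← ha, ← hb, inv_one, mul_one, one_mul] at hc ⊢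
    simp only [← mul_assoc] at hc
    simp only [← mul_assoc, hc, neg_sub]
  have hTP : TensorProduct.map T LinearMap.id (P q) =
      TensorProduct.map ((2 : 𝕜)⁻¹ • (midTrans I a b + rightTrans I (a * b))) (S ∘ₗ incl₁ I G) H +
      TensorProduct.map ((2 : 𝕜)⁻¹ • (leftTrans I (a * b) + midTrans I a b))
        (S ∘ₗ incl₂ I G) H := by
    have hTc : T = mulDeriv I a b ∘ₗ (mfderiv J (I.prod I) (fun q => (Φ₁ q, Φ₂ q)) q).toLinearMap :=
      LinearMap.ext fun v => congrArg (fun T : F →L[𝕜] E => T v)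
        (mfderiv_comp q (mdifferentiableAt_mul (a, b))
          (hΦ.contMDiff.contMDiffAt.mdifferentiableAt (by positivity)))
    have := congrArg (TensorProduct.map (mulDeriv I a b) LinearMap.id) (hΦ.momentum q)
    rw [map_map, ← hTc, doubled, map_add, map_add, map_map, map_map, map_map, map_map] at this
    obtain ⟨h₁, h₂, h₃, h₄⟩ := mulDeriv_comp_trans (I := I) a b
    have e₁ : mulDeriv I a b ∘ₗ ((2 : 𝕜)⁻¹ • (leftTrans (I.prod I) (a, b) +
        rightTrans (I.prod I) (a, b))) ∘ₗ incl₁ I G =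
          (2 : 𝕜)⁻¹ • (midTrans I a b + rightTrans I (a * b)) := by
      rw [← h₁, ← h₂, LinearMap.smul_comp, LinearMap.add_comp, LinearMap.comp_smul,
        LinearMap.comp_add]
    have e₂ : mulDeriv I a b ∘ₗ ((2 : 𝕜)⁻¹ • (leftTrans (I.prod I) (a, b) +
        rightTrans (I.prod I) (a, b))) ∘ₗ incl₂ I G =
          (2 : 𝕜)⁻¹ • (leftTrans I (a * b) + midTrans I a b) := by
      rw [← h₃, ← h₄, LinearMap.smul_comp, LinearMap.add_comp, LinearMap.comp_smul,
        LinearMap.comp_add]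
    rw [← e₁, ← e₂]
    exact this
  have hTχ : TensorProduct.map T LinearMap.id
      (TensorProduct.map S S (chi (incl₁ I G) (incl₂ I G) H)) =
      (2 : 𝕜)⁻¹ • (TensorProduct.map (midTrans I a b - rightTrans I (a * b)) (S ∘ₗ incl₂ I G) H -
        TensorProduct.map (leftTrans I (a * b) - midTrans I a b) (S ∘ₗ incl₁ I G) H) := by
    simp only [chi, map_smul, map_sub, map_map_comm, hH.symm, map_map]
    rw [hT₁, hT₂, LinearMap.id_comp, LinearMap.id_comp]
  change TensorProduct.map T LinearMap.id (P q - TensorProduct.map S S _) =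
    TensorProduct.map ((2 : 𝕜)⁻¹ • (leftTrans I (a * b) + rightTrans I (a * b))) (fund I J q) H
  rw [map_sub, hTP, hTχ, momentum_tensor_identity, fund_diagAction hn1, LinearMap.comp_add]

end ManifoldMomentum

end QPoisson

end

theorem theorem6 :
    -- smooth real manifolds, and analytic manifolds over the real or complex numbers
    (∀ (𝕜 : Type*) [RCLike 𝕜] (n : WithTop ℕ∞) (hn : ∞ ≤ n)
      (E : Type*) [NormedAddCommGroup E] [NormedSpace 𝕜 E] [FiniteDimensional 𝕜 E]
      (G : Type*) [TopologicalSpace G] [ChartedSpace E G] [Group G] [LieGroup 𝓘(𝕜, E) n G]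
      (F : Type*) [NormedAddCommGroup F] [NormedSpace 𝕜 F] [FiniteDimensional 𝕜 F]
      (M : Type*) [TopologicalSpace M] [ChartedSpace F M] [IsManifold 𝓘(𝕜, F) n M]
      [MulAction (G × G) M]
      [ContMDiffSMul (𝓘(𝕜, E).prod 𝓘(𝕜, E)) 𝓘(𝕜, F) n (G × G) M]
      (H : GroupLieAlgebra 𝓘(𝕜, E) G ⊗[𝕜] GroupLieAlgebra 𝓘(𝕜, E) G)
      (_ : QPoisson.IsInvSymm 𝓘(𝕜, E) H)
      (P : QPoisson.TensorField₂ 𝓘(𝕜, F) M)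
      (_ : QPoisson.IsInvBivector (G × G) 𝓘(𝕜, F) n P),
      haveI : CompleteSpace E := FiniteDimensional.complete 𝕜 E
      letI HH := QPoisson.doubled (QPoisson.incl₁ 𝓘(𝕜, E) G) (QPoisson.incl₂ 𝓘(𝕜, E) G) H
      letI Pfus := QPoisson.fusion 𝓘(𝕜, E) 𝓘(𝕜, F) H P
      (∀ Φ₁ Φ₂ : M → G,
        QPoisson.IsMomentumMap (𝓘(𝕜, E).prod 𝓘(𝕜, E)) 𝓘(𝕜, F) n HH P
          (fun q => (Φ₁ q, Φ₂ q)) →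
        letI := QPoisson.diagAction G M
        QPoisson.IsMomentumMap 𝓘(𝕜, E) 𝓘(𝕜, F) n H Pfus (fun q => Φ₁ q * Φ₂ q)) ∧
      (QPoisson.IsQuasiPoisson (G := G × G) (𝓘(𝕜, E).prod 𝓘(𝕜, E)) 𝓘(𝕜, F) n hn HH P →
        letI := QPoisson.diagAction G M
        QPoisson.IsQuasiPoisson (G := G) 𝓘(𝕜, E) 𝓘(𝕜, F) n hn H Pfus)) ∧
    -- affine algebraic groups and non-singular affine varieties
    (∀ (K : Type*) [Field K] [CharZero K]
      (A : Type*) [CommRing A] [HopfAlgebra K A] [Algebra.FiniteType K A]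
      (B : Type*) [CommRing B] [Algebra K B] [Algebra.Smooth K B]
      (ρ : B →ₐ[K] (A ⊗[K] A) ⊗[K] B) (_ : QPoisson.IsCoaction ρ)
      (H : QPoisson.Lie (K := K) A ⊗[K] QPoisson.Lie (K := K) A) (_ : QPoisson.IsAlgInvSymm H)
      (P : B →ₗ[K] B →ₗ[K] B) (_ : QPoisson.IsAlgInvBivector ρ P),
      letI HH := QPoisson.doubled (QPoisson.algIncl₁ K A) (QPoisson.algIncl₂ K A) H
      (∀ Φ₁ Φ₂ : A →ₐ[K] B,
        QPoisson.IsAlgMomentumMap ρ HH P (Algebra.TensorProduct.productMap Φ₁ Φ₂) →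
        QPoisson.IsAlgMomentumMap (QPoisson.diagCoaction ρ) H (QPoisson.algFusion ρ H P)
          (QPoisson.mulComorphism Φ₁ Φ₂)) ∧
      (QPoisson.IsAlgQuasiPoisson ρ HH P →
        QPoisson.IsAlgQuasiPoisson (QPoisson.diagCoaction ρ) H (QPoisson.algFusion ρ H P))) := by
  refine ⟨?_, ?_⟩
  · intro 𝕜 _ n hn E _ _ _ G _ _ _ _ F _ _ _ M _ _ _ _ _ H hH P hP
    have : CompleteSpace E := FiniteDimensional.complete 𝕜 E
    exact ⟨fun Φ₁ Φ₂ hΦ => QPoisson.isMomentumMap_fusion hn hH hΦ,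
      fun hP' => QPoisson.isQuasiPoisson_fusion hn hH hP'⟩
  · intro K _ _ A _ _ _ B _ _ _ ρ hρ H hH P hP
    exact ⟨fun Φ₁ Φ₂ hΦ => QPoisson.isAlgMomentumMap_mulComorphism hρ hH hP hΦ,
      fun hP' => QPoisson.isAlgQuasiPoisson_algFusion hρ hH hP'⟩
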